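/- **Setting.** Let $N$ be a nilpotent normal subgroup of a finite group $G$, and let $\mathrm V(\mathbb ZG,N)$ be the group of units of $\mathbb ZG$ that map to $1$ in $\mathbb Z(G/N)$. Two elements of finite order are locally $G$-conjugate if their $r$-parts are $G$-conjugate for every prime $r$. *HeLP restrictions.* A class function $\varepsilon\colon G\to\mathbb Z$ satisfies the HeLP restrictions for elements $u$ of order $n$ in $\mathrm V(\mathbb ZG,N)$ if there are $m\in N$ of order $n$ and integral class functions $\varepsilon_d$ ($d\mid n$, candidates for the partial augmentations of $u^d$) with $\varepsilon_1=\varepsilon$ such that $\varepsilon_d$ vanishes outside the local $G$-class of $m^d$, its values on the conjugacy classes add up to $1$, and for every ordinary character $\chi$ of $G$, every Brauer character $\chi$ of $G$ modulo a prime not dividing $n$, and every complex $n$-th root of unity $\xi$ the number $$\frac1n\sum_{d\mid n}\operatorname{Tr}_{\mathbb Q(\zeta_n^d)/\mathbb Q}\Big(\sum_{C}\varepsilon_d(C)\chi(C)\,\xi^{-d}\Big)$$ is a non-negative integer, where $C$ runs over the conjugacy classes of $G$ on which $\varepsilon_d\ne0$. *Algorithm restrictions.* For a group $G$ acting on a finite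 abelian group $A$ and $H\le G$ let $\mathcal E(G,H,A)$ be the set of functions $f\colon A\to\mathbb Z$, constant on $H$-classes, such that (I) the values of $f$ on the $H$-classes add up to $1$; (II) $f$ vanishes outside one local $G$-class; (III) $\sum_{c\in C}|C_H(c)|f(c)\ge0$ for every coset $C$ of a minimal subgroup of $A$ with cyclic quotient; (IV) $f(a)\ge-h_A[C_H(a_\pi):C_H(a)]$ for all $a\in A$, where $\pi$ is the set of primes $r$ dividing $|A|$ with $A_r$ cyclic and $$h_A=\frac{\sum_{X}\prod_{r}(r^{k_r-\Delta_X(r)}-1)}{\prod_{r}(r-1)r^{k_r-1}},$$ $r$ running over the primes dividing $|A|$, $X$ over the sets of odd cardinality of such primes, $\Delta_X$ being the characteristic function of $X$ and $k_r$ the rank of the socle of $A_r$; (V) $f(a)<0$ for some $a$. If $p$ is a prime such that $N_{p'}$ is abelian, the algorithm with input $(G,N,p)$ lists the functions $\varepsilon$ with $\varepsilon(n)=f(n_{p'}^g)$ if $n\in N$ and $n_p^g=y$ for some $g\in G$, and $\varepsilon(n)=0$ otherwise, for $y\in N_p$ and $f\in\mathcal E(G,C_G(y),N_{p'})$; it returns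 `true` if the list is empty. A function satisfies the restrictions of the algorithm if it is in the list or is the characteristic function of the $G$-class of an element of $N$. *Groups of type $G_d(p,q)$.* Let $p\ne q$ be primes, $d$ a common divisor of $p^2-1$ and $q^2-1$, and $\alpha,\beta$ generators of $\mathbb F_{p^2}^\times,\mathbb F_{q^2}^\times$. Let $N$ be the additive group of $\mathbb F_{p^2}\times\mathbb F_{q^2}$, $H=\langle a,b,c\rangle\le\operatorname{Aut}(N)$ with $(x,y)^a=(\alpha^dx,y)$, $(x,y)^b=(x,\beta^dy)$, $(x,y)^c=(\alpha x,\beta y)$, and $G_d(\alpha,\beta)=N\rtimes H$. Put $m_i=(1,\beta^i)$ for $0\le i<d$. A list $(x_0,\dots,x_{d-1})$ of integers satisfies the HeLP restrictions for elements of order $pq$ if $x_i=\varepsilon(m_i)$ for some $\varepsilon$ satisfying them. For a character $\chi$ let $\mu(\chi,g,\xi)$ be the multiplicity of $\xi$ as an eigenvalue of $g$ in a representation affording $\chi$. Fix primitive roots of unity $\zeta_p,\zeta_q\in\mathbb C$, let $\psi_0$ be the linear character of $N$ with kernel $\langle(1,1)\rangle$ and $\psi_0(\alpha,\beta)=\zeta_p\zeta_q$,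 and let $\chi_0=\operatorname{ind}_N^G\psi_0$. **Statement.** 1. Let $G=G_d(\alpha,\beta)$ be of type $G_d(p,q)$ with $d$ coprime to $\gcd(p+1,q+1)$. Then $\psi_0$ exists, and for integers $x_0,\dots,x_{d-1}$ the following are equivalent: (a) the list satisfies the HeLP restrictions for elements of order $pq$ of $\mathrm V(\mathbb ZG,N)$; (b) $\sum_ix_i=1$ and $\sum_i\mu(\chi,m_i,\xi)x_i\ge0$ for all characters $\chi$ of $G$ and all $\xi$ with $\xi^{pq}=1$; (c) $\sum_ix_i=1$ and $\sum_i\mu(\chi_0,m_i,\xi)x_i\ge0$ for all $\xi$ with $\xi^{pq}=1$. 2. Let $G=G_3(\alpha,\beta)$ be any group of type $G_3(5,7)$. Then the HeLP method cannot prove that the units of order $35$ in $\mathrm V(\mathbb ZG,N)$ are rationally conjugate to elements of $G$: the HeLP restrictions admit a function with a negative value. More precisely, $(2,0,-1)$ or $(2,-1,0)$ satisfies the HeLP restrictions for $(\alpha,\beta)$, and there are generators $\alpha',\beta'$ defining the same group $H$, hence the same group $G_3(\alpha',\beta')=G$, for which $(2,0,-1)$ satisfies them. On the other hand the algorithm with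 input $(G,N,7)$ returns `true`. 3. The restrictions of the algorithm are strictly stronger than those of the HeLP method: for every finite group $G$, every nilpotent normal subgroup $N$ and every prime $p$ with $N_{p'}$ abelian, each function that satisfies the restrictions of the algorithm satisfies the HeLP restrictions for some order $n$; and for every group $G$ of type $G_3(5,7)$ and $p=7$ the first set of functions is strictly contained in the second. -/

import Mathlib

/-! Torsion units in `V(ℤG, N)`: the restrictions on their partial augmentations coming from the
HeLP method and from the algorithm based on the Cliff-Weiss inequalities, and the groups
`G_d(α, β)`. -/

noncomputable section

namespace ZGUnits

open scoped Classical in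
/-- The `π`-part of the natural number `n`. -/
def piNat (π : Set ℕ) (n : ℕ) : ℕ :=
  ∏ p ∈ n.primeFactors with p ∈ π, p ^ n.factorization p

section General

variable {G : Type*} [Group G]

/-- The `π`-part `g_π` of an element `g` of finite order `n`: the exponent is `1` modulo the
`π`-part of `n` (by Euler's theorem) and `0` modulo the `π'`-part of `n`. -/
def piPart (π : Set ℕ) (g : G) : G :=
  g ^ (piNat πᶜ (orderOf g) ^ Nat.totient (piNat π (orderOf g)))

/-- For a finite nilpotent `N` the set below is already a subgroup, so that `hall π N` is the Hall
`π`-subgroup `N_π` of `N`. -/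
def hall (π : Set ℕ) (N : Subgroup G) : Subgroup G :=
  Subgroup.closure {x | x ∈ N ∧ ∀ q : ℕ, q.Prime → q ∣ orderOf x → q ∈ π}

instance hall_normal (π : Set ℕ) (N : Subgroup G) [hN : N.Normal] : (hall π N).Normal := by
  have key : ∀ g : G, (hall π N).map (MulAut.conj g).toMonoidHom ≤ hall π N := by
    intro g
    unfold hall
    rw [MonoidHom.map_closure, Subgroup.closure_le]
    rintro _ ⟨x, ⟨hx, hq⟩, rfl⟩
    refine Subgroup.subset_closure ⟨hN.conj_mem x hx g, fun q hp hd => hq q hp ?_⟩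
    have h : orderOf ((MulAut.conj g).toMonoidHom x) = orderOf x :=
      MulEquiv.orderOf_eq (MulAut.conj g) x
    rwa [h] at hd
  exact ⟨fun x hx g => key g ⟨x, hx, rfl⟩⟩

variable {M : Type*} [Group M]

/-- The `H`-classes in `M`, for a subgroup `H` of a group `G` acting on `M` through `φ`. -/
def classSetoid (φ : G →* MulAut M) (H : Subgroup G) : Setoid M where
  r x y := ∃ h ∈ H, φ h x = y
  iseqv :=
    { refl := fun x => ⟨1, H.one_mem, by simp⟩
      symm := by
        rintro x y ⟨h, hh, rfl⟩
        exact ⟨h⁻¹, H.inv_mem hh, by simp⟩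
      trans := by
        rintro x y z ⟨h, hh, rfl⟩ ⟨k, hk, rfl⟩
        exact ⟨k * h, H.mul_mem hk hh, by simp⟩ }

/-- The sum of `F` over the set `Cl_H(M)` of `H`-classes, for a function `F` that is constant on
`H`-classes. -/
def classSum {R : Type*} [AddCommMonoid R] (φ : G →* MulAut M) (H : Subgroup G) (F : M → R) : R :=
  ∑ᶠ X : Quotient (classSetoid φ H), F X.out

/-- `x` and `y` are locally `G`-conjugate: their `p`-parts are `G`-conjugate for every prime `p`. -/
def LocallyConj (φ : G →* MulAut M) (x y : M) : Prop :=
  ∀ p : ℕ, p.Prime → ∃ g : G, φ g (piPart {p} x) = piPart {p} y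

/-- `C_H(a)`, for `H` acting through `φ`. -/
def fixer (φ : G →* MulAut M) (H : Subgroup G) (a : M) : Subgroup G where
  carrier := {h | h ∈ H ∧ φ h a = a}
  one_mem' := ⟨H.one_mem, by simp⟩
  mul_mem' := by
    rintro x y ⟨hx, hx'⟩ ⟨hy, hy'⟩
    exact ⟨H.mul_mem hx hy, by simp [hx', hy']⟩
  inv_mem' := by
    rintro x ⟨hx, hx'⟩
    refine ⟨H.inv_mem hx, ?_⟩
    conv_lhs => rw [← hx']
    simp

/-! ### The restrictions of the HeLP method -/

/-- The value at `g` of the Brauer character of `ρ` with respect to the lift `θ` of roots of unity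
of `F` to `ℂ`. For `F = ℂ` and `θ = id` it is the trace of `ρ g`. -/
def brauerChar {F : Type*} [Field F] (θ : F →*₀ ℂ) {r : ℕ} (ρ : Representation F G (Fin r → F))
    (g : G) : ℂ :=
  ((ρ g).charpoly.roots.map θ).sum

/-- The HeLP restrictions (Luthar-Passi for ordinary characters, Hertweck for Brauer characters) on
a torsion unit `u ∈ V(ℤG, N)` that is locally rationally conjugate to `m ∈ N`, in terms of the
candidates `ε d` for the partial augmentations of `u ^ d`, where `d` divides the order `n` of `u`.

With `χ(u ^ d) = ∑_C ε d C χ(C)`, the number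
`(1 / n) ∑_{d ∣ n} Tr_{ℚ(ζ_n ^ d) / ℚ} (χ(u ^ d) ξ ^ (-d))`, which is the multiplicity of `ξ` as an
eigenvalue of the image of `u`, has to be a non-negative integer. The exponents `k < n` with
`gcd(k, n) = d` run over the Galois conjugates that make up the trace with index `d`: the
automorphism `ζ ↦ ζ ^ j` takes `χ(g)` to `χ(g ^ j)`. The field `F` runs over the
algebraically closed fields whose characteristic does not divide `n`. -/
structure HeLPSystem (m : G) (ε : ℕ → G → ℤ) : Prop where
  classFun : ∀ d, d ∣ orderOf m → ∀ g x : G, ε d (g * x * g⁻¹) = ε d x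
  support : ∀ d, d ∣ orderOf m → ∀ x : G, ε d x ≠ 0 → LocallyConj MulAut.conj (m ^ d) x
  sumOne : ∀ d, d ∣ orderOf m → classSum MulAut.conj ⊤ (ε d) = 1
  multiplicity : ∀ (F : Type) [Field F] [IsAlgClosed F], (orderOf m : F) ≠ 0 →
    ∀ θ : F →*₀ ℂ, (∀ x : F, x ^ orderOf m = 1 → θ x = 1 → x = 1) →
    ∀ (r : ℕ) (ρ : Representation F G (Fin r → F)) (ξ : ℂ), ξ ^ orderOf m = 1 →
      ∃ μ : ℕ,
        (1 / (orderOf m : ℂ)) * ∑ k ∈ Finset.range (orderOf m), ξ⁻¹ ^ k *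
          classSum MulAut.conj ⊤ (fun g : G =>
            (ε (Nat.gcd k (orderOf m)) g : ℂ) *
              brauerChar θ ρ (g ^ (k / Nat.gcd k (orderOf m)))) = μ

/-- `ε` satisfies the HeLP restrictions on the partial augmentations `g ↦ ε_g(u)` of an element `u`
of order `n` of `V(ℤG, N)`. -/
def HeLPAdmissible (N : Subgroup G) (n : ℕ) (ε : G → ℤ) : Prop :=
  ∃ m ∈ N, orderOf m = n ∧ ∃ E : ℕ → G → ℤ, HeLPSystem m E ∧ E 1 = ε

/-- The HeLP restrictions prove that all units of order `n` in `V(ℤG, N)` are rationally conjugate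
to elements of `G`: they force all partial augmentations to be non-negative. -/
def HeLPSolves (N : Subgroup G) (n : ℕ) : Prop :=
  ∀ ε : G → ℤ, HeLPAdmissible N n ε → ∀ g, 0 ≤ ε g

/-- `μ(χ, g, ξ)`, the multiplicity of `ξ` as an eigenvalue of `ρ g`. As `g` has finite order, `ρ g`
is diagonalizable, so that there is no difference between the two kinds of multiplicity. -/
def mult {V : Type*} [AddCommGroup V] [Module ℂ V] (ρ : Representation ℂ G V) (g : G) (ξ : ℂ) : ℕ :=
  Module.finrank ℂ (Module.End.eigenspace (ρ g) ξ)

/-! ### The restrictions of the algorithm -/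

/-- The rank of the socle of the Sylow `p`-subgroup of a finite abelian group `A`, i.e. the number
of factors in a decomposition of `A_p` as a product of non-trivial cyclic groups. -/
def socleRank (A : Type*) [Group A] (p : ℕ) : ℕ :=
  Nat.log p (Nat.card {a : A // a ^ p = 1})

open scoped Classical in
/-- The number `h_A` of a finite abelian group `A`. -/
def hNum (A : Type*) [Group A] : ℚ :=
  (∑ X ∈ (Nat.card A).primeFactors.powerset with Odd X.card,
      ∏ p ∈ (Nat.card A).primeFactors,
        ((p : ℚ) ^ (socleRank A p - if p ∈ X then 1 else 0) - 1)) /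
    ∏ p ∈ (Nat.card A).primeFactors, (((p : ℚ) - 1) * (p : ℚ) ^ (socleRank A p - 1))

/-- Normal subgroups with cyclic quotient. -/
def IsCocyclic {A : Type*} [Group A] (K : Subgroup A) : Prop :=
  ∃ _ : K.Normal, IsCyclic (A ⧸ K)

/-- The set of primes `p` dividing `|A|` for which `A_p` is cyclic. -/
def cyclicPrimes (A : Type*) [Group A] : Set ℕ :=
  {p | p.Prime ∧ p ∣ Nat.card A ∧ IsCyclic (hall {p} (⊤ : Subgroup A))}

/-- The set `𝓔(G, H, A)`, for `G` acting on the finite abelian group `A` through `φ`. -/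
structure MemE {A : Type*} [Group A] (φ : G →* MulAut A) (H : Subgroup G) (f : A → ℤ) : Prop where
  classFun : ∀ h ∈ H, ∀ a, f (φ h a) = f a
  sumOne : classSum φ H f = 1
  support : ∃ a₀, ∀ a, f a ≠ 0 → LocallyConj φ a₀ a
  cosetIneq : ∀ K : Subgroup A, Minimal IsCocyclic K → ∀ a : A,
    0 ≤ ∑ᶠ c ∈ {c : A | a⁻¹ * c ∈ K}, (Nat.card (fixer φ H c) : ℤ) * f c
  lowerBound : ∀ a, (f a : ℚ) ≥
    -hNum A * ((fixer φ H a).relIndex (fixer φ H (piPart (cyclicPrimes A) a)) : ℚ)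
  negative : ∃ a, f a < 0

/-- The list returned by the algorithm with input `G`, `N`, `p`, where `N` is a nilpotent normal
subgroup of the finite group `G` such that `N_{p'}` is abelian; the algorithm returns `true` if it is
empty. The functions are extended by `0` to `G`. Conjugate elements `y` of `N_p` contribute the same
functions, so that `y` may run over all of `N_p` in place of a set of representatives. -/
def algOutput (N : Subgroup G) [N.Normal] (p : ℕ) : Set (G → ℤ) :=
  {ε | ∃ y ∈ hall {p} N, ∃ f : hall {p}ᶜ N → ℤ,
    MemE (MulAut.conjNormal : G →* MulAut (hall {p}ᶜ N)) (Subgroup.centralizer {y}) f ∧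
    (∀ n ∈ N, ∀ (g : G) (a : hall {p}ᶜ N), g * piPart {p} n * g⁻¹ = y →
      g * piPart {p}ᶜ n * g⁻¹ = a → ε n = f a) ∧
    (∀ n : G, n ∉ N ∨ (¬ ∃ g : G, g * piPart {p} n * g⁻¹ = y) → ε n = 0)}

open scoped Classical in
/-- `ε` satisfies the restrictions provided by the algorithm on the partial augmentations of torsion
elements of `V(ℤG, N)`: either it is the function of partial augmentations of an element of `N`, or
it is in the list returned by the algorithm. -/
def AlgAdmissible (N : Subgroup G) [N.Normal] (p : ℕ) (ε : G → ℤ) : Prop :=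
  (∃ n ∈ N, ε = fun g => if IsConj n g then 1 else 0) ∨ ε ∈ algOutput N p

end General

/-! ### The groups `G_d(α, β)` -/

section Groups

variable {K L : Type*} [Field K] [Field L]

/-- The automorphism `(x, y) ↦ (s x, t y)` of the additive group of `K × L`. -/
def scaleAut (s : Kˣ) (t : Lˣ) : MulAut (Multiplicative (K × L)) :=
  AddEquiv.toMultiplicative
    (AddEquiv.prodCongr (DistribMulAction.toAddEquiv K s) (DistribMulAction.toAddEquiv L t))

/-- The group `H = ⟨a, b, c⟩` of automorphisms of the additive group of `K × L`. -/
def actGroup (d : ℕ) (α : Kˣ) (β : Lˣ) : Subgroup (MulAut (Multiplicative (K × L))) :=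
  Subgroup.closure {scaleAut (α ^ d) 1, scaleAut 1 (β ^ d), scaleAut α β}

/-- The group `G_d(α, β) = N ⋊ H`. -/
abbrev Gd (d : ℕ) (α : Kˣ) (β : Lˣ) : Type _ :=
  Multiplicative (K × L) ⋊[(actGroup d α β).subtype] actGroup d α β

/-- The normal subgroup `N` of `G_d(α, β)`. -/
def baseN (d : ℕ) (α : Kˣ) (β : Lˣ) : Subgroup (Gd d α β) :=
  (SemidirectProduct.inl : Multiplicative (K × L) →* Gd d α β).range

instance baseN_normal (d : ℕ) (α : Kˣ) (β : Lˣ) : (baseN d α β).Normal := by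
  unfold baseN
  rw [SemidirectProduct.range_inl_eq_ker_rightHom]
  infer_instance

/-- The element `m_i = (1, β ^ i)` of `N`. -/
def mElt (d : ℕ) (α : Kˣ) (β : Lˣ) (i : ℕ) : Gd d α β :=
  SemidirectProduct.inl (Multiplicative.ofAdd (1, (β : L) ^ i))

/-- The list `x` satisfies the restrictions on the partial augmentations at `m_0, …, m_{d-1}` that
the HeLP method provides for elements of order `n` of `V(ℤG, N)`, where `G = G_d(α, β)`. -/
def HeLPVector (d : ℕ) (α : Kˣ) (β : Lˣ) (n : ℕ) (x : Fin d → ℤ) : Prop :=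
  ∃ ε : Gd d α β → ℤ, HeLPAdmissible (baseN d α β) n ε ∧ ∀ i : Fin d, ε (mElt d α β i) = x i

/-- `x_0 + ⋯ + x_{d-1} = 1` and `∑ μ(χ, m_i, ξ) x_i ≥ 0` for all `n`-th roots of unity `ξ`, where
`χ` is the character afforded by `ρ`. -/
def CharIneq (d : ℕ) (α : Kˣ) (β : Lˣ) (n : ℕ) (x : Fin d → ℤ) {V : Type*} [AddCommGroup V]
    [Module ℂ V] (ρ : Representation ℂ (Gd d α β) V) : Prop :=
  ∑ i, x i = 1 ∧ ∀ ξ : ℂ, ξ ^ n = 1 → 0 ≤ ∑ i : Fin d, (mult ρ (mElt d α β i) ξ : ℤ) * x i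

/-- The representation of degree one that affords a linear character. -/
def linRep {A : Type*} [Group A] (ψ : A →* ℂˣ) : Representation ℂ A ℂ :=
  ((Algebra.lmul ℂ ℂ : ℂ →ₐ[ℂ] Module.End ℂ ℂ) : ℂ →* Module.End ℂ ℂ).comp
    ((Units.coeHom ℂ).comp ψ)

/-- `ψ` is the linear character `ψ_0` of `N`: its kernel is generated by `(1, 1)`, and it maps
`(α, β)` to `ζ_p ζ_q`. -/
def IsPsiZero (α : Kˣ) (β : Lˣ) (ζp ζq : ℂ) (ψ : Multiplicative (K × L) →* ℂˣ) : Prop :=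
  ψ.ker = Subgroup.zpowers (Multiplicative.ofAdd (1, 1)) ∧
    (ψ (Multiplicative.ofAdd ((α : K), (β : L))) : ℂ) = ζp * ζq

/-- The representation of `G_d(α, β)` induced by the linear character `ψ` of `N`. -/
def chiRep (d : ℕ) (α : Kˣ) (β : Lˣ) (ψ : Multiplicative (K × L) →* ℂˣ) :=
  Representation.ind (SemidirectProduct.inl : Multiplicative (K × L) →* Gd d α β) (linRep ψ)

end Groups

end ZGUnits

end

noncomputable section

namespace ZGUnits

/-! ### Simultaneous triangularization -/

section Triangular

open Polynomial Module

variable {F : Type*} [Field F]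

/-! All elements that matter lie in commutative subgroups. A representation restricted to such a
subgroup can be triangularized over an algebraically closed field of any characteristic
(`exists_charpoly_eq_prod`), so the multiplicity of an eigenvalue at `g` is the number of linear
characters, from a list independent of `g`, with a prescribed value at `g`. This treats ordinary and
Brauer characters at once. As candidates for the powers of `u` one takes the push-forwards of `ε`
under the power maps (`powAug`). Fourier inversion on a cyclic group then turns the HeLP expression
into the combination of the multiplicities of `ξ` with coefficients `ε`, so only its sign has to be
checked (`heLPSystem_powAug`).

The algorithm implies HeLP: for `ε` coming from `y` and `f`, orbit counting turns the sum over
classes into a sum over `A` weighted by `|C_H(a)|`. Every linear character contributes the weighted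
sum of `f` over one of its fibres in `A`. A fibre is a union of cosets of a minimal subgroup with
cyclic quotient, and condition (III) applies.

For `G_d(α, β)` the elements of `N` of order `pq` fall into the classes of the `m_i`, while elements
of each smaller order form one class. So the candidates for the powers `u ^ e` with `1 < e ∣ pq`
carry no information beyond having sum `1`, and HeLP implies the inequalities for all complex
characters (`charIneq_of_heLPVector`). Conversely, averaging over `H` reduces everything to
counting, for a linear character of `N`, the elements of `H` that take `m_i` to a point with value
`ξ`. A character trivial on one component gives the same count for every `m_i`. If `d` is coprime to
`gcd(p + 1, q + 1)`, all others arise from `ψ_0` by elements of `H` and Galois automorphisms, and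
the counts for `ψ_0` are the multiplicities of `χ_0` (`IsType.mult_chiRep`).

For type `G_3(5, 7)`, fixing the first component leaves counts of the points of a line in the field
with `49` elements that lie in a given coset of the cubes. The coset is determined by the squared
norm, and a finite check shows that one coset meets each line at most twice as often as another.
This admits the coefficients `2` and `-1`; which position gets `-1` depends on `β ^ 16`, and
inverting both generators exchanges the two cases without changing `H`. The algorithm excludes all
this: as `3` is coprime to `5 - 1`, the centralizer of `y` induces all scalars of the prime field on
`A`, so a negative value of `f` makes the sum over a whole line negative, against (III). -/

/-- Over an infinite field it suffices to compare values at `t`. These are determinants of `t - e`,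
and determinants are multiplicative along an invariant subspace. -/
lemma charpoly_eq_restrict_mul_mapQ [Infinite F] {V : Type*} [AddCommGroup V] [Module F V]
    [FiniteDimensional F V] (W : Submodule F V) (e : End F V) (he : W ≤ W.comap e) :
    e.charpoly = (e.restrict he).charpoly * (W.mapQ W e he).charpoly := by
  refine Polynomial.funext fun t => ?_
  rw [eval_mul, LinearMap.eval_charpoly, LinearMap.eval_charpoly, LinearMap.eval_charpoly]
  have he' : W ≤ W.comap (algebraMap F (End F V) t - e) := fun x hx =>
    W.sub_mem (W.smul_mem t hx) (he hx)
  rw [LinearMap.det_eq_det_mul_det W _ he']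
  congr 2
  refine LinearMap.ext fun x => ?_
  induction x using Submodule.Quotient.induction_on with
  | _ x => simp [Module.algebraMap_end_apply]

lemma charpoly_smul_one [Infinite F] {V : Type*} [AddCommGroup V] [Module F V]
    [FiniteDimensional F V] (c : F) :
    (c • (1 : End F V)).charpoly = (X - C c) ^ finrank F V := by
  refine Polynomial.funext fun t => ?_
  rw [LinearMap.eval_charpoly, Module.algebraMap_end_eq_smul_id, ← Module.End.one_eq_id,
    ← sub_smul, LinearMap.det_smul]
  simp

/-- A commuting family of endomorphisms over an algebraically closed field can be brought into
triangular form simultaneously. -/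
lemma exists_charpoly_eq_prod [IsAlgClosed F] {B : Type*} [Monoid B] (k : ℕ) :
    ∀ {V : Type*} [AddCommGroup V] [Module F V] [FiniteDimensional F V] (_ : finrank F V = k)
      (ρ : B →* End F V) (_ : ∀ x y, Commute (ρ x) (ρ y)),
      ∃ Λ : Multiset (B →* F), ∀ b, (ρ b).charpoly = (Λ.map fun l => X - C (l b)).prod := by
  have : Infinite F := IsAlgClosed.instInfinite
  induction k using Nat.strong_induction_on with
  | _ k ih =>
  intro V _ _ _ hk ρ hρ
  by_cases hs : ∀ b, ∃ c : F, ρ b = c • 1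
  · choose c hc using hs
    rcases subsingleton_or_nontrivial V with hV | hV
    · refine ⟨0, fun b => ?_⟩
      rw [hc b, charpoly_smul_one, finrank_zero_of_subsingleton]
      simp
    · have inj : ∀ a b : F, a • (1 : End F V) = b • 1 → a = b := fun a b h =>
        smul_left_injective F one_ne_zero h
      refine ⟨Multiset.replicate (finrank F V)
        { toFun := c
          map_one' := inj _ _ (by rw [← hc, map_one, one_smul])
          map_mul' := fun x y => inj _ _ (by
            rw [← hc, map_mul, hc, hc, smul_mul_smul_comm, one_mul]) }, fun b => ?_⟩
      rw [hc b, charpoly_smul_one]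
      simp
  · push Not at hs
    obtain ⟨b₀, hb₀⟩ := hs
    have : Nontrivial V := by
      by_contra h
      rw [not_nontrivial_iff_subsingleton] at h
      exact hb₀ 0 (LinearMap.ext fun x => Subsingleton.elim _ _)
    obtain ⟨μ, hμ⟩ := End.exists_eigenvalue (ρ b₀)
    -- An eigenspace of a non-scalar member is non-zero, proper and invariant under everything
    -- commuting with that member, so the induction applies to `W` and to `V ⧸ W`.
    set W := End.eigenspace (ρ b₀) μ with hW
    have hWtop : W ≠ ⊤ := by
      intro h
      refine hb₀ μ (LinearMap.ext fun x => ?_)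
      have : x ∈ W := h ▸ Submodule.mem_top
      simpa using End.mem_eigenspace_iff.1 this
    have inv : ∀ b, W ≤ W.comap (ρ b) := by
      intro b x hx
      rw [Submodule.mem_comap, hW, End.mem_eigenspace_iff, ← Module.End.mul_apply, hρ b₀ b,
        Module.End.mul_apply, End.mem_eigenspace_iff.1 hx, map_smul]
    have h1 : finrank F W < k := hk ▸ Submodule.finrank_lt hWtop.lt_top.ne
    have h2 : finrank F (V ⧸ W) < k := by
      have := Submodule.finrank_quotient_add_finrank W
      have : 0 < finrank F W := by
        rw [Module.finrank_pos_iff, Submodule.nontrivial_iff_ne_bot]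
        exact hμ
      omega
    let ρ₁ : B →* End F W :=
      { toFun := fun b => (ρ b).restrict (inv b)
        map_one' := by ext; simp
        map_mul' := fun x y => by ext; simp }
    let ρ₂ : B →* End F (V ⧸ W) :=
      { toFun := fun b => W.mapQ W (ρ b) (inv b)
        map_one' := by ext; simp
        map_mul' := fun x y => by ext; simp }
    obtain ⟨Λ₁, h₁⟩ := ih _ h1 rfl ρ₁ (fun x y => by
      ext v
      exact congr($(hρ x y) v))
    obtain ⟨Λ₂, h₂⟩ := ih _ h2 rfl ρ₂ (fun x y => by
      ext v
      exact congr(Submodule.Quotient.mk ($(hρ x y) v)))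
    refine ⟨Λ₁ + Λ₂, fun b => ?_⟩
    rw [charpoly_eq_restrict_mul_mapQ W (ρ b) (inv b), Multiset.map_add, Multiset.prod_add,
      ← h₁ b, ← h₂ b]
    rfl

lemma exists_roots_charpoly_eq [IsAlgClosed F] {B : Type*} [Monoid B] {V : Type*}
    [AddCommGroup V] [Module F V] [FiniteDimensional F V] (ρ : B →* End F V)
    (hρ : ∀ x y, Commute (ρ x) (ρ y)) :
    ∃ Λ : Multiset (B →* F), ∀ b, (ρ b).charpoly.roots = Λ.map fun l => l b := by
  obtain ⟨Λ, h⟩ := exists_charpoly_eq_prod _ rfl ρ hρ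
  refine ⟨Λ, fun b => ?_⟩
  rw [h b]
  simpa using roots_multiset_prod_X_sub_C (Λ.map fun l => l b)

end Triangular

/-! ### Eigenvalue multiplicities and Fourier inversion -/

section Multiplicity

open Polynomial Module

variable {G : Type*} [Group G] {F : Type*} [Field F]

/-- The number of eigenvalues of `ρ g` that `θ` takes to `ξ`, with multiplicity. -/
def brauerMult (θ : F →*₀ ℂ) {r : ℕ} (ρ : Representation F G (Fin r → F)) (g : G) (ξ : ℂ) : ℕ :=
  letI := Classical.decEq ℂ
  ((ρ g).charpoly.roots.map θ).count ξ

lemma charpoly_conj {V : Type*} [AddCommGroup V] [Module F V] [FiniteDimensional F V]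
    (ρ : Representation F G V) (g x : G) : (ρ (g * x * g⁻¹)).charpoly = (ρ x).charpoly := by
  let e : V ≃ₗ[F] V := LinearEquiv.ofLinearMap (ρ g) (ρ g⁻¹)
    (by rw [← Module.End.mul_eq_comp, ← map_mul]; simp [Module.End.one_eq_id])
    (by rw [← Module.End.mul_eq_comp, ← map_mul]; simp [Module.End.one_eq_id])
  have := LinearEquiv.charpoly_conj e (ρ x)
  rw [← this]
  congr 1
  ext v
  simp [e, LinearEquiv.conj_apply]

lemma brauerChar_conj (θ : F →*₀ ℂ) {r : ℕ} (ρ : Representation F G (Fin r → F)) (g x : G) :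
    brauerChar θ ρ (g * x * g⁻¹) = brauerChar θ ρ x := by
  rw [brauerChar, charpoly_conj, brauerChar]

lemma brauerMult_conj (θ : F →*₀ ℂ) {r : ℕ} (ρ : Representation F G (Fin r → F)) (g x : G)
    (ξ : ℂ) : brauerMult θ ρ (g * x * g⁻¹) ξ = brauerMult θ ρ x ξ := by
  rw [brauerMult, charpoly_conj, brauerMult]

/-- Orthogonality of the characters of a cyclic group: for `ξ ≠ z` this is a geometric sum over a
full period of the ratio `ξ⁻¹ z`. -/
lemma sum_pow_eq_ite {n : ℕ} (hn : n ≠ 0) {z ξ : ℂ} (hz : z ^ n = 1) (hξ : ξ ^ n = 1)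
    [Decidable (ξ = z)] :
    (1 / (n : ℂ)) * ∑ k ∈ Finset.range n, ξ⁻¹ ^ k * z ^ k = if ξ = z then 1 else 0 := by
  have hξ0 : ξ ≠ 0 := by rintro rfl; simp [hn] at hξ
  have hn' : (n : ℂ) ≠ 0 := Nat.cast_ne_zero.2 hn
  simp_rw [← mul_pow]
  split_ifs with h
  · subst h
    simp [hξ0, hn']
  · have h1 : ξ⁻¹ * z ≠ 1 := by
      intro h1
      apply h
      field_simp at h1
      exact h1.symm
    rw [geom_sum_eq h1, mul_pow, inv_pow, hz, hξ]
    simp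

/-- The multiplicity of an eigenvalue in terms of the character. -/
lemma sum_brauerChar_pow [IsAlgClosed F] (θ : F →*₀ ℂ) {r : ℕ}
    (ρ : Representation F G (Fin r → F)) {g : G} {n : ℕ} (hn : n ≠ 0) (hg : g ^ n = 1) {ξ : ℂ}
    (hξ : ξ ^ n = 1) :
    (1 / (n : ℂ)) * ∑ k ∈ Finset.range n, ξ⁻¹ ^ k * brauerChar θ ρ (g ^ k) =
      brauerMult θ ρ g ξ := by
  classical
  -- The cyclic group generated by `g` is commutative, so a single list of linear characters
  -- describes the eigenvalues of all powers of `g`.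
  obtain ⟨Λ, hΛ⟩ := exists_roots_charpoly_eq
    (ρ.comp (Subgroup.zpowers g).subtype) (fun x y => by
      have : Commute x y := Subtype.ext (by
        obtain ⟨i, hi⟩ := x.2
        obtain ⟨j, hj⟩ := y.2
        simp only [Subgroup.coe_mul, ← hi, ← hj]
        exact (Commute.refl g).zpow_zpow i j)
      exact this.map _)
  let g' : Subgroup.zpowers g := ⟨g, Subgroup.mem_zpowers g⟩
  have h1 : ∀ k : ℕ, brauerChar θ ρ (g ^ k) = (Λ.map fun l => θ (l g') ^ k).sum := by
    intro k
    have := hΛ (g' ^ k)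
    simp only [MonoidHom.comp_apply, Subgroup.coe_subtype, Subgroup.coe_pow] at this
    rw [brauerChar]
    erw [this]
    simp [Multiset.map_map]
  have h2 : brauerMult θ ρ g ξ = (Λ.map fun l => if ξ = θ (l g') then 1 else 0).sum := by
    have := hΛ g'
    simp only [MonoidHom.comp_apply, Subgroup.coe_subtype] at this
    rw [brauerMult]
    erw [this]
    rw [Multiset.map_map]
    clear hΛ h1 this
    induction Λ using Multiset.induction_on with
    | empty => simp
    | cons a s ih => simp [Multiset.count_cons, ← ih, add_comm]
  have h3 : ∀ l : Subgroup.zpowers g →* F, θ (l g') ^ n = 1 := by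
    intro l
    rw [← map_pow, ← map_pow, show g' ^ n = 1 from Subtype.ext hg, map_one, map_one]
  rw [h2]
  simp_rw [h1]
  clear h1 h2 hΛ
  induction Λ using Multiset.induction_on with
  | empty => simp
  | cons a s ih =>
    simp only [Multiset.map_cons, Multiset.sum_cons, mul_add, Finset.sum_add_distrib, ih,
      Nat.cast_add]
    rw [sum_pow_eq_ite hn (h3 a) hξ]
    simp

/-- `X ^ n - 1` is squarefree over `ℂ` and annihilates `ρ g`; by semisimplicity generalized
eigenspaces are eigenspaces. -/
lemma mult_eq_count {V : Type*} [AddCommGroup V] [Module ℂ V] [FiniteDimensional ℂ V]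
    (ρ : Representation ℂ G V) {g : G} {n : ℕ} (hn : n ≠ 0) (hg : g ^ n = 1) (ξ : ℂ) :
    mult ρ g ξ = (ρ g).charpoly.rootMultiplicity ξ := by
  have hs : Module.End.IsSemisimple (ρ g) := by
    refine Module.End.isSemisimple_of_squarefree_aeval_eq_zero
      (p := (X ^ n - 1 : ℂ[X])) ?_ ?_
    · exact ((separable_X_pow_sub_C (1 : ℂ) (Nat.cast_ne_zero.2 hn) one_ne_zero)).squarefree
    · rw [map_sub, map_pow, aeval_X, map_one, ← map_pow, hg, map_one, sub_self]
  rw [mult, ← LinearMap.finrank_maxGenEigenspace_eq,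
    (Module.End.isFinitelySemisimple_iff_isSemisimple.2 hs).maxGenEigenspace_eq_eigenspace]

lemma mult_eq_brauerMult {r : ℕ} (ρ : Representation ℂ G (Fin r → ℂ)) {g : G} {n : ℕ}
    (hn : n ≠ 0) (hg : g ^ n = 1) (ξ : ℂ) :
    mult ρ g ξ = brauerMult (MonoidWithZeroHom.id ℂ) ρ g ξ := by
  classical
  rw [mult_eq_count ρ hn hg, brauerMult]
  simp only [MonoidWithZeroHom.id_apply, Multiset.map_id']
  rw [← count_roots]

/-- A representation on a finite-dimensional space can be moved to a coordinate space. -/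
lemma exists_mult_eq {V : Type*} [AddCommGroup V] [Module ℂ V] [FiniteDimensional ℂ V]
    (ρ : Representation ℂ G V) :
    ∃ ρ' : Representation ℂ G (Fin (finrank ℂ V) → ℂ), ∀ g ξ, mult ρ' g ξ = mult ρ g ξ := by
  let e : V ≃ₗ[ℂ] (Fin (finrank ℂ V) → ℂ) := (finBasis ℂ V).equivFun
  refine ⟨(e.conjRingEquiv : End ℂ V →* End ℂ _).comp ρ, fun g ξ => ?_⟩
  have key : End.eigenspace (((e.conjRingEquiv : End ℂ V →* End ℂ _).comp ρ) g) ξ =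
      (End.eigenspace (ρ g) ξ).map (e : V →ₗ[ℂ] (Fin (finrank ℂ V) → ℂ)) := by
    ext v
    rw [Submodule.mem_map_equiv, End.mem_eigenspace_iff, End.mem_eigenspace_iff,
      ← e.symm.injective.eq_iff]
    simp
  exact (congrArg (fun W : Submodule ℂ (Fin (finrank ℂ V) → ℂ) => finrank ℂ W) key).trans
    (e.finrank_map_eq _)

end Multiplicity

/-! ### Primary parts of elements of finite order -/

section PiParts

lemma piNat_ne_zero (π : Set ℕ) (n : ℕ) : piNat π n ≠ 0 := by
  classical
  rw [piNat, Finset.prod_ne_zero_iff]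
  intro p hp
  exact pow_ne_zero _ (Nat.prime_of_mem_primeFactors (Finset.mem_filter.1 hp).1).ne_zero

lemma piNat_mul_piNat_compl (π : Set ℕ) {n : ℕ} (hn : n ≠ 0) : piNat π n * piNat πᶜ n = n := by
  classical
  conv_rhs => rw [← Nat.prod_factorization_pow_eq_self hn, Finsupp.prod, Nat.support_factorization,
    ← Finset.prod_filter_mul_prod_filter_not _ (· ∈ π)]
  simp only [piNat, Set.mem_compl_iff]

lemma prime_dvd_piNat {π : Set ℕ} {n r : ℕ} (hr : r.Prime) (h : r ∣ piNat π n) :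
    r ∈ π ∧ r ∣ n := by
  classical
  rw [piNat, hr.prime.dvd_finsetProd_iff] at h
  obtain ⟨p, hp, hd⟩ := h
  rw [Finset.mem_filter] at hp
  have hpp := Nat.prime_of_mem_primeFactors hp.1
  rw [(Nat.prime_dvd_prime_iff_eq hr hpp).1 (hr.dvd_of_dvd_pow hd)]
  exact ⟨hp.2, Nat.dvd_of_mem_primeFactors hp.1⟩

lemma piNat_coprime (π : Set ℕ) (n k : ℕ) : (piNat π n).Coprime (piNat πᶜ k) :=
  Nat.coprime_of_dvd fun _ hr h1 h2 => (prime_dvd_piNat hr h2).1 (prime_dvd_piNat hr h1).1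

/-- The exponent by which `piPart` is defined. -/
def piExp (π : Set ℕ) (n : ℕ) : ℕ := piNat πᶜ n ^ Nat.totient (piNat π n)

lemma piExp_modEq_one (π : Set ℕ) (n : ℕ) : piExp π n ≡ 1 [MOD piNat π n] :=
  Nat.ModEq.pow_totient (piNat_coprime π n n).symm

lemma piNat_compl_dvd_piExp (π : Set ℕ) (n : ℕ) : piNat πᶜ n ∣ piExp π n :=
  dvd_pow_self _ (Nat.totient_pos.2 (Nat.pos_of_ne_zero (piNat_ne_zero π n))).ne'

variable {G : Type*} [Group G]

lemma piPart_eq_pow (π : Set ℕ) (g : G) : piPart π g = g ^ piExp π (orderOf g) := rfl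

/-- `u` is a `π`-element. -/
def IsPiElt (π : Set ℕ) (u : G) : Prop := ∀ q : ℕ, q.Prime → q ∣ orderOf u → q ∈ π

lemma isPiElt_iff_dvd {π : Set ℕ} {u : G} {n : ℕ} (hn : n ≠ 0) (h : orderOf u ∣ n) :
    IsPiElt π u ↔ orderOf u ∣ piNat π n := by
  constructor
  · intro hu
    have hc : (orderOf u).Coprime (piNat πᶜ n) :=
      Nat.coprime_of_dvd fun r hr h1 h2 => (prime_dvd_piNat hr h2).1 (hu r hr h1)
    exact hc.dvd_of_dvd_mul_right (by rwa [piNat_mul_piNat_compl π hn])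
  · intro hu q hq hd
    exact (prime_dvd_piNat hq (hd.trans hu)).1

lemma isPiElt_piPart (π : Set ℕ) {g : G} (hg : IsOfFinOrder g) : IsPiElt π (piPart π g) := by
  have hn : orderOf g ≠ 0 := hg.orderOf_pos.ne'
  rw [piPart_eq_pow, isPiElt_iff_dvd hn (orderOf_pow_dvd _), orderOf_dvd_iff_pow_eq_one, ← pow_mul,
    ← orderOf_dvd_iff_pow_eq_one]
  conv_lhs => rw [← piNat_mul_piNat_compl π hn, mul_comm]
  exact Nat.mul_dvd_mul_right (piNat_compl_dvd_piExp _ _) _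

lemma piPart_mul_of_commute (π : Set ℕ) {u v : G} (hu : IsOfFinOrder u) (hv : IsOfFinOrder v)
    (h : Commute u v) (hu' : IsPiElt π u) (hv' : IsPiElt πᶜ v) : piPart π (u * v) = u := by
  have hc : (orderOf u).Coprime (orderOf v) :=
    Nat.coprime_of_dvd fun r hr h1 h2 => hv' r hr h2 (hu' r hr h1)
  have ho := h.orderOf_mul_eq_mul_orderOf_of_coprime hc
  have hn : orderOf (u * v) ≠ 0 := ho ▸ (Nat.mul_pos hu.orderOf_pos hv.orderOf_pos).ne'
  rw [piPart_eq_pow, h.mul_pow]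
  have h1 : v ^ piExp π (orderOf (u * v)) = 1 := orderOf_dvd_iff_pow_eq_one.1
    (((isPiElt_iff_dvd hn (ho ▸ dvd_mul_left _ _)).1 hv').trans (piNat_compl_dvd_piExp _ _))
  have h2 : u ^ piExp π (orderOf (u * v)) = u ^ 1 := pow_eq_pow_iff_modEq.2
    ((piExp_modEq_one π _).of_dvd ((isPiElt_iff_dvd hn (ho ▸ dvd_mul_right _ _)).1 hu'))
  rw [h1, h2, mul_one, pow_one]

lemma piPart_mul_piPart_compl (π : Set ℕ) {g : G} (hg : IsOfFinOrder g) :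
    piPart π g * piPart πᶜ g = g := by
  have hn : orderOf g ≠ 0 := hg.orderOf_pos.ne'
  rw [piPart_eq_pow, piPart_eq_pow, ← pow_add]
  conv_rhs => rw [← pow_one g]
  rw [pow_eq_pow_iff_modEq]
  conv => arg 1; rw [← piNat_mul_piNat_compl π hn]
  rw [← Nat.modEq_and_modEq_iff_modEq_mul (piNat_coprime _ _ _)]
  constructor
  · have h2 := piNat_compl_dvd_piExp πᶜ (orderOf g)
    rw [compl_compl] at h2
    simpa using (piExp_modEq_one π _).add ((Nat.modEq_zero_iff_dvd).2 h2)
  · simpa using ((Nat.modEq_zero_iff_dvd).2 (piNat_compl_dvd_piExp π (orderOf g))).add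
      (piExp_modEq_one πᶜ _)

lemma IsPiElt.pow {π : Set ℕ} {u : G} (hu : IsPiElt π u) (k : ℕ) : IsPiElt π (u ^ k) :=
  fun q hq hd => hu q hq (hd.trans (orderOf_pow_dvd k))

lemma piPart_pow (π : Set ℕ) {g : G} (hg : IsOfFinOrder g) (k : ℕ) :
    piPart π (g ^ k) = piPart π g ^ k := by
  have hc : Commute (piPart π g) (piPart πᶜ g) := (Commute.refl g).pow_pow _ _
  conv_lhs => rw [← piPart_mul_piPart_compl π hg, hc.mul_pow]
  exact piPart_mul_of_commute π (hg.pow.pow) (hg.pow.pow) (hc.pow_pow _ _)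
    ((isPiElt_piPart π hg).pow k) ((isPiElt_piPart πᶜ hg).pow k)

lemma map_piPart {M M' : Type*} [Group M] [Group M'] (π : Set ℕ) (f : M →* M')
    (hf : Function.Injective f) (x : M) : f (piPart π x) = piPart π (f x) := by
  rw [piPart_eq_pow, piPart_eq_pow, map_pow, orderOf_injective f hf]

lemma piPart_conj (π : Set ℕ) (g x : G) : piPart π (g * x * g⁻¹) = g * piPart π x * g⁻¹ :=
  (map_piPart π (MulAut.conj g).toMonoidHom (MulAut.conj g).injective x).symm

/-- An element all of whose primary parts lie in a normal subgroup lies in this subgroup. -/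
lemma mem_of_forall_piPart_mem {N : Subgroup G} [N.Normal] {g : G}
    (h : ∀ r : ℕ, r.Prime → piPart {r} g ∈ N) : g ∈ N := by
  rw [← QuotientGroup.eq_one_iff, ← orderOf_eq_one_iff]
  by_contra ho
  obtain ⟨r, hr, hd⟩ := Nat.exists_prime_and_dvd ho
  -- In the quotient the `r`-part becomes trivial, so `r` divides the exponent defining it; but that
  -- exponent is a power of a number prime to `r`.
  have h1 := (QuotientGroup.eq_one_iff _).2 (h r hr)
  rw [piPart_eq_pow, QuotientGroup.mk_pow, ← orderOf_dvd_iff_pow_eq_one] at h1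
  have h2 := hr.dvd_of_dvd_pow (hd.trans h1)
  exact (prime_dvd_piNat hr h2).1 rfl

/-- The preceding criterion for the trivial subgroup, applied to `g ^ orderOf h`. -/
lemma orderOf_dvd_of_forall_piPart {g h : G} (hg : IsOfFinOrder g)
    (H : ∀ r : ℕ, r.Prime → orderOf (piPart {r} g) ∣ orderOf (piPart {r} h)) :
    orderOf g ∣ orderOf h := by
  rw [orderOf_dvd_iff_pow_eq_one]
  refine Subgroup.mem_bot.1 (mem_of_forall_piPart_mem fun r hr => ?_)
  rw [Subgroup.mem_bot, piPart_pow _ hg, ← orderOf_dvd_iff_pow_eq_one]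
  exact (H r hr).trans (orderOf_pow_dvd _)

lemma LocallyConj.orderOf_eq {m g : G} (hm : IsOfFinOrder m) (hg : IsOfFinOrder g)
    (h : LocallyConj (MulAut.conj : G →* MulAut G) m g) : orderOf g = orderOf m := by
  have key : ∀ r : ℕ, r.Prime → orderOf (piPart {r} g) = orderOf (piPart {r} m) := by
    intro r hr
    obtain ⟨x, hx⟩ := h r hr
    rw [← hx]
    exact MulEquiv.orderOf_eq (MulAut.conj x) _
  exact Nat.dvd_antisymm (orderOf_dvd_of_forall_piPart hg fun r hr => (key r hr).dvd)
    (orderOf_dvd_of_forall_piPart hm fun r hr => (key r hr).symm.dvd)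

lemma LocallyConj.pow {M : Type*} [Group M] {φ : G →* MulAut M} {m g : M} (hm : IsOfFinOrder m)
    (hg : IsOfFinOrder g) (h : LocallyConj φ m g) (d : ℕ) : LocallyConj φ (m ^ d) (g ^ d) := by
  intro r hr
  obtain ⟨x, hx⟩ := h r hr
  exact ⟨x, by rw [piPart_pow _ hm, piPart_pow _ hg, map_pow, hx]⟩

lemma LocallyConj.trans_isConj {m g g' : G}
    (h : LocallyConj (MulAut.conj : G →* MulAut G) m g) (h' : IsConj g g') :
    LocallyConj (MulAut.conj : G →* MulAut G) m g' := by
  obtain ⟨y, rfl⟩ := isConj_iff.1 h'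
  intro r hr
  obtain ⟨x, hx⟩ := h r hr
  exact ⟨y * x, by rw [piPart_conj, ← hx]; simp [mul_assoc]⟩

end PiParts

/-! ### Sums over conjugacy classes -/

section ClassSums

variable {G : Type*} [Group G] {M : Type*} [Group M]

/-- `F` is constant on `H`-classes. -/
def IsClassFun {R : Type*} (φ : G →* MulAut M) (H : Subgroup G) (F : M → R) : Prop :=
  ∀ h ∈ H, ∀ x, F (φ h x) = F x

lemma IsClassFun.out {R : Type*} {φ : G →* MulAut M} {H : Subgroup G} {F : M → R}
    (hF : IsClassFun φ H F) (x : M) : F (Quotient.mk (classSetoid φ H) x).out = F x := by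
  obtain ⟨h, hh, e⟩ := Quotient.mk_out (s := classSetoid φ H) x
  rw [← hF h hh, e]

lemma classSum_eq_sum {R : Type*} [AddCommMonoid R] (φ : G →* MulAut M) (H : Subgroup G)
    [Fintype (Quotient (classSetoid φ H))] (F : M → R) :
    classSum φ H F = ∑ X : Quotient (classSetoid φ H), F X.out :=
  finsum_eq_sum_of_fintype _

lemma isClassFun_conj_iff {R : Type*} {F : G → R} :
    IsClassFun (MulAut.conj : G →* MulAut G) ⊤ F ↔ ∀ g x, F (g * x * g⁻¹) = F x :=
  ⟨fun h g x => h g trivial x, fun h g _ x => h g x⟩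

lemma IsClassFun.eq_of_isConj {R : Type*} {F : G → R}
    (hF : IsClassFun (MulAut.conj : G →* MulAut G) ⊤ F) {x y : G} (h : IsConj x y) :
    F x = F y := by
  obtain ⟨c, rfl⟩ := isConj_iff.1 h
  exact (hF c trivial x).symm

lemma isConj_iff_mk_eq {x y : G} : IsConj x y ↔
    Quotient.mk (classSetoid (MulAut.conj : G →* MulAut G) ⊤) x = Quotient.mk _ y := by
  rw [isConj_iff, Quotient.eq]
  exact ⟨fun ⟨c, h⟩ => ⟨c, trivial, h⟩, fun ⟨c, _, h⟩ => ⟨c, h⟩⟩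

/-- Summation over a set of representatives of the classes on which `ε` does not vanish. -/
lemma classSum_eq_sum_reps {R ι : Type*} [AddCommMonoid R] [Finite G] [Fintype ι]
    {F : G → R} (hF : IsClassFun (MulAut.conj : G →* MulAut G) ⊤ F) (m : ι → G)
    (hm : ∀ i j, IsConj (m i) (m j) → i = j) (hs : ∀ x, F x ≠ 0 → ∃ i, IsConj (m i) x) :
    classSum (MulAut.conj : G →* MulAut G) ⊤ F = ∑ i, F (m i) := by
  classical
  have := Fintype.ofFinite (Quotient (classSetoid (MulAut.conj : G →* MulAut G) ⊤))
  rw [classSum_eq_sum]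
  symm
  refine Finset.sum_of_injOn (fun i => Quotient.mk _ (m i)) ?_ (by simp) ?_ ?_
  · intro i _ j _ h
    exact hm i j (isConj_iff_mk_eq.2 h)
  · intro X _ hX
    by_contra h
    obtain ⟨i, hi⟩ := hs _ h
    refine hX ⟨i, by simp, ?_⟩
    exact (isConj_iff_mk_eq.1 hi).trans (Quotient.out_eq X)
  · intro i _
    exact (hF.out _).symm

lemma classSum_ite_isConj {R : Type*} [AddCommMonoid R] [Finite G] {F : G → R}
    (hF : IsClassFun (MulAut.conj : G →* MulAut G) ⊤ F) (m : G) [DecidablePred (IsConj m)] :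
    classSum (MulAut.conj : G →* MulAut G) ⊤ (fun g => if IsConj m g then F g else 0) = F m := by
  rw [classSum_eq_sum_reps (ι := Unit) _ (fun _ => m)]
  · simp only [if_pos (IsConj.refl m), Fintype.sum_unique]
  · exact fun _ _ _ => rfl
  · intro x hx
    by_contra h
    exact hx (if_neg fun h' => h ⟨(), h'⟩)
  · rw [isClassFun_conj_iff]
    intro g x
    have h1 : IsConj x (g * x * g⁻¹) := isConj_iff.2 ⟨g, rfl⟩
    have h2 : IsConj m (g * x * g⁻¹) ↔ IsConj m x := ⟨fun h => h.trans h1.symm, fun h => h.trans h1⟩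
    simp only [h2, hF.eq_of_isConj h1]

lemma classSum_comm {R : Type*} [AddCommMonoid R] [Finite G] (F : G → G → R) :
    classSum (MulAut.conj : G →* MulAut G) ⊤ (fun x => classSum (MulAut.conj : G →* MulAut G) ⊤
      (fun y => F x y)) =
    classSum (MulAut.conj : G →* MulAut G) ⊤ (fun y => classSum (MulAut.conj : G →* MulAut G) ⊤
      (fun x => F x y)) := by
  classical
  have := Fintype.ofFinite (Quotient (classSetoid (MulAut.conj : G →* MulAut G) ⊤))
  simp only [classSum_eq_sum]
  exact Finset.sum_comm

end ClassSums

/-! ### Candidates for powers and the reduction of HeLP to a sign condition -/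

section Sufficient

variable {G : Type*} [Group G]

lemma map_classSum {R S M : Type*} [AddCommMonoid R] [AddCommMonoid S] [Group M] [Finite M]
    (f : R →+ S) (φ : G →* MulAut M) (H : Subgroup G) (F : M → R) :
    f (classSum φ H F) = classSum φ H (fun x => f (F x)) := by
  classical
  have := Fintype.ofFinite (Quotient (classSetoid φ H))
  simp only [classSum_eq_sum, map_sum]

lemma classSum_congr {R M : Type*} [AddCommMonoid R] [Group M] {φ : G →* MulAut M}
    {H : Subgroup G} {F F' : M → R} (h : ∀ x, F x = F' x) :
    classSum φ H F = classSum φ H F' := by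
  rw [funext h]

lemma mul_classSum {R M : Type*} [Semiring R] [Group M] [Finite M]
    (φ : G →* MulAut M) (H : Subgroup G) (r : R) (F : M → R) :
    r * classSum φ H F = classSum φ H (fun x => r * F x) :=
  map_classSum (AddMonoidHom.mulLeft r) φ H F

lemma sum_classSum {R M ι : Type*} [AddCommMonoid R] [Group M] [Finite M]
    (φ : G →* MulAut M) (H : Subgroup G) (s : Finset ι) (F : ι → M → R) :
    ∑ i ∈ s, classSum φ H (F i) = classSum φ H (fun x => ∑ i ∈ s, F i x) := by
  classical
  have := Fintype.ofFinite (Quotient (classSetoid φ H))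
  simp only [classSum_eq_sum]
  exact Finset.sum_comm

lemma intCast_classSum {M : Type*} [Group M] [Finite M] (R : Type*) [Ring R]
    (φ : G →* MulAut M) (H : Subgroup G) (F : M → ℤ) :
    ((classSum φ H F : ℤ) : R) = classSum φ H (fun x => (F x : R)) :=
  map_classSum (Int.castAddHom R) φ H F

lemma exists_ne_zero_of_classSum_ne_zero {R M : Type*} [AddCommMonoid R] [Group M]
    {φ : G →* MulAut M} {H : Subgroup G} {F : M → R} (h : classSum φ H F ≠ 0) :
    ∃ x, F x ≠ 0 := by
  by_contra! h0
  exact h (by simp [classSum, h0])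

open scoped Classical in
/-- The partial augmentations of `u ^ d`, if those of `u` are given by `ε` and `u` behaves like the
corresponding combination of group elements. -/
def powAug (ε : G → ℤ) (d : ℕ) (x : G) : ℤ :=
  classSum (MulAut.conj : G →* MulAut G) ⊤ (fun g => if IsConj (g ^ d) x then ε g else 0)

variable {ε : G → ℤ}

lemma powAug_conj (d : ℕ) (g x : G) : powAug ε d (g * x * g⁻¹) = powAug ε d x := by
  have h1 : IsConj x (g * x * g⁻¹) := isConj_iff.2 ⟨g, rfl⟩
  have h2 : ∀ y, IsConj y (g * x * g⁻¹) ↔ IsConj y x := fun y =>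
    ⟨fun h => h.trans h1.symm, fun h => h.trans h1⟩
  classical
  exact classSum_congr fun y => by simp only [h2]

lemma powAug_one [Finite G] (hε : IsClassFun (MulAut.conj : G →* MulAut G) ⊤ ε) :
    powAug ε 1 = ε := by
  classical
  ext x
  rw [← classSum_ite_isConj hε x]
  exact classSum_congr fun g => by simp only [pow_one, isConj_comm]

lemma exists_of_powAug_ne_zero {d : ℕ} {x : G} (h : powAug ε d x ≠ 0) :
    ∃ g, ε g ≠ 0 ∧ IsConj (g ^ d) x := by
  obtain ⟨g, hg⟩ := exists_ne_zero_of_classSum_ne_zero h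
  split_ifs at hg with h'
  · exact ⟨g, hg, h'⟩
  · exact (hg rfl).elim

/-- `powAug ε d` is the push-forward of `ε` under the `d`-th power map on classes; this is the
change of variables formula. -/
lemma classSum_powAug_mul [Finite G] {R : Type*} [Ring R] (d : ℕ) {f : G → R}
    (hf : IsClassFun (MulAut.conj : G →* MulAut G) ⊤ f) :
    classSum (MulAut.conj : G →* MulAut G) ⊤ (fun x => (powAug ε d x : R) * f x) =
      classSum (MulAut.conj : G →* MulAut G) ⊤ (fun g => (ε g : R) * f (g ^ d)) := by
  classical
  have h : ∀ x, (powAug ε d x : R) * f x = classSum (MulAut.conj : G →* MulAut G) ⊤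
      (fun g => if IsConj (g ^ d) x then (ε g : R) * f x else 0) := by
    intro x
    rw [powAug, intCast_classSum]
    refine (map_classSum (AddMonoidHom.mulRight (f x)) _ _ _).trans (classSum_congr fun g => ?_)
    simp only [AddMonoidHom.mulRight_apply]
    split_ifs <;> simp
  rw [classSum_congr h, classSum_comm]
  refine classSum_congr fun g => ?_
  exact classSum_ite_isConj (F := fun x => (ε g : R) * f x)
    (fun a ha x => by simp only [hf a ha x]) (g ^ d)

/-- If the multiplicities of eigenvalues that belong to the power maps are non-negative, the HeLP
restrictions are satisfied. -/
theorem heLPSystem_powAug [Finite G] {m : G}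
    (hs : ∀ x, ε x ≠ 0 → LocallyConj (MulAut.conj : G →* MulAut G) m x)
    (h1 : classSum (MulAut.conj : G →* MulAut G) ⊤ ε = 1)
    (hnn : ∀ (F : Type) [Field F] [IsAlgClosed F] (θ : F →*₀ ℂ) (r : ℕ)
      (ρ : Representation F G (Fin r → F)) (ξ : ℂ),
      0 ≤ classSum (MulAut.conj : G →* MulAut G) ⊤ (fun g => ε g * (brauerMult θ ρ g ξ : ℤ))) :
    HeLPSystem m (powAug ε) where
  classFun d _ g x := powAug_conj d g x
  support d _ x hx := by
    obtain ⟨g, hg, hc⟩ := exists_of_powAug_ne_zero hx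
    exact ((hs g hg).pow (isOfFinOrder_of_finite _) (isOfFinOrder_of_finite _) d).trans_isConj hc
  sumOne d _ := by
    have := classSum_powAug_mul (ε := ε) (R := ℤ) d (f := fun _ => 1) (fun _ _ _ => rfl)
    simpa [h1] using this
  multiplicity F _ _ _ θ _ r ρ ξ hξ := by
    have hn : orderOf m ≠ 0 := (orderOf_pos m).ne'
    have hpow : ∀ g, ε g ≠ 0 → g ^ orderOf m = 1 := fun g hg => by
      rw [← (hs g hg).orderOf_eq (isOfFinOrder_of_finite _) (isOfFinOrder_of_finite _),
        pow_orderOf_eq_one]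
    refine ⟨(classSum (MulAut.conj : G →* MulAut G) ⊤
      (fun g => ε g * (brauerMult θ ρ g ξ : ℤ))).toNat, ?_⟩
    -- Raising to the power `gcd(k, n)` and then `k / gcd(k, n)` is raising to the power `k`. By
    -- change of variables all `k` thus involve the same `ε`, and the sum over `k` is the Fourier
    -- inversion that yields multiplicities.
    have key : ∀ k, classSum (MulAut.conj : G →* MulAut G) ⊤ (fun g : G =>
        (powAug ε (Nat.gcd k (orderOf m)) g : ℂ) *
          brauerChar θ ρ (g ^ (k / Nat.gcd k (orderOf m)))) =
        classSum (MulAut.conj : G →* MulAut G) ⊤ (fun g => (ε g : ℂ) * brauerChar θ ρ (g ^ k)) := by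
      intro k
      rw [classSum_powAug_mul _ (f := fun g => brauerChar θ ρ (g ^ (k / Nat.gcd k (orderOf m))))]
      · simp only [← pow_mul, Nat.mul_div_cancel' (Nat.gcd_dvd_left k _)]
      · intro g _ x
        change brauerChar θ ρ (MulAut.conj g x ^ _) = _
        rw [← map_pow, MulAut.conj_apply, brauerChar_conj]
    simp only [key, mul_classSum, sum_classSum]
    rw [← Int.cast_natCast (R := ℂ) (Int.toNat _), Int.toNat_of_nonneg (hnn F θ r ρ ξ), intCast_classSum]
    refine classSum_congr fun g => ?_
    by_cases hg : ε g = 0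
    · simp [hg]
    · rw [Int.cast_mul, Int.cast_natCast, ← sum_brauerChar_pow θ ρ hn (hpow g hg) hξ,
        Finset.mul_sum, Finset.mul_sum, Finset.mul_sum]
      exact Finset.sum_congr rfl fun k _ => by ring

end Sufficient

lemma IsPiElt.mul {G : Type*} [Group G] {π : Set ℕ} {x y : G} (h : Commute x y)
    (hx : IsPiElt π x) (hy : IsPiElt π y) : IsPiElt π (x * y) := fun q hq hd =>
  (hq.dvd_mul.1 (hd.trans h.orderOf_mul_dvd_mul_orderOf)).elim (hx q hq) (hy q hq)

lemma isClassFun_brauerMult {G : Type*} [Group G] {F : Type*} [Field F] (θ : F →*₀ ℂ) {r : ℕ}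
    (ρ : Representation F G (Fin r → F)) (ξ : ℂ) :
    IsClassFun (MulAut.conj : G →* MulAut G) ⊤ (fun g => (brauerMult θ ρ g ξ : ℤ)) := by
  rw [isClassFun_conj_iff]
  exact fun g x => by rw [brauerMult_conj]

/-! ### Hall subgroups of a nilpotent normal subgroup -/

section Nilpotent

variable {G : Type*} [Group G] {N : Subgroup G}

lemma mem_hall_of_isPiElt {π : Set ℕ} {x : G} (hx : x ∈ N) (h : IsPiElt π x) : x ∈ hall π N :=
  Subgroup.subset_closure ⟨hx, h⟩

lemma hall_le (π : Set ℕ) (N : Subgroup G) : hall π N ≤ N :=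
  (Subgroup.closure_le _).2 fun _ hx => hx.1

lemma piPart_mem_hall (π : Set ℕ) [Finite G] {x : G} (hx : x ∈ N) : piPart π x ∈ hall π N :=
  mem_hall_of_isPiElt (N.pow_mem hx _) (isPiElt_piPart π (isOfFinOrder_of_finite x))

lemma isPiElt_of_mem_hall_of_comm {π : Set ℕ}
    (hc : ∀ x ∈ hall π N, ∀ y ∈ hall π N, x * y = y * x) {x : G} (hx : x ∈ hall π N) :
    IsPiElt π x := by
  induction hx using Subgroup.closure_induction with
  | mem x hx => exact hx.2
  | one => exact fun q hq hd => (hq.one_lt.ne' (by simpa using hd)).elim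
  | mul x y hx hy ihx ihy => exact IsPiElt.mul (hc x hx y hy) ihx ihy
  | inv x _ ih => exact fun q hq hd => ih q hq (by rwa [orderOf_inv] at hd)

/-- The Sylow `p`-subgroup of a nilpotent group is normal, hence unique, so it contains all
`p`-elements and the subgroup they generate. -/
lemma isPiElt_of_mem_hall_prime [Finite G] [Group.IsNilpotent N] {p : ℕ} (hp : p.Prime) {x : G}
    (hx : x ∈ hall {p} N) : IsPiElt {p} x := by
  have : Fact p.Prime := ⟨hp⟩
  let P : Sylow p N := default
  have hP : (P : Subgroup N).Normal := inferInstance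
  have key : hall {p} N ≤ (P : Subgroup N).map N.subtype := by
    refine (Subgroup.closure_le _).2 fun y hy => ?_
    have hpg : IsPGroup p (Subgroup.zpowers (⟨y, hy.1⟩ : N)) := by
      rw [IsPGroup.iff_card, Nat.card_zpowers]
      have h0 : orderOf (⟨y, hy.1⟩ : N) = orderOf y := Subgroup.orderOf_mk y hy.1
      rw [h0]
      exact ⟨_, Nat.eq_prime_pow_of_unique_prime_dvd (orderOf_pos y).ne'
        fun hq hd => hy.2 _ hq hd⟩
    obtain ⟨Q, hQ⟩ := hpg.exists_le_sylow
    have : Q = P := by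
      have := Sylow.unique_of_normal P hP
      exact Subsingleton.elim _ _
    exact ⟨⟨y, hy.1⟩, this ▸ hQ (Subgroup.mem_zpowers _), rfl⟩
  obtain ⟨z, hz, rfl⟩ := key hx
  intro q hq hd
  obtain ⟨k, hk⟩ := IsPGroup.iff_orderOf.1 P.isPGroup' ⟨z, hz⟩
  have h1 : orderOf (N.subtype z) = p ^ k := by
    rw [← hk, Subgroup.orderOf_mk]
    exact Subgroup.orderOf_coe z
  exact (Nat.prime_dvd_prime_iff_eq hq hp).1 (hq.dvd_of_dvd_pow (h1 ▸ hd))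

/-- Normal subgroups with trivial intersection centralize each other. -/
lemma commute_of_isPiElt_hall [N.Normal] {π : Set ℕ} (h1 : ∀ x ∈ hall π N, IsPiElt π x)
    (h2 : ∀ x ∈ hall πᶜ N, IsPiElt πᶜ x) {x y : G} (hx : x ∈ hall π N) (hy : y ∈ hall πᶜ N) :
    Commute x y := by
  refine Subgroup.commute_of_normal_of_disjoint _ _ inferInstance inferInstance ?_ x y hx hy
  rw [Subgroup.disjoint_def]
  intro z hz hz'
  rw [← orderOf_eq_one_iff]
  by_contra h
  obtain ⟨r, hr, hd⟩ := Nat.exists_prime_and_dvd h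
  exact h2 z hz' r hr hd (h1 z hz r hr hd)

end Nilpotent

/-! ### Fibres of linear characters as unions of cosets -/

section Cosets

variable {A : Type*} [Group A] [Finite A]

/-- A finite group that embeds multiplicatively into a field is cyclic. -/
lemma isCocyclic_ker (χ : A →* ℂ) : IsCocyclic χ.ker := by
  refine ⟨χ.normal_ker, isCyclic_of_injective_ringHom
    (QuotientGroup.lift χ.ker χ fun _ h => h) ?_⟩
  rw [injective_iff_map_eq_one]
  intro x hx
  induction x using QuotientGroup.induction_on with
  | _ x => exact (QuotientGroup.eq_one_iff x).2 hx

/-- The kernel of `χ` contains a minimal subgroup `K` with cyclic quotient, and the fibres of `χ`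
are unions of cosets of `K`. This is where condition (III) of the algorithm acts. -/
lemma sum_fiber_nonneg {w : A → ℤ}
    (hw : ∀ K : Subgroup A, Minimal IsCocyclic K → ∀ a : A, 0 ≤ ∑ᶠ c ∈ {c : A | a⁻¹ * c ∈ K}, w c)
    (χ : A →* ℂ) (z : ℂ) [Fintype A] [DecidablePred fun a => χ a = z] :
    0 ≤ ∑ a with χ a = z, w a := by
  classical
  obtain ⟨K, hK, hmin⟩ := exists_minimal_le_of_wellFoundedLT IsCocyclic χ.ker (isCocyclic_ker χ)
  have h1 : ∀ a, 0 ≤ ∑ k : K, w (a * k) := by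
    intro a
    convert hw K hmin a
    have : {c : A | a⁻¹ * c ∈ K} = (fun k => a * k) '' (K : Set A) := by
      ext c
      refine ⟨fun h => ⟨_, h, by simp⟩, ?_⟩
      rintro ⟨k, hk, rfl⟩
      simpa using hk
    rw [this, finsum_mem_image (mul_right_injective a).injOn,
      ← finsum_subtype_eq_finsum_cond (M := ℤ) (p := fun k => k ∈ (K : Set A))
        (f := fun k => w (a * k)), finsum_eq_sum_of_fintype]
    rfl
  -- Instead of choosing coset representatives, sum over the cosets of all points of the fibre.
  -- Translation by `k ∈ K` permutes the fibre, so each point is counted `|K|` times.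
  have h2 : (Fintype.card K : ℤ) * ∑ a with χ a = z, w a =
      ∑ a with χ a = z, ∑ k : K, w (a * k) := by
    rw [Finset.sum_comm, ← Finset.card_univ, ← nsmul_eq_mul, ← Finset.sum_const]
    refine Finset.sum_congr rfl fun k _ => ?_
    have hk : χ k = 1 := hK k.2
    symm
    refine Finset.sum_bijective (fun a => a * k) (Group.mulRight_bijective (k : A)) ?_ ?_
    · intro a
      simp [hk]
    · exact fun _ _ => rfl
  have h3 : (0 : ℤ) < Fintype.card K := by exact_mod_cast Fintype.card_pos
  exact nonneg_of_mul_nonneg_right (h2 ▸ Finset.sum_nonneg fun a _ => h1 a) h3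

end Cosets

/-! ### Class sums as weighted sums over elements -/

section Orbits

variable {G : Type*} [Group G] {M : Type*} [Group M]

/-- Orbit-stabilizer: the stabilizers of the points of one orbit have orders adding up to `|H|`. It
explains the weights `|C_H(c)|` in condition (III). -/
lemma card_mul_classSum [Finite M] [Fintype M] [Finite G] (φ : G →* MulAut M) (H : Subgroup G)
    {F : M → ℤ} (hF : IsClassFun φ H F) :
    (Nat.card H : ℤ) * classSum φ H F = ∑ a, (Nat.card (fixer φ H a) : ℤ) * F a := by
  classical
  have := Fintype.ofFinite (Quotient (classSetoid φ H))
  have := Fintype.ofFinite H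
  rw [classSum_eq_sum, Finset.mul_sum,
    ← Finset.sum_fiberwise (g := fun a => Quotient.mk (classSetoid φ H) a)]
  refine Finset.sum_congr rfl fun X _ => ?_
  have h1 : ∀ a ∈ Finset.univ.filter (fun a => Quotient.mk (classSetoid φ H) a = X),
      (Nat.card (fixer φ H a) : ℤ) * F a =
        ((Finset.univ.filter fun h : H => φ h X.out = a).card : ℤ) * F X.out := by
    intro a ha
    obtain rfl := (Finset.mem_filter.1 ha).2
    rw [hF.out]
    congr 2
    obtain ⟨k, hk, e⟩ := Quotient.mk_out (s := classSetoid φ H) a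
    rw [← Fintype.card_subtype, ← Nat.card_eq_fintype_card]
    -- The elements of `H` taking the representative to `a` form the coset `C_H(a) k`.
    refine Nat.card_congr
      { toFun := fun h => ⟨⟨h * k, H.mul_mem h.2.1 hk⟩, by
          rw [map_mul, MulAut.mul_apply, e]
          exact h.2.2⟩
        invFun := fun h => ⟨h * k⁻¹, H.mul_mem h.1.2 (H.inv_mem hk), by
          have h2 := h.2
          have h3 : φ k⁻¹ a = (Quotient.mk (classSetoid φ H) a).out := by
            rw [map_inv, MulAut.inv_apply, MulEquiv.symm_apply_eq, e]
          rw [map_mul, MulAut.mul_apply, h3, h2]⟩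
        left_inv := fun h => by simp
        right_inv := fun h => by simp }
  rw [Finset.sum_congr rfl h1, ← Finset.sum_mul, ← Nat.cast_sum,
    ← Finset.card_eq_sum_card_fiberwise (f := fun h : H => φ h X.out), Nat.card_eq_fintype_card, Finset.card_univ]
  intro h _
  rw [Finset.mem_coe, Finset.mem_filter]
  refine ⟨Finset.mem_univ _, ?_⟩
  conv_rhs => rw [← Quotient.out_eq X]
  exact (Quotient.sound (s := classSetoid φ H) ⟨h, h.2, rfl⟩).symm

end Orbits

/-! ### The restrictions of the algorithm imply those of HeLP -/

section Algorithm

variable {G : Type*} [Group G] {N : Subgroup G} {p : ℕ}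

/-- The hypotheses under which the algorithm works, in the form in which they are used. -/
structure AlgSetup (N : Subgroup G) (p : ℕ) : Prop where
  comm : ∀ x ∈ hall {p}ᶜ N, ∀ y ∈ hall {p}ᶜ N, x * y = y * x
  isPi : ∀ x ∈ hall {p} N, IsPiElt {p} x

lemma AlgSetup.isPi_compl (S : AlgSetup N p) {x : G} (hx : x ∈ hall {p}ᶜ N) : IsPiElt {p}ᶜ x :=
  isPiElt_of_mem_hall_of_comm S.comm hx

variable [N.Normal]

lemma AlgSetup.commute (S : AlgSetup N p) {y a : G} (hy : y ∈ hall {p} N)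
    (ha : a ∈ hall {p}ᶜ N) : Commute y a :=
  commute_of_isPiElt_hall S.isPi (fun _ => S.isPi_compl) hy ha

variable [Finite G]

lemma AlgSetup.piPart_mul (S : AlgSetup N p) {y a : G} (hy : y ∈ hall {p} N)
    (ha : a ∈ hall {p}ᶜ N) : piPart {p} (y * a) = y :=
  piPart_mul_of_commute _ (isOfFinOrder_of_finite _) (isOfFinOrder_of_finite _)
    (S.commute hy ha) (S.isPi y hy) (S.isPi_compl ha)

lemma AlgSetup.piPart_compl_mul (S : AlgSetup N p) {y a : G} (hy : y ∈ hall {p} N)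
    (ha : a ∈ hall {p}ᶜ N) : piPart {p}ᶜ (y * a) = a := by
  rw [(S.commute hy ha).eq]
  exact piPart_mul_of_commute _ (isOfFinOrder_of_finite _) (isOfFinOrder_of_finite _)
    (S.commute hy ha).symm (S.isPi_compl ha) (by rw [compl_compl]; exact S.isPi y hy)

variable {ε : G → ℤ} {y : G} {f : hall {p}ᶜ N → ℤ}

/-- `ε` is the extension of `f` to `G` that belongs to `y`. -/
structure IsExtension (y : G) (f : hall {p}ᶜ N → ℤ) (ε : G → ℤ) : Prop where
  eq_of_conj : ∀ n ∈ N, ∀ (g : G) (a : hall {p}ᶜ N), g * piPart {p} n * g⁻¹ = y →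
      g * piPart {p}ᶜ n * g⁻¹ = a → ε n = f a
  eq_zero : ∀ n : G, n ∉ N ∨ (¬ ∃ g : G, g * piPart {p} n * g⁻¹ = y) → ε n = 0

lemma IsExtension.apply_mul (E : IsExtension y f ε) (S : AlgSetup N p) (hy : y ∈ hall {p} N)
    (a : hall {p}ᶜ N) : ε (y * a) = f a :=
  E.eq_of_conj _ (N.mul_mem (hall_le _ _ hy) (hall_le _ _ a.2)) 1 a
    (by simpa using S.piPart_mul hy a.2) (by simpa using S.piPart_compl_mul hy a.2)

lemma conj_piPart_compl_mem {n : G} (hn : n ∈ N) (g : G) :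
    g * piPart {p}ᶜ n * g⁻¹ ∈ hall {p}ᶜ N :=
  (hall_normal {p}ᶜ N).conj_mem _ (piPart_mem_hall _ hn) g

lemma IsExtension.isClassFun (E : IsExtension y f ε) :
    IsClassFun (MulAut.conj : G →* MulAut G) ⊤ ε := by
  rw [isClassFun_conj_iff]
  intro h x
  by_cases hx : x ∈ N ∧ ∃ g : G, g * piPart {p} x * g⁻¹ = y
  · obtain ⟨hxN, g, hg⟩ := hx
    rw [E.eq_of_conj x hxN g ⟨_, conj_piPart_compl_mem hxN g⟩ hg rfl]
    refine E.eq_of_conj _ (Subgroup.Normal.conj_mem ‹_› x hxN h) (g * h⁻¹) _ ?_ ?_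
    · rw [piPart_conj, ← hg]; group
    · rw [piPart_conj]; group
  · have h1 := hx
    rw [not_and_or] at h1
    rw [E.eq_zero x h1]
    refine E.eq_zero _ ?_
    rw [← not_and_or]
    rintro ⟨h2, g, h3⟩
    refine hx ⟨?_, g * h, ?_⟩
    · simpa [mul_assoc] using Subgroup.Normal.conj_mem ‹_› _ h2 h⁻¹
    · rw [← h3, piPart_conj]; group

lemma IsExtension.exists_isConj (E : IsExtension y f ε) {x : G} (hx : ε x ≠ 0) :
    ∃ a : hall {p}ᶜ N, IsConj (y * a) x := by
  have h : x ∈ N ∧ ∃ g : G, g * piPart {p} x * g⁻¹ = y := by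
    by_contra h
    rw [not_and_or] at h
    exact hx (E.eq_zero x h)
  obtain ⟨hxN, g, hg⟩ := h
  refine ⟨⟨_, conj_piPart_compl_mem hxN g⟩, (isConj_iff.2 ⟨g, ?_⟩).symm⟩
  rw [← hg]
  conv_lhs => rw [← piPart_mul_piPart_compl {p} (isOfFinOrder_of_finite x)]
  group

/-- Sums over the classes of `G` on which `ε` lives are sums over classes in `A`. -/
lemma IsExtension.classSum_eq (E : IsExtension y f ε) (S : AlgSetup N p) (hy : y ∈ hall {p} N)
    {μ : G → ℤ} (hμ : IsClassFun (MulAut.conj : G →* MulAut G) ⊤ μ) :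
    classSum (MulAut.conj : G →* MulAut G) ⊤ (fun g => ε g * μ g) =
      classSum (MulAut.conjNormal : G →* MulAut (hall {p}ᶜ N)) (Subgroup.centralizer {y})
        (fun a => f a * μ (y * a)) := by
  classical
  have := Fintype.ofFinite (Quotient (classSetoid (MulAut.conj : G →* MulAut G) ⊤))
  have := Fintype.ofFinite (Quotient (classSetoid
    (MulAut.conjNormal : G →* MulAut (hall {p}ᶜ N)) (Subgroup.centralizer {y})))
  have hF : IsClassFun (MulAut.conj : G →* MulAut G) ⊤ (fun g => ε g * μ g) := fun g hg x => by
    simp only [E.isClassFun g hg x, hμ g hg x]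
  rw [classSum_eq_sum, classSum_eq_sum]
  symm
  refine Finset.sum_of_injOn (fun X => Quotient.mk _ (y * (X.out : hall {p}ᶜ N))) ?_ (by simp) ?_ ?_
  -- Taking `p`-parts and `p'`-parts, an element conjugating `y a` to `y b` centralizes `y` and
  -- takes `a` to `b`. So `G`-classes meeting `yA` correspond to `C_G(y)`-classes in `A`.
  · intro X _ Y _ h
    obtain ⟨c, hc⟩ := isConj_iff.1 (isConj_iff_mk_eq.2 h)
    have h1 : c * y * c⁻¹ = y := by
      have := congrArg (piPart {p}) hc
      rwa [piPart_conj, S.piPart_mul hy X.out.2, S.piPart_mul hy Y.out.2] at this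
    have h2 : c * X.out * c⁻¹ = (Y.out : G) := by
      have := congrArg (piPart {p}ᶜ) hc
      rwa [piPart_conj, S.piPart_compl_mul hy X.out.2, S.piPart_compl_mul hy Y.out.2] at this
    rw [← Quotient.out_eq X, ← Quotient.out_eq Y]
    refine Quotient.sound (s := classSetoid _ _) ⟨c, ?_, Subtype.ext ?_⟩
    · rw [Subgroup.mem_centralizer_singleton_iff]
      exact mul_inv_eq_iff_eq_mul.1 h1
    · rw [MulAut.conjNormal_apply, h2]
  · intro X _ hX
    by_contra h
    obtain ⟨a, ha⟩ := E.exists_isConj (left_ne_zero_of_mul h)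
    refine hX ⟨Quotient.mk _ a, by simp, ?_⟩
    refine Eq.trans ?_ (Quotient.out_eq X)
    refine isConj_iff_mk_eq.1 (IsConj.trans ?_ ha)
    obtain ⟨c, hc, e⟩ := Quotient.mk_out (s := classSetoid
      (MulAut.conjNormal : G →* MulAut (hall {p}ᶜ N)) (Subgroup.centralizer {y})) a
    refine isConj_iff.2 ⟨c, ?_⟩
    rw [Subgroup.mem_centralizer_singleton_iff] at hc
    have h1 : c * y * c⁻¹ = y := by rw [hc]; group
    have h2 := congrArg Subtype.val e
    rw [MulAut.conjNormal_apply] at h2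
    have h3 : ∀ z : G, c * (y * z) * c⁻¹ = (c * y * c⁻¹) * (c * z * c⁻¹) := fun z => by group
    rw [h3, h1]
    exact congrArg (y * ·) h2
  · intro X _
    exact ((hF.out _).trans (by rw [E.apply_mul S hy])).symm

/-- The combination of eigenvalue multiplicities given by `f` is non-negative. -/
lemma IsExtension.classSum_brauerMult_nonneg (E : IsExtension y f ε) (S : AlgSetup N p)
    (hy : y ∈ hall {p} N)
    (hf : MemE (MulAut.conjNormal : G →* MulAut (hall {p}ᶜ N)) (Subgroup.centralizer {y}) f)
    {F : Type*} [Field F] [IsAlgClosed F] (θ : F →*₀ ℂ) {r : ℕ}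
    (ρ : Representation F G (Fin r → F)) (ξ : ℂ) :
    0 ≤ classSum (MulAut.conj : G →* MulAut G) ⊤ (fun g => ε g * (brauerMult θ ρ g ξ : ℤ)) := by
  classical
  have := Fintype.ofFinite (hall {p}ᶜ N)
  rw [E.classSum_eq S hy (μ := fun g => (brauerMult θ ρ g ξ : ℤ))
    (isClassFun_brauerMult θ ρ ξ)]
  have hH : (0 : ℤ) < Nat.card (Subgroup.centralizer {y}) := by exact_mod_cast Nat.card_pos
  refine nonneg_of_mul_nonneg_right (b := classSum _ _ _) ?_ hH
  rw [card_mul_classSum]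
  swap
  · intro h hh a
    change f _ * (brauerMult θ ρ (y * _) ξ : ℤ) = f a * (brauerMult θ ρ (y * a) ξ : ℤ)
    rw [hf.classFun h hh, MulAut.conjNormal_apply]
    rw [Subgroup.mem_centralizer_singleton_iff] at hh
    have h1 : y * (h * a * h⁻¹) = h * (y * a) * h⁻¹ := by
      rw [← mul_assoc, ← mul_assoc, ← hh]; group
    rw [h1, brauerMult_conj]
  -- The subgroup generated by `y` and `A` is commutative, so its linear characters describe the
  -- eigenvalues at all `y a` simultaneously.
  set T := insert y (hall {p}ᶜ N : Set G) with hT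
  have hcomm : ∀ x ∈ T, ∀ z ∈ T, x * z = z * x := by
    rintro x (rfl | hx) z (rfl | hz)
    · rfl
    · exact S.commute hy hz
    · exact (S.commute hy hx).symm
    · exact S.comm x hx z hz
  have hc := Subgroup.isMulCommutative_closure hcomm
  obtain ⟨Λ, hΛ⟩ := exists_roots_charpoly_eq (ρ.comp (Subgroup.closure T).subtype) (fun x z => by
    have h : Commute x z := mul_comm' x z
    exact h.map _)
  let y' : Subgroup.closure T := ⟨y, Subgroup.subset_closure (Set.mem_insert _ _)⟩
  let ι : hall {p}ᶜ N →* Subgroup.closure T := Subgroup.inclusion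
    (fun x hx => Subgroup.subset_closure (Set.mem_insert_of_mem _ hx))
  -- A linear character `l` contributes to the eigenvalue `ξ` at `y a` exactly when `a` lies in the
  -- fibre of `θ ∘ l` on `A` over `ξ / θ (l y)`.
  have h2 : ∀ a : hall {p}ᶜ N, (brauerMult θ ρ (y * a) ξ : ℤ) =
      (Λ.map fun l => if θ (l (ι a)) = ξ / θ (l y') then (1 : ℤ) else 0).sum := by
    intro a
    have h3 := hΛ (y' * ι a)
    have h4 : brauerMult θ ρ (y * a) ξ = ((Λ.map fun l => l (y' * ι a)).map θ).count ξ := by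
      rw [← h3, brauerMult]
      congr!
    have h5 : ∀ l : Subgroup.closure T →* F, (ξ = θ (l (y' * ι a))) ↔
        θ (l (ι a)) = ξ / θ (l y') := by
      intro l
      have h6 : θ (l y') ≠ 0 := by
        rw [map_ne_zero]
        exact (((Group.isUnit y').map l).ne_zero)
      rw [eq_div_iff h6, map_mul, map_mul, eq_comm, mul_comm]
    rw [h4, Multiset.map_map]
    clear hΛ h3 h4
    induction Λ using Multiset.induction_on with
    | empty => simp
    | cons l s ih =>
      rw [Multiset.map_cons, Multiset.count_cons, Multiset.map_cons, Multiset.sum_cons, ← ih]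
      simp only [Function.comp_apply, h5]
      push_cast
      ring
  simp only [h2]
  clear h2 hΛ
  induction Λ using Multiset.induction_on with
  | empty => simp
  | cons l s ih =>
    simp only [Multiset.map_cons, Multiset.sum_cons, mul_add, Finset.sum_add_distrib]
    refine add_nonneg ?_ ih
    have := sum_fiber_nonneg (w := fun c => (Nat.card (fixer MulAut.conjNormal
      (Subgroup.centralizer {y}) c) : ℤ) * f c) hf.cosetIneq
      (((θ : F →* ℂ).comp l).comp ι) (ξ / θ (l y'))
    rw [Finset.sum_filter] at this
    refine this.trans_eq (Finset.sum_congr rfl fun a _ => ?_)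
    simp only [mul_ite, mul_one, mul_zero]
    rfl

/-- The `p`-part of both products is `y`; for `r ≠ p` the factor `y` is absorbed by the `r'`-part.
-/
lemma locallyConj_mul (S : AlgSetup N p) (hy : y ∈ hall {p} N) {a b : hall {p}ᶜ N}
    (hab : LocallyConj (MulAut.conjNormal : G →* MulAut (hall {p}ᶜ N)) a b) :
    LocallyConj (MulAut.conj : G →* MulAut G) (y * a) (y * b) := by
  intro r hr
  by_cases hrp : r = p
  · subst hrp
    exact ⟨1, by simp [S.piPart_mul hy a.2, S.piPart_mul hy b.2]⟩
  · obtain ⟨g, hg⟩ := hab r hr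
    refine ⟨g, ?_⟩
    have key : ∀ c ∈ hall {p}ᶜ N, piPart {r} (y * c) = piPart {r} c := by
      intro c hc
      have h1 := piPart_mul_piPart_compl {r} (isOfFinOrder_of_finite c)
      have h2 : Commute (piPart {r} c) (piPart {r}ᶜ c) := (Commute.refl _).pow_pow _ _
      have h3 : Commute y (piPart {r} c) := (S.commute hy hc).pow_right _
      have h4 : Commute y (piPart {r}ᶜ c) := (S.commute hy hc).pow_right _
      have h5 : y * c = piPart {r} c * (y * piPart {r}ᶜ c) := by
        rw [← mul_assoc, ← h3.eq, mul_assoc, h1]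
      rw [h5]
      refine piPart_mul_of_commute _ (isOfFinOrder_of_finite _) (isOfFinOrder_of_finite _)
        (h3.symm.mul_right h2) (isPiElt_piPart _ (isOfFinOrder_of_finite _))
        (IsPiElt.mul h4 ?_ (isPiElt_piPart _ (isOfFinOrder_of_finite _)))
      intro q hq hd hqr
      exact hrp (hqr.symm.trans (S.isPi y hy q hq hd))
    rw [key a a.2, key b b.2]
    have := congrArg (hall {p}ᶜ N).subtype hg
    rwa [map_piPart _ _ (Subgroup.subtype_injective _), Subgroup.subtype_apply,
      MulAut.conjNormal_apply, ← Subgroup.subtype_apply, map_piPart _ _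
      (Subgroup.subtype_injective _)] at this

/-- For a function in the list, conditions (I), (II) and (III) supply the sum, the support and the
sign; the order is that of `y a₀`, with `a₀` from the local class in (II). -/
theorem heLPAdmissible_of_algAdmissible [Group.IsNilpotent N] (hp : p.Prime)
    (hc : ∀ x ∈ hall {p}ᶜ N, ∀ y ∈ hall {p}ᶜ N, x * y = y * x) {ε : G → ℤ}
    (h : AlgAdmissible N p ε) : ∃ n, HeLPAdmissible N n ε := by
  classical
  rcases h with ⟨m, hm, rfl⟩ | ⟨y, hy, f, hf, h1, h2⟩
  · have hcl : IsClassFun (MulAut.conj : G →* MulAut G) ⊤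
        (fun g => if IsConj m g then (1 : ℤ) else 0) := by
      rw [isClassFun_conj_iff]
      intro g x
      have h1 : IsConj x (g * x * g⁻¹) := isConj_iff.2 ⟨g, rfl⟩
      have h2 : IsConj m (g * x * g⁻¹) ↔ IsConj m x :=
        ⟨fun h => h.trans h1.symm, fun h => h.trans h1⟩
      simp only [h2]
    refine ⟨orderOf m, m, hm, rfl, powAug (fun g => if IsConj m g then 1 else 0),
      heLPSystem_powAug ?_ ?_ ?_, ?_⟩
    · intro x hx
      have : IsConj m x := by
        by_contra h
        exact hx (if_neg h)
      exact LocallyConj.trans_isConj (fun r _ => ⟨1, by simp⟩) this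
    · exact classSum_ite_isConj (F := fun _ => (1 : ℤ)) (fun _ _ _ => rfl) m
    · intro F _ _ θ r ρ ξ
      have := classSum_ite_isConj (F := fun g => (brauerMult θ ρ g ξ : ℤ))
        (isClassFun_brauerMult θ ρ ξ) m
      simp only [ite_mul, one_mul, zero_mul]
      rw [this]
      positivity
    · rw [powAug_one hcl]
  · have S : AlgSetup N p := ⟨hc, fun _ => isPiElt_of_mem_hall_prime hp⟩
    have E : IsExtension y f ε := ⟨h1, h2⟩
    obtain ⟨a₀, ha₀⟩ := hf.support
    refine ⟨_, y * a₀, N.mul_mem (hall_le _ _ hy) (hall_le _ _ a₀.2), rfl, powAug ε,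
      heLPSystem_powAug ?_ ?_ ?_, powAug_one E.isClassFun⟩
    · intro x hx
      obtain ⟨a, ha⟩ := E.exists_isConj hx
      refine (locallyConj_mul S hy (ha₀ a ?_)).trans_isConj ha
      rwa [← E.apply_mul S hy, E.isClassFun.eq_of_isConj ha]
    · have := E.classSum_eq S hy (μ := fun _ => 1) (fun _ _ _ => rfl)
      simp only [mul_one] at this
      rw [this, hf.sumOne]
    · exact fun F _ _ θ r ρ ξ => E.classSum_brauerMult_nonneg S hy hf θ ρ ξ

end Algorithm

/-! ### Structure and conjugacy in the groups `G_d(α, β)` -/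

section GroupsOfTypeGd

variable {K L : Type*} [Field K] [Field L]

@[simp] lemma scaleAut_apply (s : Kˣ) (t : Lˣ) (z : Multiplicative (K × L)) :
    scaleAut s t z = Multiplicative.ofAdd (s * z.toAdd.1, t * z.toAdd.2) := rfl

/-- `scaleAut` as a homomorphism. -/
def scaleHom : Kˣ × Lˣ →* MulAut (Multiplicative (K × L)) where
  toFun u := scaleAut u.1 u.2
  map_one' := by ext z <;> simp
  map_mul' u v := by ext z <;> simp [mul_assoc]

lemma scaleHom_apply (u : Kˣ × Lˣ) (z : Multiplicative (K × L)) :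
    scaleHom u z = Multiplicative.ofAdd ((u.1 : K) * z.toAdd.1, (u.2 : L) * z.toAdd.2) := rfl

variable {d : ℕ} {α : Kˣ} {β : Lˣ}

/-- The generators change the exponents `(i, j)` by `(d, 0)`, `(0, d)` and `(1, 1)`, so `H` is
described by the one congruence `i ≡ j` modulo `d`. -/
lemma mem_actGroup {σ : MulAut (Multiplicative (K × L))} :
    σ ∈ actGroup d α β ↔ ∃ i j : ℤ, (d : ℤ) ∣ i - j ∧ scaleHom (α ^ i, β ^ j) = σ := by
  constructor
  · intro h
    induction h using Subgroup.closure_induction with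
    | mem x hx =>
      rcases hx with rfl | rfl | rfl
      · exact ⟨d, 0, by simp, by ext <;> simp [scaleHom_apply]⟩
      · exact ⟨0, d, by simp, by ext <;> simp [scaleHom_apply]⟩
      · exact ⟨1, 1, by simp, by ext <;> simp [scaleHom_apply]⟩
    | one => exact ⟨0, 0, by simp, by ext <;> simp [scaleHom_apply]⟩
    | mul x y _ _ ihx ihy =>
      obtain ⟨i, j, h, rfl⟩ := ihx
      obtain ⟨k, l, h', rfl⟩ := ihy
      refine ⟨i + k, j + l, ?_, by rw [← map_mul, zpow_add, zpow_add]; rfl⟩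
      rw [add_sub_add_comm]
      exact dvd_add h h'
    | inv x _ ih =>
      obtain ⟨i, j, h, rfl⟩ := ih
      refine ⟨-i, -j, ?_, by rw [← map_inv, zpow_neg, zpow_neg]; rfl⟩
      rw [neg_sub_neg, ← neg_sub]
      exact h.neg_right
  · rintro ⟨i, j, ⟨k, hk⟩, rfl⟩
    have h1 : (α ^ i, β ^ j) = (α ^ d, (1 : Lˣ)) ^ k * (α, β) ^ j := by
      rw [show i = d * k + j by rw [← hk]; ring]
      ext <;> simp [zpow_add, zpow_mul]
    rw [h1, map_mul, map_zpow, map_zpow]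
    exact Subgroup.mul_mem _
      (Subgroup.zpow_mem _ (Subgroup.subset_closure (by left; rfl)) _)
      (Subgroup.zpow_mem _ (Subgroup.subset_closure (by right; right; rfl)) _)

/-- The element `(x, y)` of the normal subgroup `N` of `G_d(α, β)`. -/
abbrev nElt (d : ℕ) (α : Kˣ) (β : Lˣ) (z : Multiplicative (K × L)) : Gd d α β :=
  SemidirectProduct.inl z

lemma conj_nElt (g : Gd d α β) (z : Multiplicative (K × L)) :
    g * nElt d α β z * g⁻¹ = nElt d α β (g.right.1 z) := by
  obtain ⟨n, h⟩ := g
  ext1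
  · simp [mul_comm]
  · simp

lemma isConj_nElt {z z' : Multiplicative (K × L)} :
    IsConj (nElt d α β z) (nElt d α β z') ↔ ∃ σ ∈ actGroup d α β, σ z = z' := by
  rw [isConj_iff]
  constructor
  · rintro ⟨g, hg⟩
    rw [conj_nElt] at hg
    exact ⟨g.right.1, g.right.2, SemidirectProduct.inl_injective hg⟩
  · rintro ⟨σ, hσ, rfl⟩
    exact ⟨SemidirectProduct.inr ⟨σ, hσ⟩, by rw [conj_nElt]; rfl⟩

/-- The parameters of a group of type `G_d(p, q)`. -/
structure IsType (p q d : ℕ) (α : Kˣ) (β : Lˣ) : Prop where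
  prime_p : p.Prime
  prime_q : q.Prime
  ne : p ≠ q
  dvd_p : d ∣ p ^ 2 - 1
  dvd_q : d ∣ q ^ 2 - 1
  card_K : Nat.card K = p ^ 2
  card_L : Nat.card L = q ^ 2
  gen_α : Subgroup.zpowers α = ⊤
  gen_β : Subgroup.zpowers β = ⊤

namespace IsType

variable {p q : ℕ}

lemma symm (T : IsType p q d α β) : IsType q p d β α :=
  ⟨T.prime_q, T.prime_p, T.ne.symm, T.dvd_q, T.dvd_p, T.card_L, T.card_K, T.gen_β, T.gen_α⟩

lemma finite_K (T : IsType p q d α β) : Finite K :=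
  Nat.finite_of_card_ne_zero (T.card_K ▸ pow_ne_zero 2 T.prime_p.ne_zero)

lemma finite_L (T : IsType p q d α β) : Finite L := T.symm.finite_K

lemma d_pos (T : IsType p q d α β) : 0 < d := by
  have := Nat.one_lt_pow two_ne_zero T.prime_p.one_lt
  exact Nat.pos_of_dvd_of_pos T.dvd_p (by omega)

lemma charP_K (T : IsType p q d α β) : CharP K p := by
  have := T.finite_K
  have := Fintype.ofFinite K
  have : Fact p.Prime := ⟨T.prime_p⟩
  exact charP_of_card_eq_prime_pow (f := 2) (by rw [Fintype.card_eq_nat_card, T.card_K])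

lemma charP_L (T : IsType p q d α β) : CharP L q := T.symm.charP_K

lemma orderOf_α (T : IsType p q d α β) : orderOf α = p ^ 2 - 1 := by
  have := T.finite_K
  rw [orderOf_eq_card_of_zpowers_eq_top T.gen_α, Nat.card_units, T.card_K]

lemma exists_zpow_α (T : IsType p q d α β) {x : K} (hx : x ≠ 0) :
    ∃ i : ℤ, ((α ^ i : Kˣ) : K) = x := by
  have : Units.mk0 x hx ∈ Subgroup.zpowers α := T.gen_α ▸ Subgroup.mem_top _
  obtain ⟨i, hi⟩ := this
  exact ⟨i, congrArg Units.val hi⟩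

lemma exists_zpow_β (T : IsType p q d α β) {x : L} (hx : x ≠ 0) :
    ∃ i : ℤ, ((β ^ i : Lˣ) : L) = x := T.symm.exists_zpow_α hx

/-- Exponents of `α` are well defined modulo `d`, since `d` divides the order `p ^ 2 - 1`. -/
lemma dvd_of_zpow_α_eq_one (T : IsType p q d α β) {i : ℤ} (h : α ^ i = 1) : (d : ℤ) ∣ i := by
  rw [← orderOf_dvd_iff_zpow_eq_one, T.orderOf_α] at h
  exact (Int.natCast_dvd_natCast.2 T.dvd_p).trans h

lemma dvd_of_zpow_β_eq_one (T : IsType p q d α β) {i : ℤ} (h : β ^ i = 1) : (d : ℤ) ∣ i :=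
  T.symm.dvd_of_zpow_α_eq_one h

lemma finite_actGroup (T : IsType p q d α β) : Finite (actGroup d α β) := by
  have := T.finite_K
  have := T.finite_L
  have : Finite (scaleHom : Kˣ × Lˣ →* MulAut (Multiplicative (K × L))).range := inferInstance
  refine Finite.of_injective (Subgroup.inclusion (K := (scaleHom : Kˣ × Lˣ →* _).range) ?_)
    (Subgroup.inclusion_injective _)
  intro σ hσ
  obtain ⟨i, j, _, rfl⟩ := mem_actGroup.1 hσ
  exact ⟨_, rfl⟩

lemma finite_Gd (T : IsType p q d α β) : Finite (Gd d α β) := by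
  have := T.finite_K
  have := T.finite_L
  have := T.finite_actGroup
  exact Finite.of_equiv _ SemidirectProduct.equivProd.symm

lemma nsmul_eq_zero_K (T : IsType p q d α β) {x : K} (hx : x ≠ 0) (k : ℕ) :
    k • x = 0 ↔ p ∣ k := by
  have := T.charP_K
  rw [nsmul_eq_mul, mul_eq_zero, or_iff_left hx, CharP.cast_eq_zero_iff K p]

lemma nsmul_eq_zero_L (T : IsType p q d α β) {x : L} (hx : x ≠ 0) (k : ℕ) :
    k • x = 0 ↔ q ∣ k := T.symm.nsmul_eq_zero_K hx k

open scoped Classical in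
lemma orderOf_nElt (T : IsType p q d α β) (x : K) (y : L) :
    orderOf (nElt d α β (Multiplicative.ofAdd (x, y))) =
      (if x = 0 then 1 else p) * (if y = 0 then 1 else q) := by
  have h1 : (if x = 0 then 1 else p).Coprime (if y = 0 then 1 else q) := by
    have := (Nat.coprime_primes T.prime_p T.prime_q).2 T.ne
    split_ifs
    exacts [Nat.coprime_one_left _, Nat.coprime_one_left _, Nat.coprime_one_right _, this]
  have h2 : ∀ k : ℕ, nElt d α β (Multiplicative.ofAdd (x, y)) ^ k = 1 ↔
      (if x = 0 then 1 else p) * (if y = 0 then 1 else q) ∣ k := by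
    intro k
    rw [← map_pow, ← ofAdd_nsmul, map_eq_one_iff _ SemidirectProduct.inl_injective, ofAdd_eq_one,
      Prod.smul_mk, Prod.mk_eq_zero]
    refine Iff.trans (and_congr ?_ ?_) ⟨fun h => h1.mul_dvd_of_dvd_of_dvd h.1 h.2,
      fun h => ⟨(dvd_mul_right _ _).trans h, (dvd_mul_left _ _).trans h⟩⟩
    · split_ifs with h
      · simp [h]
      · exact T.nsmul_eq_zero_K h k
    · split_ifs with h
      · simp [h]
      · exact T.nsmul_eq_zero_L h k
  exact Nat.dvd_antisymm (orderOf_dvd_iff_pow_eq_one.2 ((h2 _).2 dvd_rfl))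
    ((h2 _).1 (pow_orderOf_eq_one _))

lemma orderOf_nElt_eq_iff (T : IsType p q d α β) (z : Multiplicative (K × L)) :
    orderOf (nElt d α β z) = p * q ↔ z.toAdd.1 ≠ 0 ∧ z.toAdd.2 ≠ 0 := by
  have hp := T.prime_p.one_lt
  have hq := T.prime_q.one_lt
  have h := T.orderOf_nElt z.toAdd.1 z.toAdd.2
  rw [Prod.mk.eta, ofAdd_toAdd] at h
  rw [h]
  split_ifs with h1 h2 h2
  · simp [h1]; nlinarith
  · simp [h1]; nlinarith
  · simp [h2]; nlinarith
  · simp [h1, h2]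

/-- The element `m_i` before the embedding into `G_d(α, β)`. -/
def zElt (K : Type*) [Field K] {L : Type*} [Field L] (β : Lˣ) (i : ℕ) : Multiplicative (K × L) :=
  Multiplicative.ofAdd (1, (β : L) ^ i)

lemma mElt_eq (i : ℕ) : mElt d α β i = nElt d α β (zElt K β i) := rfl

lemma orderOf_mElt (T : IsType p q d α β) (i : ℕ) : orderOf (mElt d α β i) = p * q := by
  rw [mElt_eq, T.orderOf_nElt_eq_iff]
  exact ⟨one_ne_zero, pow_ne_zero _ β.ne_zero⟩

/-- The residue `v - u` modulo `d` is an invariant of the class of `(α ^ u, β ^ v)`, because `H`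
changes both exponents by congruent amounts. For `m_i` it is `i`. -/
lemma eq_of_isConj_mElt (T : IsType p q d α β) {i j : Fin d}
    (h : IsConj (mElt d α β i) (mElt d α β j)) : i = j := by
  rw [mElt_eq, mElt_eq, isConj_nElt] at h
  obtain ⟨σ, hσ, h⟩ := h
  obtain ⟨u, v, huv, rfl⟩ := mem_actGroup.1 hσ
  have h1 := congrArg (fun z => (Multiplicative.toAdd z).1) h
  have h2 := congrArg (fun z => (Multiplicative.toAdd z).2) h
  simp only [scaleHom_apply, zElt, toAdd_ofAdd, mul_one, Units.val_eq_one] at h1 h2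
  have h3 : β ^ (v + i - j : ℤ) = 1 := by
    rw [zpow_sub, zpow_add, mul_inv_eq_one, zpow_natCast, zpow_natCast]
    exact Units.ext (by simpa using h2)
  have h4 := T.dvd_of_zpow_α_eq_one h1
  have h5 := T.dvd_of_zpow_β_eq_one h3
  have h6 : (d : ℤ) ∣ (i : ℤ) - j := by
    have := dvd_add (dvd_sub huv h4) h5
    ring_nf at this ⊢
    simpa using this
  have h7 := Int.emod_emod_of_dvd (i : ℤ) (dvd_refl (d : ℤ))
  have h8 := (Int.emod_emod_of_dvd (j : ℤ) (dvd_refl (d : ℤ)))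
  have h9 := Int.emod_eq_emod_iff_emod_sub_eq_zero.2 (Int.emod_eq_zero_of_dvd h6)
  rw [Int.emod_eq_of_lt (by omega) (by omega), Int.emod_eq_of_lt (by omega) (by omega)] at h9
  exact Fin.ext (by omega)

lemma exists_isConj_mElt (T : IsType p q d α β) {z : Multiplicative (K × L)}
    (hz : z.toAdd.1 ≠ 0 ∧ z.toAdd.2 ≠ 0) : ∃ i : Fin d, IsConj (mElt d α β i) (nElt d α β z) := by
  obtain ⟨u, hu⟩ := T.exists_zpow_α hz.1
  obtain ⟨v, hv⟩ := T.exists_zpow_β hz.2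
  have hd : (0 : ℤ) < d := by exact_mod_cast T.d_pos
  have h0 := Int.emod_nonneg (v - u) hd.ne'
  have h1 := Int.emod_lt_of_pos (v - u) hd
  refine ⟨⟨((v - u) % d).toNat, by omega⟩, ?_⟩
  rw [mElt_eq, isConj_nElt]
  refine ⟨_, mem_actGroup.2 ⟨u, v - (v - u) % d, ?_, rfl⟩, ?_⟩
  · rw [show u - (v - (v - u) % d) = -((v - u) - (v - u) % d) by ring]
    exact (Int.dvd_self_sub_emod).neg_right
  · rw [scaleHom_apply]
    refine Multiplicative.toAdd.injective (Prod.ext ?_ ?_)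
    · simpa [zElt] using hu
    · have h2 : (β : L) ^ ((v - u) % d).toNat = ((β ^ ((v - u) % d) : Lˣ) : L) := by
        rw [← Units.val_pow_eq_pow_val, ← zpow_natCast, Int.toNat_of_nonneg h0]
      simp only [zElt, toAdd_ofAdd]
      rw [h2, ← Units.val_mul, ← zpow_add, sub_add_cancel]
      exact hv

/-- The elements `(α ^ u, β ^ u)` of `H` already act transitively on the non-zero vectors of each
component; only at order `pq` can several classes occur. -/
lemma isConj_of_orderOf_eq (T : IsType p q d α β) {z z' : Multiplicative (K × L)}
    (h : orderOf (nElt d α β z) = orderOf (nElt d α β z'))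
    (hz : orderOf (nElt d α β z) ≠ p * q) : IsConj (nElt d α β z) (nElt d α β z') := by
  classical
  have hp := T.prime_p.one_lt
  have hq := T.prime_q.one_lt
  have hpq := T.ne
  rw [isConj_nElt]
  induction z using Multiplicative.rec with | _ z => ?_
  induction z' using Multiplicative.rec with | _ z' => ?_
  obtain ⟨x, y⟩ := z
  obtain ⟨x', y'⟩ := z'
  rw [T.orderOf_nElt, T.orderOf_nElt] at h
  rw [T.orderOf_nElt] at hz
  by_cases hx : x = 0
  · by_cases hy : y = 0
    · have : x' = 0 ∧ y' = 0 := by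
        simp only [hx, hy, if_true] at h
        split_ifs at h <;> simp_all
      refine ⟨1, Subgroup.one_mem _, ?_⟩
      rw [hx, hy, this.1, this.2]; rfl
    · have : x' = 0 ∧ y' ≠ 0 := by
        simp only [hx, hy, if_true, if_false] at h
        split_ifs at h <;> simp_all
      obtain ⟨u, hu⟩ := T.exists_zpow_β (div_ne_zero this.2 hy)
      refine ⟨_, mem_actGroup.2 ⟨u, u, by simp, rfl⟩, ?_⟩
      simp [scaleHom_apply, hu, hy, this.1, hx, -Units.val_zpow_eq_zpow_val]
  · by_cases hy : y = 0
    · have : x' ≠ 0 ∧ y' = 0 := by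
        simp only [hx, hy, if_true, if_false] at h
        split_ifs at h <;> simp_all
      obtain ⟨u, hu⟩ := T.exists_zpow_α (div_ne_zero this.1 hx)
      refine ⟨_, mem_actGroup.2 ⟨u, u, by simp, rfl⟩, ?_⟩
      simp [scaleHom_apply, hu, hy, this.2, hx, -Units.val_zpow_eq_zpow_val]
    · simp [hx, hy] at hz

end IsType

end GroupsOfTypeGd

lemma sum_multiset_sum_map_comm {R ι κ : Type*} [AddCommMonoid R] (s : Finset ι) (Λ : Multiset κ)
    (f : ι → κ → R) :
    ∑ i ∈ s, (Λ.map (f i)).sum = (Λ.map fun l => ∑ i ∈ s, f i l).sum := by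
  induction Λ using Multiset.induction_on with
  | empty => simp
  | cons l t ih => simp [Finset.sum_add_distrib, ih]

/-! ### The HeLP restrictions in terms of linear characters of `N` -/

section HeLPForGd

variable {K L : Type*} [Field K] [Field L] {d : ℕ} {α : Kˣ} {β : Lˣ}

/-- The number of elements `h` of `H` for which `χ` takes the value `ξ` at `z ^ h`. -/
def hits (d : ℕ) (α : Kˣ) (β : Lˣ) (χ : Multiplicative (K × L) →* ℂ) (z : Multiplicative (K × L))
    (ξ : ℂ) : ℕ :=
  Nat.card {σ : actGroup d α β // χ (σ.1 z) = ξ}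

/-- The combination of the numbers of hits of the `m_i` with coefficients `x_i`. -/
def hitSum (α : Kˣ) (β : Lˣ) (x : Fin d → ℤ) (χ : Multiplicative (K × L) →* ℂ) (ξ : ℂ) : ℤ :=
  ∑ i : Fin d, (hits d α β χ (IsType.zElt K β i) ξ : ℤ) * x i

namespace IsType

variable {p q : ℕ}

/-- The multiplicity is constant on the `H`-orbit of `z`. Summing its description by linear
characters over all `σ ∈ H` and exchanging the sums gives numbers of hits. -/
lemma card_mul_brauerMult (T : IsType p q d α β) {F : Type*} [Field F] [IsAlgClosed F]
    (θ : F →*₀ ℂ) {r : ℕ} (ρ : Representation F (Gd d α β) (Fin r → F)) (ξ : ℂ) :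
    ∃ Λ : Multiset (Multiplicative (K × L) →* ℂ), ∀ z,
      Nat.card (actGroup d α β) * brauerMult θ ρ (nElt d α β z) ξ =
        (Λ.map fun χ => hits d α β χ z ξ).sum := by
  classical
  have := T.finite_actGroup
  have := Fintype.ofFinite (actGroup d α β)
  obtain ⟨Λ, hΛ⟩ := exists_roots_charpoly_eq (ρ.comp SemidirectProduct.inl) (fun x z => by
    have h : Commute x z := mul_comm x z
    exact h.map _)
  refine ⟨Λ.map fun l => (θ : F →* ℂ).comp l, fun z => ?_⟩
  have h1 : ∀ σ : actGroup d α β, brauerMult θ ρ (nElt d α β z) ξ =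
      (Λ.map fun l => if θ (l (σ.1 z)) = ξ then 1 else 0).sum := by
    intro σ
    obtain ⟨c, hc⟩ := isConj_iff.1
      (isConj_nElt.2 ⟨σ.1, σ.2, rfl⟩ : IsConj (nElt d α β z) (nElt d α β (σ.1 z)))
    have h2 : brauerMult θ ρ (nElt d α β z) ξ =
        ((Λ.map fun l => l (σ.1 z)).map θ).count ξ := by
      rw [← hΛ, ← brauerMult_conj θ ρ c, hc, brauerMult]
      congr!
    rw [h2, Multiset.map_map]
    clear hΛ h2
    induction Λ using Multiset.induction_on with
    | empty => simp
    | cons l s ih =>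
      rw [Multiset.map_cons, Multiset.count_cons, Multiset.map_cons, Multiset.sum_cons, ← ih,
        add_comm]
      simp only [Function.comp_apply, eq_comm]
  rw [Nat.card_eq_fintype_card, ← Finset.card_univ, ← smul_eq_mul, ← Finset.sum_const,
    Finset.sum_congr rfl fun σ _ => h1 σ]
  clear h1 hΛ
  induction Λ using Multiset.induction_on with
  | empty => simp
  | cons l s ih =>
    simp only [Multiset.map_cons, Multiset.sum_cons, Finset.sum_add_distrib, ih]
    congr 1
    rw [hits, Nat.card_eq_fintype_card, Fintype.card_subtype, Finset.card_filter]
    rfl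

/-- The exponent of the `r`-part is divisible by `p` or by `q` and kills the corresponding
component; on the remaining one `H` is transitive. -/
lemma locallyConj_mElt (T : IsType p q d α β) (i : ℕ) :
    LocallyConj (MulAut.conj : Gd d α β →* _) (mElt d α β 0) (mElt d α β i) := by
  have := T.charP_K
  have := T.charP_L
  intro r hr
  suffices IsConj (piPart {r} (mElt d α β 0)) (piPart {r} (mElt d α β i)) by
    obtain ⟨g, hg⟩ := isConj_iff.1 this
    exact ⟨g, hg⟩
  rw [piPart_eq_pow, piPart_eq_pow, T.orderOf_mElt, T.orderOf_mElt]
  set e := piExp {r} (p * q) with he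
  have h1 : ∀ s : ℕ, s.Prime → s ∣ p * q → s ≠ r → s ∣ e := by
    intro s hs hd hsr
    have h0 : p * q ≠ 0 := mul_ne_zero T.prime_p.ne_zero T.prime_q.ne_zero
    rw [← piNat_mul_piNat_compl {r} h0, hs.dvd_mul] at hd
    rcases hd with hd | hd
    · exact (hsr (prime_dvd_piNat hs hd).1).elim
    · exact hd.trans (piNat_compl_dvd_piExp _ _)
  rw [mElt_eq, mElt_eq, ← map_pow, ← map_pow, isConj_nElt]
  by_cases hp : p = r
  · have hq : q ∣ e := h1 q T.prime_q (dvd_mul_left _ _) (fun h => T.ne (hp.trans h.symm))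
    refine ⟨1, Subgroup.one_mem _, ?_⟩
    rw [zElt, zElt, ← ofAdd_nsmul, ← ofAdd_nsmul, MulAut.one_apply, Prod.smul_mk, Prod.smul_mk,
      nsmul_eq_mul, nsmul_eq_mul e (β.1 ^ i), (CharP.cast_eq_zero_iff L q e).2 hq]
    simp [(CharP.cast_eq_zero_iff L q e).2 hq]
  · have hp' : p ∣ e := h1 p T.prime_p (dvd_mul_right _ _) hp
    refine ⟨_, mem_actGroup.2 ⟨i, i, by simp, rfl⟩, ?_⟩
    rw [zElt, zElt, ← ofAdd_nsmul, ← ofAdd_nsmul, scaleHom_apply, Prod.smul_mk, Prod.smul_mk,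
      nsmul_eq_mul, nsmul_eq_mul, nsmul_eq_mul, (CharP.cast_eq_zero_iff K p e).2 hp']
    simp [mul_comm]

/-- If all combinations of numbers of hits are non-negative, the HeLP restrictions hold. -/
theorem heLPVector_of_hitSum_nonneg (T : IsType p q d α β) {x : Fin d → ℤ} (h1 : ∑ i, x i = 1)
    (h : ∀ χ ξ, 0 ≤ hitSum α β x χ ξ) : HeLPVector d α β (p * q) x := by
  classical
  have := T.finite_Gd
  have := T.finite_actGroup
  set ε : Gd d α β → ℤ := fun g => ∑ i : Fin d, if IsConj (mElt d α β i) g then x i else 0 with hε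
  have hcl : IsClassFun (MulAut.conj : Gd d α β →* _) ⊤ ε := by
    rw [isClassFun_conj_iff]
    intro g y
    have h1 : IsConj y (g * y * g⁻¹) := isConj_iff.2 ⟨g, rfl⟩
    have h2 : ∀ m, IsConj m (g * y * g⁻¹) ↔ IsConj m y := fun m =>
      ⟨fun h => h.trans h1.symm, fun h => h.trans h1⟩
    simp only [hε, h2]
  have hεm : ∀ i : Fin d, ε (mElt d α β i) = x i := by
    intro i
    rw [hε]
    simp only
    rw [Finset.sum_eq_single i]
    · rw [if_pos (IsConj.refl _)]
    · exact fun j _ hj => if_neg fun h => hj (T.eq_of_isConj_mElt h)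
    · exact fun h => (h (Finset.mem_univ _)).elim
  have hsupp : ∀ g, ε g ≠ 0 → ∃ i : Fin d, IsConj (mElt d α β i) g := by
    intro g hg
    by_contra! h
    exact hg (Finset.sum_eq_zero fun i _ => if_neg (h i))
  have hsum : ∀ μ : Gd d α β → ℤ, IsClassFun (MulAut.conj : Gd d α β →* _) ⊤ μ →
      classSum (MulAut.conj : Gd d α β →* _) ⊤ (fun g => ε g * μ g) =
        ∑ i : Fin d, x i * μ (mElt d α β i) := by
    intro μ hμ
    rw [classSum_eq_sum_reps (ι := Fin d) _ (fun i => mElt d α β i)]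
    · simp only [hεm]
    · exact fun i j hij => T.eq_of_isConj_mElt hij
    · exact fun g hg => hsupp g (left_ne_zero_of_mul hg)
    · exact fun g hg y => by simp only [hcl g hg y, hμ g hg y]
  refine ⟨ε, ⟨mElt d α β 0, ⟨_, rfl⟩, T.orderOf_mElt 0, powAug ε, heLPSystem_powAug ?_ ?_ ?_,
    powAug_one hcl⟩, hεm⟩
  · intro g hg
    obtain ⟨i, hi⟩ := hsupp g hg
    exact (T.locallyConj_mElt i).trans_isConj hi
  · have := hsum (fun _ => 1) (fun _ _ _ => rfl)
    simpa [h1] using this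
  · intro F _ _ θ r ρ ξ
    rw [hsum _ (isClassFun_brauerMult θ ρ ξ)]
    obtain ⟨Λ, hΛ⟩ := T.card_mul_brauerMult θ ρ ξ
    have hH : (0 : ℤ) < Nat.card (actGroup d α β) := by exact_mod_cast Nat.card_pos
    refine nonneg_of_mul_nonneg_right (b := ∑ i : Fin d, _) ?_ hH
    have h2 : (Nat.card (actGroup d α β) : ℤ) *
        ∑ i : Fin d, x i * (brauerMult θ ρ (mElt d α β i) ξ : ℤ) =
        (Λ.map fun χ => hitSum α β x χ ξ).sum := by
      have h3 : ∀ i : Fin d, (Nat.card (actGroup d α β) : ℤ) *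
          (x i * (brauerMult θ ρ (mElt d α β i) ξ : ℤ)) =
          (Λ.map fun χ => (hits d α β χ (zElt K β i) ξ : ℤ) * x i).sum := by
        intro i
        have h4 := congrArg (Nat.cast : ℕ → ℤ) (hΛ (zElt K β i))
        rw [Nat.cast_mul, ← mElt_eq, Nat.cast_multiset_sum, Multiset.map_map] at h4
        rw [mul_left_comm, h4, mul_comm, ← Multiset.sum_map_mul_right]
        rfl
      rw [Finset.mul_sum, Finset.sum_congr rfl fun i _ => h3 i, sum_multiset_sum_map_comm]
      rfl
    rw [h2]
    refine Multiset.sum_nonneg fun a ha => ?_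
    obtain ⟨χ, _, rfl⟩ := Multiset.mem_map.1 ha
    exact h χ ξ

/-- The primary parts of `g` are conjugate to powers of `m`, so they lie in the normal subgroup `N`.
-/
lemma mem_baseN_of_locallyConj (T : IsType p q d α β) {m g : Gd d α β} (hm : m ∈ baseN d α β)
    (h : LocallyConj (MulAut.conj : Gd d α β →* _) m g) :
    ∃ z, g = nElt d α β z ∧ orderOf (nElt d α β z) = orderOf m := by
  have := T.finite_Gd
  have h1 : g ∈ baseN d α β := by
    refine mem_of_forall_piPart_mem fun r hr => ?_
    obtain ⟨y, hy⟩ := h r hr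
    rw [← hy]
    exact (baseN_normal d α β).conj_mem _ (Subgroup.pow_mem _ hm _) y
  obtain ⟨z, rfl⟩ := h1
  exact ⟨z, rfl, h.orderOf_eq (isOfFinOrder_of_finite _) (isOfFinOrder_of_finite _)⟩

/-- The HeLP restrictions imply the inequalities for all complex characters. -/
theorem charIneq_of_heLPVector (T : IsType p q d α β) {x : Fin d → ℤ}
    (hx : HeLPVector d α β (p * q) x) {r : ℕ} (ρ : Representation ℂ (Gd d α β) (Fin r → ℂ)) :
    CharIneq d α β (p * q) x ρ := by
  have := T.finite_Gd
  obtain ⟨ε, ⟨m, hmN, hm, E, hE, rfl⟩, hεm⟩ := hx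
  have hn0 : p * q ≠ 0 := mul_ne_zero T.prime_p.ne_zero T.prime_q.ne_zero
  have hcl : ∀ k, k ∣ p * q → IsClassFun (MulAut.conj : Gd d α β →* _) ⊤ (E k) := fun k hk =>
    isClassFun_conj_iff.2 (hE.classFun k (hm ▸ hk))
  have hsum : ∀ {R : Type} [Ring R] (μ : Gd d α β → R),
      IsClassFun (MulAut.conj : Gd d α β →* _) ⊤ μ →
      classSum (MulAut.conj : Gd d α β →* _) ⊤ (fun g => (E 1 g : R) * μ g) =
        ∑ i : Fin d, (x i : R) * μ (mElt d α β i) := by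
    intro R _ μ hμ
    rw [classSum_eq_sum_reps (ι := Fin d) _ (fun i => mElt d α β i)]
    · simp only [hεm]
    · exact fun i j hij => T.eq_of_isConj_mElt hij
    · intro g hg
      have h0 : E 1 g ≠ 0 := by
        intro h0
        rw [h0, Int.cast_zero, zero_mul] at hg
        exact hg rfl
      obtain ⟨z, rfl, hz⟩ := T.mem_baseN_of_locallyConj hmN
        (by simpa using hE.support 1 (one_dvd _) g h0)
      exact T.exists_isConj_mElt ((T.orderOf_nElt_eq_iff z).1 (hz.trans hm))
    · exact fun g hg y => by simp only [hcl 1 (one_dvd _) g hg y, hμ g hg y]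
  have hx1 : ∑ i, x i = 1 := by
    have h0 := hsum (R := ℤ) (fun _ => 1) (fun _ _ _ => rfl)
    have h1 := hE.sumOne 1 (one_dvd _)
    simpa [h1] using h0.symm
  refine ⟨hx1, fun ξ hξ => ?_⟩
  set χ : Gd d α β → ℂ := brauerChar (MonoidWithZeroHom.id ℂ) ρ with hχ
  have hχc : ∀ j : ℕ, IsClassFun (MulAut.conj : Gd d α β →* _) ⊤ (fun g => χ (g ^ j)) :=
    fun j g _ y => by
      change χ (MulAut.conj g y ^ j) = _
      rw [← map_pow, MulAut.conj_apply, hχ, brauerChar_conj]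
  -- For `gcd(k, pq) = 1` this is the definition of `x`. Otherwise both sides equal the one value of
  -- `χ` involved, since `E e` and `x` both have sum `1`.
  have key : ∀ k : ℕ, classSum (MulAut.conj : Gd d α β →* _) ⊤ (fun g =>
      (E (Nat.gcd k (p * q)) g : ℂ) * χ (g ^ (k / Nat.gcd k (p * q)))) =
      ∑ i : Fin d, (x i : ℂ) * χ (mElt d α β i ^ k) := by
    intro k
    set e := Nat.gcd k (p * q) with he
    by_cases h1 : e = 1
    · rw [h1, Nat.div_one, hsum _ (hχc k)]
    · have hed : e ∣ p * q := Nat.gcd_dvd_right _ _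
      have hek : e * (k / e) = k := Nat.mul_div_cancel' (Nat.gcd_dvd_left _ _)
      have ho : ∀ y : Gd d α β, orderOf y = p * q → orderOf (y ^ e) = p * q / e := by
        intro y hy
        rw [orderOf_pow, hy, Nat.gcd_eq_right hed]
      have hne : p * q / e ≠ p * q := fun h => h1 (by
        have := Nat.div_mul_cancel hed
        rw [h] at this
        exact (Nat.mul_eq_left hn0).1 this)
      have h2 : ∀ z, orderOf (nElt d α β z) = p * q / e → ∀ i : ℕ,
          χ (nElt d α β z ^ (k / e)) = χ (mElt d α β i ^ k) := by
        intro z hz i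
        have h3 := ho _ (T.orderOf_mElt i)
        rw [mElt_eq, ← map_pow] at h3
        have h4 := T.isConj_of_orderOf_eq (hz.trans h3.symm) (hz ▸ hne)
        have h5 : nElt d α β (zElt K β i ^ e) = mElt d α β i ^ e := map_pow _ _ _
        rw [(hχc (k / e)).eq_of_isConj h4, h5, ← pow_mul, hek]
      -- The support of `E e` consists of elements of `N` of order `pq / e`, which form a single
      -- class; hence only the sum of `E e` matters.
      have h5 : ∀ g, (E e g : ℂ) * χ (g ^ (k / e)) = χ (mElt d α β 0 ^ k) * (E e g : ℂ) := by
        intro g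
        by_cases h0 : E e g = 0
        · simp [h0]
        · obtain ⟨z, rfl, hz⟩ := T.mem_baseN_of_locallyConj (Subgroup.pow_mem _ hmN e)
            (hE.support e (hm ▸ hed) g h0)
          rw [h2 z (hz.trans (ho m hm)) 0, mul_comm]
      rw [classSum_congr h5, ← mul_classSum, ← intCast_classSum, hE.sumOne e (hm ▸ hed)]
      have h6 : ∀ i : Fin d, χ (mElt d α β i ^ k) = χ (mElt d α β 0 ^ k) := by
        intro i
        have h7 := ho _ (T.orderOf_mElt 0)
        rw [mElt_eq, ← map_pow] at h7
        rw [← h2 _ h7 i, ← h2 _ h7 0]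
      simp only [h6]
      rw [← Finset.sum_mul, ← Int.cast_sum, hx1]
      simp
  obtain ⟨μ, hμ⟩ := hE.multiplicity ℂ (by rw [hm]; exact_mod_cast hn0) (MonoidWithZeroHom.id ℂ)
    (fun _ _ h => h) r ρ ξ (hm ▸ hξ)
  rw [hm] at hμ
  simp only [← hχ, key] at hμ
  have h8 : ((∑ i : Fin d, (mult ρ (mElt d α β i) ξ : ℤ) * x i : ℤ) : ℂ) = (μ : ℤ) := by
    rw [Int.cast_natCast, ← hμ, Int.cast_sum]
    have hp : ∀ i : ℕ, mElt d α β i ^ (p * q) = 1 := fun i => by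
      rw [← T.orderOf_mElt (d := d) (α := α) (β := β) i, pow_orderOf_eq_one]
    have h9 : ∀ i : Fin d, (((mult ρ (mElt d α β i) ξ : ℤ) * x i : ℤ) : ℂ) =
        ∑ k ∈ Finset.range (p * q), (1 / ((p * q : ℕ) : ℂ)) *
          (ξ⁻¹ ^ k * ((x i : ℂ) * χ (mElt d α β i ^ k))) := by
      intro i
      rw [Int.cast_mul, Int.cast_natCast, mult_eq_brauerMult ρ hn0 (hp i),
        ← sum_brauerChar_pow _ ρ hn0 (hp i) hξ, mul_right_comm, mul_comm, Finset.sum_mul]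
      exact Finset.sum_congr rfl fun k _ => by rw [hχ]; ring
    rw [Finset.sum_congr rfl fun i _ => h9 i, Finset.sum_comm, Finset.mul_sum]
    exact Finset.sum_congr rfl fun k _ => by rw [Finset.mul_sum, Finset.mul_sum]
  rw [Int.cast_inj.1 h8]
  positivity

end IsType

end HeLPForGd

/-! ### The induced character `χ_0` -/

section InducedCharacter

open Representation Module

variable {K L : Type*} [Field K] [Field L] {d : ℕ} {α : Kˣ} {β : Lˣ}
  (ψ : Multiplicative (K × L) →* ℂˣ)

/-- The space of the representation induced by `ψ`. -/
abbrev ChiSpace (d : ℕ) (α : Kˣ) (β : Lˣ) (ψ : Multiplicative (K × L) →* ℂˣ) :=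
  IndV (SemidirectProduct.inl : Multiplicative (K × L) →* Gd d α β) (linRep ψ)

@[simp] lemma linRep_apply {A : Type*} [Group A] (ψ : A →* ℂˣ) (a : A) (x : ℂ) :
    linRep ψ a x = ψ a * x := rfl

/-- The coordinates in the induced representation with respect to the coset representatives given
by the complement. -/
def chiCoord : ChiSpace d α β ψ →ₗ[ℂ] (actGroup d α β → ℂ) := by
  classical exact
  Coinvariants.lift _ (TensorProduct.lift ((Finsupp.lift _ ℂ _ fun g : Gd d α β =>
    (((ψ g.left)⁻¹ : ℂˣ) : ℂ) • LinearMap.single ℂ (fun _ => ℂ) g.right) ∘ₗ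
      (MonoidAlgebra.coeffLinearEquiv ℂ).toLinearMap)) (fun n => by
    ext g : 4
    funext h
    simp [Pi.single_apply])

lemma chiCoord_mk [DecidableEq (actGroup d α β)] (g : Gd d α β) (x : ℂ) :
    chiCoord ψ (IndV.mk _ _ g x) = Pi.single g.right (((ψ g.left)⁻¹ : ℂˣ) * x) := by
  funext h
  simp [chiCoord, Pi.single_apply]

/-- The image of `1` in the component of the induced representation that belongs to `h`. -/
def chiVec (h : actGroup d α β) : ChiSpace d α β ψ :=
  IndV.mk _ _ (SemidirectProduct.inr h) 1

lemma mk_inl_mul (n : Multiplicative (K × L)) (g : Gd d α β) (x : ℂ) :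
    (IndV.mk _ _ (SemidirectProduct.inl n * g) x : ChiSpace d α β ψ) =
      IndV.mk _ _ g (((ψ n)⁻¹ : ℂˣ) * x) := by
  have := Coinvariants.mk_self_apply (tprod ((leftRegular ℂ (Gd d α β)).comp
    (SemidirectProduct.inl : Multiplicative (K × L) →* Gd d α β)) (linRep ψ)) n
    (TensorProduct.mk ℂ _ _ (MonoidAlgebra.single g (1 : ℂ)) (((ψ n)⁻¹ : ℂˣ) * x))
  simpa using this

/-- Moving `z⁻¹` past the complement element `h` turns it into the inverse of `h z`, so `N` acts on
the line of `h` through the conjugate of `ψ` by `h`. -/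
lemma chiRep_nElt_chiVec (z : Multiplicative (K × L)) (h : actGroup d α β) :
    chiRep d α β ψ (nElt d α β z) (chiVec ψ h) = (ψ (h.1 z) : ℂ) • chiVec ψ h := by
  rw [chiVec, chiRep, ind_mk]
  have h1 : (SemidirectProduct.inr h : Gd d α β) * (nElt d α β z)⁻¹ =
      SemidirectProduct.inl (h.1 z)⁻¹ * SemidirectProduct.inr h := by
    ext1 <;> simp
  rw [h1, mk_inl_mul, map_inv, inv_inv, ← smul_eq_mul, map_smul]

lemma linearIndependent_chiVec : LinearIndependent ℂ (chiVec (d := d) (α := α) (β := β) ψ) := by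
  classical
  refine LinearIndependent.of_comp (chiCoord ψ) ?_
  have : chiCoord ψ ∘ chiVec ψ = fun h : actGroup d α β => Pi.single h (1 : ℂ) := by
    funext h
    rw [Function.comp_apply, chiVec, chiCoord_mk]
    simp
  rw [this]
  exact Pi.linearIndependent_single_one _ _

lemma span_chiVec : ⊤ ≤ Submodule.span ℂ (Set.range (chiVec (d := d) (α := α) (β := β) ψ)) := by
  set S := Submodule.span ℂ (Set.range (chiVec (d := d) (α := α) (β := β) ψ)) with hS
  have h0 : S.mkQ = 0 := by
    -- The quotient by the span vanishes: every `g` is `n h` with `n ∈ N`, and `n` only contributes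
    -- a scalar.
    refine IndV.hom_ext _ _ fun g => LinearMap.ext_ring ?_
    change S.mkQ (IndV.mk _ _ g 1) = 0
    rw [Submodule.mkQ_apply, Submodule.Quotient.mk_eq_zero, ← SemidirectProduct.inl_left_mul_inr_right g, mk_inl_mul,
      ← smul_eq_mul, map_smul]
    exact Submodule.smul_mem _ _ (Submodule.subset_span ⟨_, rfl⟩)
  rw [← Submodule.ker_mkQ S, h0, LinearMap.ker_zero]

/-- A basis of the induced representation on which `N` acts diagonally. -/
def chiBasis : Basis (actGroup d α β) ℂ (ChiSpace d α β ψ) :=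
  Basis.mk (linearIndependent_chiVec ψ) (span_chiVec ψ)

lemma finiteDimensional_chiSpace [Finite (actGroup d α β)] :
    FiniteDimensional ℂ (ChiSpace d α β ψ) := Module.Finite.of_basis (chiBasis ψ)

open Polynomial in
-- In the basis indexed by `H` the matrix of `z` is diagonal with entries `ψ (h z)`.
lemma IsType.mult_chiRep {p q : ℕ} (T : IsType p q d α β) (z : Multiplicative (K × L)) (ξ : ℂ) :
    mult (chiRep d α β ψ) (nElt d α β z) ξ = hits d α β ((Units.coeHom ℂ).comp ψ) z ξ := by
  classical
  have := T.finite_actGroup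
  have := T.finite_Gd
  have := Fintype.ofFinite (actGroup d α β)
  have := finiteDimensional_chiSpace (d := d) (α := α) (β := β) ψ
  rw [mult_eq_count (chiRep d α β ψ) (orderOf_pos (nElt d α β z)).ne' (pow_orderOf_eq_one _)]
  have h1 : LinearMap.toMatrix (chiBasis ψ) (chiBasis ψ) (chiRep d α β ψ (nElt d α β z)) =
      Matrix.diagonal fun h : actGroup d α β => (ψ (h.1 z) : ℂ) := by
    ext i j
    rw [LinearMap.toMatrix_apply]
    have h2 : chiBasis ψ j = chiVec ψ j := Basis.mk_apply _ _ _
    rw [h2]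
    erw [chiRep_nElt_chiVec]
    rw [← h2, map_smul, Basis.repr_self, Matrix.diagonal_apply, Finsupp.smul_apply,
      Finsupp.single_apply]
    simp only [eq_comm (a := j)]
    split_ifs with h <;> simp [h]
  rw [← LinearMap.charpoly_toMatrix _ (chiBasis ψ)]
  erw [h1]
  rw [Matrix.charpoly_diagonal, ← count_roots, roots_prod _ _
    (Finset.prod_ne_zero_iff.2 fun _ _ => X_sub_C_ne_zero _)]
  simp only [roots_X_sub_C, Multiset.count_bind, hits, Nat.card_eq_fintype_card,
    Fintype.card_subtype, Finset.card_filter, Multiset.count_singleton]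
  refine Finset.sum_congr rfl fun h _ => ?_
  simp only [eq_comm (a := ξ)]
  rfl

end InducedCharacter

/-! ### Linear characters of `N` and the reduction to `ψ_0` -/

section Characters

/-- A non-trivial character of a finite field is primitive, so its shifts are distinct; being as
many as there are characters, they exhaust the dual. -/
lemma exists_mulShift_eq {F : Type*} [Field F] [Finite F] {φ ψ : AddChar F ℂ} (hφ : φ ≠ 1)
    (hψ : ψ ≠ 1) : ∃ u : Fˣ, ∀ x, ψ x = φ (u * x) := by
  classical
  have := Fintype.ofFinite F
  have hb : Function.Bijective (AddChar.mulShift φ) := by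
    rw [Fintype.bijective_iff_injective_and_card]
    exact ⟨AddChar.to_mulShift_inj_of_isPrimitive (AddChar.IsPrimitive.of_ne_one hφ),
      AddChar.card_eq.symm⟩
  obtain ⟨u, rfl⟩ := hb.2 ψ
  have hu : u ≠ 0 := by
    rintro rfl
    exact hψ (AddChar.mulShift_zero φ)
  exact ⟨Units.mk0 u hu, fun x => rfl⟩

variable {K L : Type*} [Field K] [Field L]

/-- The restriction of a character of `N` to the first component. -/
def charFst (χ : Multiplicative (K × L) →* ℂ) : AddChar K ℂ where
  toFun x := χ (Multiplicative.ofAdd (x, 0))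
  map_zero_eq_one' := χ.map_one
  map_add_eq_mul' x y := by
    rw [← map_mul, ← ofAdd_add, Prod.mk_add_mk, add_zero]

/-- The restriction of a character of `N` to the second component. -/
def charSnd (χ : Multiplicative (K × L) →* ℂ) : AddChar L ℂ where
  toFun y := χ (Multiplicative.ofAdd (0, y))
  map_zero_eq_one' := χ.map_one
  map_add_eq_mul' x y := by
    rw [← map_mul, ← ofAdd_add, Prod.mk_add_mk, add_zero]

lemma char_apply (χ : Multiplicative (K × L) →* ℂ) (x : K) (y : L) :
    χ (Multiplicative.ofAdd (x, y)) = charFst χ x * charSnd χ y := by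
  change _ = χ _ * χ _
  rw [← map_mul, ← ofAdd_add, Prod.mk_add_mk, add_zero, zero_add]

variable {d : ℕ} {α : Kˣ} {β : Lˣ} {χ : Multiplicative (K × L) →* ℂ}

lemma hits_comp {σ : MulAut (Multiplicative (K × L))} (hσ : σ ∈ actGroup d α β)
    (z : Multiplicative (K × L)) (ξ : ℂ) :
    hits d α β (χ.comp σ.toMonoidHom) z ξ = hits d α β χ z ξ :=
  Nat.card_congr ((Equiv.mulLeft (⟨σ, hσ⟩ : actGroup d α β)).subtypeEquiv fun _ => Iff.rfl)

lemma hits_apply {σ : MulAut (Multiplicative (K × L))} (hσ : σ ∈ actGroup d α β)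
    (z : Multiplicative (K × L)) (ξ : ℂ) :
    hits d α β χ (σ z) ξ = hits d α β χ z ξ :=
  Nat.card_congr ((Equiv.mulRight (⟨σ, hσ⟩ : actGroup d α β)).subtypeEquiv fun _ => Iff.rfl)

lemma hitSum_nonneg_of_const {x : Fin d → ℤ} (h1 : ∑ i, x i = 1) {ξ : ℂ}
    (h : ∀ i : ℕ, hits d α β χ (IsType.zElt K β i) ξ = hits d α β χ (IsType.zElt K β 0) ξ) :
    0 ≤ hitSum α β x χ ξ := by
  simp only [hitSum, h, ← Finset.mul_sum, h1, mul_one]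
  positivity

lemma hitSum_nonneg_of_charSnd_eq_one {x : Fin d → ℤ} (h1 : ∑ i, x i = 1) (hχ : charSnd χ = 1)
    (ξ : ℂ) : 0 ≤ hitSum α β x χ ξ := by
  refine hitSum_nonneg_of_const h1 fun i => ?_
  refine Nat.card_congr (Equiv.subtypeEquivRight fun σ => ?_)
  obtain ⟨u, v, _, h⟩ := mem_actGroup.1 σ.2
  rw [← h, scaleHom_apply, scaleHom_apply, char_apply, char_apply, hχ]
  rfl

/-- The element `(α ^ i, β ^ i)` of `H` takes `m_0` to a point with the second component of `m_i`,
and `χ` does not see the first. -/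
lemma hitSum_nonneg_of_charFst_eq_one {x : Fin d → ℤ} (h1 : ∑ i, x i = 1) (hχ : charFst χ = 1)
    (ξ : ℂ) : 0 ≤ hitSum α β x χ ξ := by
  refine hitSum_nonneg_of_const h1 fun i => ?_
  have h2 : scaleHom (α ^ (i : ℤ), β ^ (i : ℤ)) ∈ actGroup d α β :=
    mem_actGroup.2 ⟨i, i, by simp, rfl⟩
  rw [← hits_apply h2 (IsType.zElt K β 0)]
  refine Nat.card_congr (Equiv.subtypeEquivRight fun σ => ?_)
  obtain ⟨u, v, _, h⟩ := mem_actGroup.1 σ.2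
  rw [← h, scaleHom_apply, scaleHom_apply, scaleHom_apply, char_apply, char_apply, hχ]
  simp [IsType.zElt]

lemma exists_natCast_eq_of_pow_eq_one {F : Type*} [Field F] {p : ℕ} [CharP F p] (hp : p.Prime)
    {u : F} (hu : u ^ (p - 1) = 1) : ∃ n : ℕ, (n : F) = u := by
  classical
  have := Fact.mk hp
  have h0 : (p - 1) ≠ 0 := by have := hp.two_le; omega
  have hinj : Function.Injective (ZMod.castHom (dvd_refl p) F) := RingHom.injective _
  -- the `p - 1` non-zero elements of the prime field exhaust the roots of `X ^ (p - 1) - 1`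
  have h1 : (Finset.univ.image fun v : (ZMod p)ˣ => ZMod.castHom (dvd_refl p) F v) =
      Polynomial.nthRootsFinset (p - 1) (1 : F) := by
    refine Finset.eq_of_subset_of_card_le ?_ ?_
    · intro x hx
      obtain ⟨v, _, rfl⟩ := Finset.mem_image.1 hx
      rw [Polynomial.mem_nthRootsFinset (Nat.pos_of_ne_zero h0), ← map_pow,
        ZMod.pow_card_sub_one_eq_one v.ne_zero, map_one]
    · have hinj' : Function.Injective fun v : (ZMod p)ˣ => ZMod.castHom (dvd_refl p) F v :=
        hinj.comp Units.val_injective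
      rw [Finset.card_image_of_injective _ hinj', Finset.card_univ,
        ZMod.card_units_eq_totient, Nat.totient_prime hp]
      exact (Multiset.toFinset_card_le _).trans (Polynomial.card_nthRoots _ _)
  have h2 : u ∈ Polynomial.nthRootsFinset (p - 1) (1 : F) :=
    (Polynomial.mem_nthRootsFinset (Nat.pos_of_ne_zero h0) _).2 hu
  rw [← h1] at h2
  obtain ⟨v, _, rfl⟩ := Finset.mem_image.1 h2
  exact ⟨v.1.val, by simp⟩

namespace IsType

variable {p q : ℕ}

/-- As `(p + 1)(p - 1) = p ^ 2 - 1`, the powers of `α ^ (p + 1)` are the units of the prime field.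
-/
lemma exists_natCast_eq (T : IsType p q d α β) (j : ℤ) :
    ∃ n : ℕ, (n : K) = (α ^ ((p + 1 : ℤ) * j) : Kˣ) := by
  have := T.charP_K
  refine exists_natCast_eq_of_pow_eq_one T.prime_p ?_
  have h1 : α ^ (p ^ 2 - 1) = 1 := T.orderOf_α ▸ pow_orderOf_eq_one α
  have hp := T.prime_p.one_lt
  have h2 : ((p ^ 2 - 1 : ℕ) : ℤ) = (p + 1) * (p - 1 : ℕ) := by
    rw [Nat.cast_sub (by nlinarith), Nat.cast_sub hp.le]
    push_cast
    ring
  rw [← Units.val_pow_eq_pow_val, ← zpow_natCast, ← zpow_mul, Units.val_eq_one,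
    show (p + 1 : ℤ) * j * (p - 1 : ℕ) = ((p ^ 2 - 1 : ℕ) : ℤ) * j by rw [h2]; ring, zpow_mul,
    zpow_natCast, h1, one_zpow]

/-- A natural number that acts like suitable scalars on both components. -/
lemma exists_nat_scalar (T : IsType p q d α β) (i j : ℤ) :
    ∃ n : ℕ, (n : K) = (α ^ ((p + 1 : ℤ) * i) : Kˣ) ∧ (n : L) = (β ^ ((q + 1 : ℤ) * j) : Lˣ) ∧
      n.Coprime (p * q) := by
  have := T.charP_K
  have := T.charP_L
  obtain ⟨a, ha⟩ := T.exists_natCast_eq i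
  obtain ⟨b, hb⟩ := T.symm.exists_natCast_eq j
  obtain ⟨n, hn⟩ := Nat.chineseRemainder ((Nat.coprime_primes T.prime_p T.prime_q).2 T.ne) a b
  have h1 : (n : K) = (α ^ ((p + 1 : ℤ) * i) : Kˣ) := by
    rw [← ha, CharP.natCast_eq_natCast K p]
    exact hn.1
  have h2 : (n : L) = (β ^ ((q + 1 : ℤ) * j) : Lˣ) := by
    rw [← hb, CharP.natCast_eq_natCast L q]
    exact hn.2
  refine ⟨n, h1, h2, Nat.Coprime.mul_right ?_ ?_⟩
  · rw [Nat.coprime_comm, T.prime_p.coprime_iff_not_dvd, ← CharP.cast_eq_zero_iff K p, h1]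
    exact Units.ne_zero _
  · rw [Nat.coprime_comm, T.prime_q.coprime_iff_not_dvd, ← CharP.cast_eq_zero_iff L q, h2]
    exact Units.ne_zero _

lemma char_pow_eq_one (T : IsType p q d α β) (χ : Multiplicative (K × L) →* ℂ)
    (z : Multiplicative (K × L)) : χ z ^ (p * q) = 1 := by
  have := T.charP_K
  have := T.charP_L
  rw [← map_pow]
  convert χ.map_one
  refine Multiplicative.toAdd.injective (Prod.ext ?_ ?_)
  · simp
  · simp

/-- Up to the action of `H` and of Galois automorphisms there is only one character of `N` that is
non-trivial on both components. -/
lemma exists_char_eq_pow (T : IsType p q d α β) (hd : d.Coprime (Nat.gcd (p + 1) (q + 1)))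
    {χ₀ χ : Multiplicative (K × L) →* ℂ} (h1 : charFst χ₀ ≠ 1) (h2 : charSnd χ₀ ≠ 1)
    (h3 : charFst χ ≠ 1) (h4 : charSnd χ ≠ 1) :
    ∃ σ ∈ actGroup d α β, ∃ n : ℕ, n.Coprime (p * q) ∧ ∀ z, χ z = χ₀ (σ z) ^ n := by
  have := T.finite_K
  have := T.finite_L
  obtain ⟨u, hu⟩ := exists_mulShift_eq h1 h3
  obtain ⟨v, hv⟩ := exists_mulShift_eq h2 h4
  obtain ⟨a, ha⟩ := T.exists_zpow_α u.ne_zero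
  obtain ⟨b, hb⟩ := T.exists_zpow_β v.ne_zero
  -- `χ` arises from `χ₀` by the scalars `(α ^ a, β ^ b)`. A Galois automorphism can remove `(p + 1)
  -- i` from `a` and `(q + 1) j` from `b`; what remains must be congruent modulo `d` to belong to
  -- `H`. Coprimality and two applications of Bézout make this possible.
  obtain ⟨i, j, k, hijk⟩ : ∃ i j k : ℤ, (p + 1) * i - (q + 1) * j + d * k = a - b := by
    have e1 := Nat.gcd_eq_gcd_ab (p + 1) (q + 1)
    have e2 := Nat.gcd_eq_gcd_ab d (Nat.gcd (p + 1) (q + 1))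
    rw [hd.gcd_eq_one] at e2
    set s := (p + 1).gcdA (q + 1)
    set t := (p + 1).gcdB (q + 1)
    set m := d.gcdA ((p + 1).gcd (q + 1))
    set l := d.gcdB ((p + 1).gcd (q + 1))
    push_cast at e1 e2
    refine ⟨s * l * (a - b), -t * l * (a - b), m * (a - b), ?_⟩
    rw [e1] at e2
    linear_combination -(a - b) * e2
  obtain ⟨n, hn1, hn2, hn⟩ := T.exists_nat_scalar i j
  refine ⟨_, mem_actGroup.2 ⟨a - (p + 1) * i, b - (q + 1) * j, ⟨k, by linarith⟩, rfl⟩, n, hn,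
    fun z => ?_⟩
  rw [← map_pow]
  induction z using Multiplicative.rec with | _ z => ?_
  obtain ⟨x, y⟩ := z
  rw [scaleHom_apply, ← ofAdd_nsmul, Prod.smul_mk, char_apply, char_apply, hu, hv, nsmul_eq_mul,
    nsmul_eq_mul, hn1, hn2, ← mul_assoc, ← mul_assoc, ← Units.val_mul, ← Units.val_mul, ← zpow_add,
    ← zpow_add, add_sub_cancel, add_sub_cancel, ha, hb]
  rfl

lemma hitSum_nonneg_of_forall (T : IsType p q d α β) (hd : d.Coprime (Nat.gcd (p + 1) (q + 1)))
    {χ₀ : Multiplicative (K × L) →* ℂ} (h1 : charFst χ₀ ≠ 1) (h2 : charSnd χ₀ ≠ 1)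
    {x : Fin d → ℤ} (hx : ∑ i, x i = 1) (h : ∀ ξ : ℂ, ξ ^ (p * q) = 1 → 0 ≤ hitSum α β x χ₀ ξ)
    (χ : Multiplicative (K × L) →* ℂ) (ξ : ℂ) : 0 ≤ hitSum α β x χ ξ := by
  by_cases h3 : charFst χ = 1
  · exact hitSum_nonneg_of_charFst_eq_one hx h3 ξ
  by_cases h4 : charSnd χ = 1
  · exact hitSum_nonneg_of_charSnd_eq_one hx h4 ξ
  obtain ⟨σ, hσ, n, hn, hχ⟩ := T.exists_char_eq_pow hd h1 h2 h3 h4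
  by_cases hξ : ξ ^ (p * q) = 1
  · have hpq : 1 < p * q := one_lt_mul'' T.prime_p.one_lt T.prime_q.one_lt
    -- Since `n m ≡ 1` modulo `pq`, the `m`-th power inverts the Galois twist: hits of `χ` at `ξ`
    -- are hits of a conjugate of `χ₀` at `ξ ^ m`.
    obtain ⟨m, hm⟩ := Nat.exists_mul_mod_eq_one_of_coprime hn hpq
    have key : ∀ {w : ℂ}, w ^ (p * q) = 1 → w ^ (n * m) = w := by
      intro w hw
      rw [pow_eq_pow_mod _ hw, hm.2, pow_one]
    have h5 : hitSum α β x χ ξ = hitSum α β x χ₀ (ξ ^ m) := by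
      refine Finset.sum_congr rfl fun i _ => ?_
      rw [← hits_comp (χ := χ₀) hσ]
      congr 2
      refine Nat.card_congr (Equiv.subtypeEquivRight fun τ => ?_)
      change _ ↔ χ₀ (σ _) = _
      rw [hχ]
      constructor
      · intro e
        rw [← e, ← pow_mul, key (T.char_pow_eq_one _ _)]
      · intro e
        rw [e, ← pow_mul, mul_comm, key hξ]
    rw [h5]
    exact h _ (by rw [← pow_mul, mul_comm, pow_mul, hξ, one_pow])
  · refine Finset.sum_nonneg fun i _ => ?_
    have : hits d α β χ (zElt K β i) ξ = 0 := by
      have : IsEmpty {τ : actGroup d α β // χ (τ.1 (zElt K β i)) = ξ} :=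
        ⟨fun τ => hξ (τ.2 ▸ T.char_pow_eq_one χ _)⟩
      exact Nat.card_of_isEmpty
    simp [this]

/-! ### The character `ψ_0` -/

/-- A unit of the prime field has order at most `p - 1`, less than `p ^ 2 - 1`. -/
lemma intCast_ne_gen (T : IsType p q d α β) (k : ℤ) : (k : K) ≠ α := by
  intro h
  have := T.charP_K
  have := Fact.mk T.prime_p
  have h1 : (α : K) ^ p = α := by
    rw [← h]
    exact map_intCast (frobenius K p) k
  have h2 : α ^ (p - 1) = 1 := by
    refine mul_right_cancel (b := α) ?_
    rw [← pow_succ, Nat.sub_add_cancel T.prime_p.one_le, one_mul]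
    exact Units.ext (by simpa using h1)
  have h3 := Nat.le_of_dvd (Nat.sub_pos_of_lt T.prime_p.one_lt) (orderOf_dvd_of_pow_eq_one h2)
  rw [T.orderOf_α] at h3
  have := T.prime_p.one_lt
  have : p < p ^ 2 := by nlinarith
  omega

/-- Otherwise `(α, 0)` would be a multiple of `(1, 1)`, putting `α` into the prime field. -/
lemma charFst_ne_one (T : IsType p q d α β) {ζp ζq : ℂ} {ψ : Multiplicative (K × L) →* ℂˣ}
    (hψ : IsPsiZero α β ζp ζq ψ) : charFst ((Units.coeHom ℂ).comp ψ) ≠ 1 := by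
  intro h
  have h1 : Multiplicative.ofAdd ((α : K), (0 : L)) ∈ ψ.ker := by
    rw [MonoidHom.mem_ker]
    exact Units.ext (DFunLike.congr_fun h (α : K))
  rw [hψ.1] at h1
  obtain ⟨k, hk⟩ := h1
  have h2 := congrArg (fun z => (Multiplicative.toAdd z).1) hk
  simp at h2
  exact T.intCast_ne_gen k h2

lemma charSnd_ne_one (T : IsType p q d α β) {ζp ζq : ℂ} {ψ : Multiplicative (K × L) →* ℂˣ}
    (hψ : IsPsiZero α β ζp ζq ψ) : charSnd ((Units.coeHom ℂ).comp ψ) ≠ 1 := by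
  intro h
  have h1 : Multiplicative.ofAdd ((0 : K), (β : L)) ∈ ψ.ker := by
    rw [MonoidHom.mem_ker]
    exact Units.ext (DFunLike.congr_fun h (β : L))
  rw [hψ.1] at h1
  obtain ⟨k, hk⟩ := h1
  have h2 := congrArg (fun z => (Multiplicative.toAdd z).2) hk
  simp at h2
  exact T.symm.intCast_ne_gen k h2

/-- A character of the additive group of `K` whose kernel is the prime field. -/
lemma exists_addChar (T : IsType p q d α β) {ζ : ℂ} (hζ : IsPrimitiveRoot ζ p) :
    ∃ φ : AddChar K ℂ, φ α = ζ ∧ (∀ x, φ x = 1 ↔ ∃ n : ℕ, x = n) ∧ ∀ x, φ x ^ p = 1 := by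
  have := T.charP_K
  have := T.finite_K
  have := Fact.mk T.prime_p
  let _ : Algebra (ZMod p) K := ZMod.algebra K p
  have hcast : ∀ a : ZMod p, algebraMap (ZMod p) K a = (a.val : K) := fun a => by
    conv_lhs => rw [← ZMod.natCast_zmod_val a]
    exact map_natCast _ _
  -- `1` and `α` form a basis over the prime field; the character is `ζ` to the power of the
  -- coordinate at `α`.
  have hli : LinearIndependent (ZMod p) ![(1 : K), (α : K)] := by
    rw [LinearIndependent.pair_iff' one_ne_zero]
    intro a ha
    refine T.intCast_ne_gen (a.val : ℤ) ?_
    rw [← ha, Algebra.smul_def, mul_one, hcast, Int.cast_natCast]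
  have hfr : Module.finrank (ZMod p) K = 2 := by
    have h1 := Module.natCard_eq_pow_finrank (K := ZMod p) (V := K)
    rw [T.card_K, Nat.card_zmod] at h1
    exact (Nat.pow_right_injective T.prime_p.two_le h1).symm
  let b := basisOfLinearIndependentOfCardEqFinrank hli (by simp [hfr])
  have hb0 : b 0 = 1 := by simp [b]
  have hb1 : b 1 = α := by simp [b]
  refine ⟨(AddChar.zmodChar p hζ.pow_eq_one).compAddMonoidHom (b.coord 1).toAddMonoidHom,
    ?_, ?_, ?_⟩
  · change AddChar.zmodChar p hζ.pow_eq_one (b.coord 1 α) = ζ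
    rw [← hb1]
    have := Fact.mk T.prime_p.one_lt
    simp [AddChar.zmodChar_apply, ZMod.val_one]
  · intro x
    change AddChar.zmodChar p hζ.pow_eq_one (b.coord 1 x) = 1 ↔ _
    have h2 := b.sum_repr x
    rw [Fin.sum_univ_two, hb0, hb1] at h2
    rw [AddChar.zmodChar_apply, hζ.pow_eq_one_iff_dvd]
    constructor
    · intro h
      have h3 : b.repr x 1 = 0 := by
        have h4 : (b.coord 1 x).val = 0 := Nat.eq_zero_of_dvd_of_lt h (ZMod.val_lt _)
        exact (ZMod.val_eq_zero _).1 h4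
      refine ⟨(b.repr x 0).val, ?_⟩
      rw [h3, zero_smul, add_zero, Algebra.smul_def, mul_one, hcast] at h2
      exact h2.symm
    · rintro ⟨n, rfl⟩
      have h4 : (n : K) = n • b 0 := by rw [hb0]; simp
      rw [h4, map_nsmul]
      simp
  · intro x
    change AddChar.zmodChar p hζ.pow_eq_one (b.coord 1 x) ^ p = 1
    rw [AddChar.zmodChar_apply, ← pow_mul, mul_comm, pow_mul, hζ.pow_eq_one, one_pow]

/-- Take the product of characters of `K` and `L` whose kernels are the prime fields. Their values
have coprime orders, so the product is `1` only if both factors are, and by the Chinese remainder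
theorem the product of the prime fields is generated by `(1, 1)`. -/
lemma exists_isPsiZero (T : IsType p q d α β) {ζp ζq : ℂ} (hp : IsPrimitiveRoot ζp p)
    (hq : IsPrimitiveRoot ζq q) : ∃ ψ, IsPsiZero α β ζp ζq ψ := by
  have := T.charP_K
  have := T.charP_L
  obtain ⟨φ, hφ, hφk, hφp⟩ := T.exists_addChar hp
  obtain ⟨φ', hφ', hφk', hφp'⟩ := T.symm.exists_addChar hq
  let χ : Multiplicative (K × L) →* ℂ :=
    { toFun := fun z => φ z.toAdd.1 * φ' z.toAdd.2
      map_one' := by simp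
      map_mul' := fun z w => by
        rw [toAdd_mul, Prod.fst_add, Prod.snd_add, AddChar.map_add_eq_mul, AddChar.map_add_eq_mul]
        ring }
  refine ⟨χ.toHomUnits, ?_, ?_⟩
  · have hpq := (Nat.coprime_primes T.prime_p T.prime_q).2 T.ne
    ext z
    rw [MonoidHom.mem_ker, Units.ext_iff]
    change φ z.toAdd.1 * φ' z.toAdd.2 = 1 ↔ _
    constructor
    · intro h
      have h1 : φ z.toAdd.1 = 1 := by
        have h2 := congrArg (· ^ q) h
        simp only [mul_pow, hφp', mul_one, one_pow] at h2
        have := pow_gcd_eq_one.2 ⟨hφp z.toAdd.1, h2⟩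
        rwa [hpq.gcd_eq_one, pow_one] at this
      rw [h1, one_mul] at h
      obtain ⟨a, ha⟩ := (hφk _).1 h1
      obtain ⟨b, hb⟩ := (hφk' _).1 h
      obtain ⟨n, hn⟩ := Nat.chineseRemainder hpq a b
      refine ⟨n, ?_⟩
      refine Multiplicative.toAdd.injective (Prod.ext ?_ ?_)
      · rw [ha]
        simpa using (CharP.natCast_eq_natCast K p).2 hn.1
      · rw [hb]
        simpa using (CharP.natCast_eq_natCast L q).2 hn.2
    · rintro ⟨k, rfl⟩
      have h1 : φ 1 = 1 := (hφk 1).2 ⟨1, by simp⟩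
      have h2 : φ' 1 = 1 := (hφk' 1).2 ⟨1, by simp⟩
      have h3 := φ.map_zsmul_eq_zpow k 1
      have h4 := φ'.map_zsmul_eq_zpow k 1
      rw [zsmul_one, h1, one_zpow] at h3
      rw [zsmul_one, h2, one_zpow] at h4
      simp [h3, h4]
  · change φ α * φ' β = _
    rw [hφ, hφ']

/-- The equivalence of the HeLP restrictions with the inequalities for `χ_0` alone. -/
theorem heLPVector_iff (T : IsType p q d α β) (hd : d.Coprime (Nat.gcd (p + 1) (q + 1)))
    {ζp ζq : ℂ} {ψ : Multiplicative (K × L) →* ℂˣ} (hψ : IsPsiZero α β ζp ζq ψ)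
    (x : Fin d → ℤ) :
    (HeLPVector d α β (p * q) x ↔ ∀ (r : ℕ) (ρ : Representation ℂ (Gd d α β) (Fin r → ℂ)),
        CharIneq d α β (p * q) x ρ) ∧
    (HeLPVector d α β (p * q) x ↔ CharIneq d α β (p * q) x (chiRep d α β ψ)) := by
  have h1 : HeLPVector d α β (p * q) x → ∀ (r : ℕ) (ρ : Representation ℂ (Gd d α β) (Fin r → ℂ)),
      CharIneq d α β (p * q) x ρ := fun h r ρ => T.charIneq_of_heLPVector h ρ
  have h2 : (∀ (r : ℕ) (ρ : Representation ℂ (Gd d α β) (Fin r → ℂ)),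
      CharIneq d α β (p * q) x ρ) → CharIneq d α β (p * q) x (chiRep d α β ψ) := by
    intro h
    have := T.finite_actGroup
    have := finiteDimensional_chiSpace (d := d) (α := α) (β := β) ψ
    obtain ⟨ρ, hρ⟩ := exists_mult_eq (chiRep d α β ψ)
    have h3 := h _ ρ
    simpa only [CharIneq, hρ] using h3
  have h3 : CharIneq d α β (p * q) x (chiRep d α β ψ) → HeLPVector d α β (p * q) x := by
    rintro ⟨hx, h⟩
    refine T.heLPVector_of_hitSum_nonneg hx
      (T.hitSum_nonneg_of_forall hd (T.charFst_ne_one hψ) (T.charSnd_ne_one hψ) hx fun ξ hξ => ?_)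
    have h4 := h ξ hξ
    simpa only [hitSum, mElt_eq, T.mult_chiRep ψ] using h4
  exact ⟨⟨h1, fun h => h3 (h2 h)⟩, ⟨fun h => h2 (h1 h), h3⟩⟩

end IsType

end Characters

/-! ### Reduction to the second component -/

section ClassHits

variable {K L : Type*} [Field K] [Field L] {d : ℕ} {α : Kˣ} {β : Lˣ}

/-- The number of elements of `L` in the class `β ^ c ⟨β ^ d⟩` at which `φ` takes the value `η`. -/
def clsHits (d : ℕ) (β : Lˣ) (φ : AddChar L ℂ) (c : ℤ) (η : ℂ) : ℕ :=
  Nat.card {t : L // (∃ w : ℤ, ((β ^ w : Lˣ) : L) = t ∧ (d : ℤ) ∣ w - c) ∧ φ t = η}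

lemma addChar_ne_zero {F : Type*} [Field F] (φ : AddChar F ℂ) (x : F) : φ x ≠ 0 := by
  intro h
  have h1 := φ.map_add_eq_mul x (-x)
  rw [h, zero_mul, add_neg_cancel, AddChar.map_zero_eq_one] at h1
  exact one_ne_zero h1

namespace IsType

variable {p q : ℕ}

/-- Once the first component of the image of `m_i` is fixed as `α ^ u`, an element of `H` is
determined by the second one, which runs over the class `β ^ (u + i) ⟨β ^ d⟩`. -/
lemma card_fiber_eq_clsHits (T : IsType p q d α β) (χ : Multiplicative (K × L) →* ℂ) (u : ℤ) (i : ℕ) (ξ : ℂ) :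
    Nat.card {σ : actGroup d α β // χ (σ.1 (zElt K β i)) = ξ ∧
      (σ.1 (zElt K β i)).toAdd.1 = ((α ^ u : Kˣ) : K)} =
    clsHits d β (charSnd χ) (u + i) (ξ / charFst χ ((α ^ u : Kˣ) : K)) := by
  have key : ∀ (x : K) (y : L), χ (Multiplicative.ofAdd (x, y)) = ξ ↔
      charSnd χ y = ξ / charFst χ x := by
    intro x y
    rw [char_apply, eq_div_iff (addChar_ne_zero _ _), mul_comm]
  refine Nat.card_congr (Equiv.ofBijective (fun σ => ⟨(σ.1.1 (zElt K β i)).toAdd.2, ?_, ?_⟩)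
    ⟨?_, ?_⟩)
  · obtain ⟨a, b, hab, h⟩ := mem_actGroup.1 σ.1.2
    have h2 := σ.2.2
    rw [← h, scaleHom_apply] at h2 ⊢
    simp only [zElt, toAdd_ofAdd, mul_one] at h2 ⊢
    have hd : (d : ℤ) ∣ a - u := T.dvd_of_zpow_α_eq_one (by
      rw [zpow_sub, mul_inv_eq_one]
      exact Units.ext h2)
    refine ⟨b + i, by simp [zpow_add₀], ?_⟩
    have := dvd_sub hd hab
    rwa [show a - u - (a - b) = b + i - (u + i) by ring] at this
  · have h1 := (key (σ.1.1 (zElt K β i)).toAdd.1 (σ.1.1 (zElt K β i)).toAdd.2).1 σ.2.1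
    rwa [σ.2.2] at h1
  · rintro ⟨σ, hσ, hσ'⟩ ⟨τ, hτ, hτ'⟩ h
    have h1 : (σ.1 (zElt K β i)).toAdd.2 = (τ.1 (zElt K β i)).toAdd.2 := congrArg Subtype.val h
    refine Subtype.ext (Subtype.ext ?_)
    obtain ⟨a, b, _, h2⟩ := mem_actGroup.1 σ.2
    obtain ⟨a', b', _, h3⟩ := mem_actGroup.1 τ.2
    have h4 := hσ'.trans hτ'.symm
    change σ.1 = τ.1
    rw [← h2, ← h3] at h1 h4 ⊢
    rw [scaleHom_apply, scaleHom_apply] at h1 h4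
    simp only [zElt, toAdd_ofAdd, mul_one] at h1 h4
    rw [Units.ext h4, Units.ext (mul_right_cancel₀ (pow_ne_zero i β.ne_zero) h1)]
  · rintro ⟨t, ⟨w, rfl, hw⟩, ht⟩
    refine ⟨⟨⟨_, mem_actGroup.2 ⟨u, w - i, ?_, rfl⟩⟩, ?_, ?_⟩, ?_⟩
    · rw [show u - (w - i) = -(w - (u + i)) by ring]
      exact hw.neg_right
    · rw [scaleHom_apply, key]
      simp only [zElt, toAdd_ofAdd, mul_one]
      rw [← ht, ← zpow_natCast, ← Units.val_zpow_eq_zpow_val, ← Units.val_mul, ← zpow_add,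
        sub_add_cancel]
    · simp [scaleHom_apply, zElt]
    · refine Subtype.ext ?_
      change (Multiplicative.toAdd (scaleHom (α ^ u, β ^ (w - i)) (zElt K β i))).2 = _
      rw [scaleHom_apply]
      simp only [zElt, toAdd_ofAdd]
      rw [← zpow_natCast, ← Units.val_zpow_eq_zpow_val, ← Units.val_mul, ← zpow_add,
        sub_add_cancel]

/-- It suffices to consider the second component. -/
lemma hitSum_nonneg_of_clsHits (T : IsType p q d α β) {x : Fin d → ℤ}
    {χ : Multiplicative (K × L) →* ℂ}
    (h : ∀ c η, 0 ≤ ∑ i : Fin d, (clsHits d β (charSnd χ) (c + (i : ℕ)) η : ℤ) * x i) (ξ : ℂ) :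
    0 ≤ hitSum α β x χ ξ := by
  classical
  have := T.finite_K
  have := Fintype.ofFinite K
  have := T.finite_actGroup
  have := Fintype.ofFinite (actGroup d α β)
  -- The hits are sorted by the first component `s` of the image; `s = 0` does not occur.
  have h1 : ∀ i : ℕ, (hits d α β χ (zElt K β i) ξ : ℤ) = ∑ s : K,
      (Nat.card {σ : actGroup d α β // χ (σ.1 (zElt K β i)) = ξ ∧
        (σ.1 (zElt K β i)).toAdd.1 = s} : ℤ) := by
    intro i
    rw [← Nat.cast_sum, hits, Nat.card_eq_fintype_card, Fintype.card_subtype,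
      Finset.card_eq_sum_card_fiberwise (t := Finset.univ)
        (f := fun σ : actGroup d α β => (σ.1 (zElt K β i)).toAdd.1) (by simp)]
    congr 1
    refine Finset.sum_congr rfl fun s _ => ?_
    rw [Nat.card_eq_fintype_card, Fintype.card_subtype, Finset.filter_filter]
  simp only [hitSum, h1, Finset.sum_mul]
  rw [Finset.sum_comm]
  refine Finset.sum_nonneg fun s _ => ?_
  by_cases hs : s = 0
  · refine (Finset.sum_eq_zero fun i _ => ?_).ge
    have : IsEmpty {σ : actGroup d α β // χ (σ.1 (zElt K β i)) = ξ ∧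
        (σ.1 (zElt K β i)).toAdd.1 = s} := by
      refine ⟨fun σ => ?_⟩
      obtain ⟨a, b, _, h2⟩ := mem_actGroup.1 σ.1.2
      have h3 := σ.2.2
      rw [← h2, hs, scaleHom_apply] at h3
      simp only [zElt, toAdd_ofAdd, mul_one] at h3
      exact Units.ne_zero _ h3
    rw [Nat.card_of_isEmpty]
    simp
  · obtain ⟨u, rfl⟩ := T.exists_zpow_α hs
    simp only [T.card_fiber_eq_clsHits]
    exact h _ _

end IsType

end ClassHits

/-! ### Cosets of cubes on lines over the field with seven elements -/

section FieldWith49Elements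

/-- The number of points of a line over `ZMod 7` at which the squared norm is `w`. -/
def lineCount (A B h w : ZMod 7) : ℕ :=
  (Finset.univ.filter fun z : ZMod 7 × ZMod 7 =>
    (z.1 ^ 2 + z.2 ^ 2) ^ 2 = w ∧ A * z.1 + B * z.2 = h).card

/-- A finite check over all lines. The factor `2` is what allows the coefficients `2` and `-1`. -/
lemma lineCount_two_mul_le : ∀ A B h : ZMod 7, A ≠ 0 ∨ B ≠ 0 → ∀ w : ZMod 7, w ^ 3 = 1 →
    lineCount A B h (2 * w) ≤ 2 * lineCount A B h w := by
  decide +kernel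

lemma zmod_seven_sq_add_sq : ∀ a b : ZMod 7, a ^ 2 + b ^ 2 = 0 → a = 0 ∧ b = 0 := by decide

lemma zmod_seven_cube_eq_one : ∀ a : ZMod 7, a ^ 3 = 1 → a ≠ 1 → a = 2 ∨ a = 4 := by decide

instance fact_prime_seven : Fact (Nat.Prime 7) := ⟨by norm_num⟩

variable {L : Type*} [Field L] {β : Lˣ}

/-- A field with `49` elements is the Gaussian extension of the field with `7` elements. -/
lemma exists_gauss (hL : Nat.card L = 7 ^ 2) (hβ : Subgroup.zpowers β = ⊤) :
    ∃ (f : ZMod 7 →+* L) (I : L), (∀ z : ZMod 7 × ZMod 7,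
      (f z.1 + f z.2 * I) ^ 16 = f ((z.1 ^ 2 + z.2 ^ 2) ^ 2)) ∧
      Function.Bijective fun z : ZMod 7 × ZMod 7 => f z.1 + f z.2 * I := by
  have hfin : Finite L := Nat.finite_of_card_ne_zero (by rw [hL]; norm_num)
  have := Fintype.ofFinite L
  have hch : CharP L 7 :=
    charP_of_card_eq_prime_pow (f := 2) (by rw [Fintype.card_eq_nat_card, hL])
  have hord : orderOf β = 48 := by
    rw [orderOf_eq_card_of_zpowers_eq_top hβ, Nat.card_units, hL]
    norm_num
  let f : ZMod 7 →+* L := ZMod.castHom (dvd_refl 7) L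
  -- `β` has order `48`, so `β ^ 12` has order `4` and is a square root of `-1`.
  let I : L := (β : L) ^ 12
  have hI : I ^ 2 = -1 := by
    have h1 : (β : L) ^ 48 = 1 := by
      rw [← Units.val_pow_eq_pow_val, ← hord, pow_orderOf_eq_one, Units.val_one]
    have h2 : (β : L) ^ 24 ≠ 1 := by
      intro h
      have h3 : β ^ 24 = 1 := Units.ext (by simpa using h)
      have := orderOf_dvd_of_pow_eq_one h3
      rw [hord] at this
      norm_num at this
    have h3 : ((β : L) ^ 24 - 1) * ((β : L) ^ 24 + 1) = 0 := by linear_combination h1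
    rcases mul_eq_zero.1 h3 with h | h
    · exact (h2 (sub_eq_zero.1 h)).elim
    · simp only [I, ← pow_mul]
      linear_combination h
  have hnorm : ∀ z : ZMod 7 × ZMod 7, (f z.1 + f z.2 * I) * (f z.1 - f z.2 * I) =
      f (z.1 ^ 2 + z.2 ^ 2) := by
    intro z
    simp only [map_add, map_pow]
    linear_combination -(f z.2) ^ 2 * hI
  -- Frobenius is conjugation, as `I ^ 7 = -I`. Hence `t ^ 8` is the norm of `t` and `t ^ 16` its
  -- square.
  have hfrob : ∀ z : ZMod 7 × ZMod 7, (f z.1 + f z.2 * I) ^ 7 = f z.1 - f z.2 * I := by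
    intro z
    rw [add_pow_char, mul_pow, ← map_pow, ← map_pow, ZMod.pow_card, ZMod.pow_card]
    linear_combination f z.2 * I * (I ^ 4 - I ^ 2 + 1) * hI
  refine ⟨f, I, fun z => ?_, ?_⟩
  · have h1 : (f z.1 + f z.2 * I) ^ 8 = f (z.1 ^ 2 + z.2 ^ 2) := by
      rw [pow_succ, hfrob, mul_comm, hnorm]
    rw [show 16 = 8 * 2 by norm_num, pow_mul, h1, map_pow]
  · rw [Fintype.bijective_iff_injective_and_card]
    constructor
    · intro z w hzw
      have h1 : f (z.1 - w.1) + f (z.2 - w.2) * I = 0 := by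
        simp only [map_sub]
        linear_combination hzw
      have h2 := hnorm (z.1 - w.1, z.2 - w.2)
      simp only [h1, zero_mul] at h2
      have h3 : (z.1 - w.1) ^ 2 + (z.2 - w.2) ^ 2 = 0 := f.injective (by rw [← h2, map_zero])
      obtain ⟨h5, h6⟩ := zmod_seven_sq_add_sq _ _ h3
      exact Prod.ext (sub_eq_zero.1 h5) (sub_eq_zero.1 h6)
    · rw [Fintype.card_prod, ZMod.card, Fintype.card_eq_nat_card, hL]
      norm_num

/-- The numbers of hits in the three classes are numbers of points on a line. -/
lemma exists_clsHits_eq_lineCount (hL : Nat.card L = 7 ^ 2) (hβ : Subgroup.zpowers β = ⊤) :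
    ∃ (w : ZMod 7), (w = 2 ∨ w = 4) ∧ (∀ f : ZMod 7 →+* L, f w = (β : L) ^ 16) ∧
      ∀ (φ : AddChar L ℂ), φ ≠ 1 → ∀ η, (∀ c, clsHits 3 β φ c η = 0) ∨
        ∃ A B h : ZMod 7, (A ≠ 0 ∨ B ≠ 0) ∧ ∀ c, clsHits 3 β φ c η = lineCount A B h (w ^ c) := by
  have hfin : Finite L := Nat.finite_of_card_ne_zero (by rw [hL]; norm_num)
  have := Fintype.ofFinite L
  have hord : orderOf β = 48 := by
    rw [orderOf_eq_card_of_zpowers_eq_top hβ, Nat.card_units, hL]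
    norm_num
  obtain ⟨f, I, h16, hbij⟩ := exists_gauss hL hβ
  have h48 : (β : L) ^ 48 = 1 := by
    rw [← Units.val_pow_eq_pow_val, ← hord, pow_orderOf_eq_one, Units.val_one]
  obtain ⟨z, hz⟩ := hbij.2 (β : L)
  set w := (z.1 ^ 2 + z.2 ^ 2) ^ 2 with hw
  have hwβ : f w = (β : L) ^ 16 := by rw [← h16, ← hz]
  -- `w` corresponds to `β ^ 16`, a cube root of unity other than `1`.
  have hw24 : w = 2 ∨ w = 4 := by
    have h1 : w ^ 3 = 1 := f.injective (by
      rw [map_pow, hwβ, ← pow_mul, map_one, h48])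
    have h2 : w ≠ 1 := by
      intro h
      rw [h, map_one] at hwβ
      have h3 : β ^ 16 = 1 := Units.ext (by simpa using hwβ.symm)
      have := orderOf_dvd_of_pow_eq_one h3
      rw [hord] at this
      norm_num at this
    exact zmod_seven_cube_eq_one w h1 h2
  refine ⟨w, hw24, fun g => by rw [Subsingleton.elim g f, hwβ], fun φ hφ η => ?_⟩
  -- the class of an element is determined by its power with exponent `16`
  have hcls : ∀ (t : L) (c : ℤ), (∃ v : ℤ, ((β ^ v : Lˣ) : L) = t ∧ (3 : ℤ) ∣ v - c) ↔
      t ^ 16 = f (w ^ c) := by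
    intro t c
    have h1 : f (w ^ c) = ((β ^ (16 * c) : Lˣ) : L) := by
      rw [map_zpow₀, hwβ, zpow_mul, Units.val_zpow_eq_zpow_val]
      norm_cast
    rw [h1]
    constructor
    · rintro ⟨v, rfl, hv⟩
      rw [← Units.val_pow_eq_pow_val, Units.val_inj, ← zpow_natCast, ← zpow_mul,
        zpow_eq_zpow_iff_modEq, hord, Int.modEq_iff_dvd]
      push_cast
      omega
    · intro h
      have ht : t ≠ 0 := by
        rintro rfl
        rw [zero_pow (by norm_num)] at h
        exact Units.ne_zero _ h.symm
      have : Units.mk0 t ht ∈ Subgroup.zpowers β := hβ ▸ Subgroup.mem_top _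
      obtain ⟨v, hv⟩ := this
      have hv' : ((β ^ v : Lˣ) : L) = t := congrArg Units.val hv
      refine ⟨v, hv', ?_⟩
      rw [← hv', ← Units.val_pow_eq_pow_val, Units.val_inj, ← zpow_natCast, ← zpow_mul,
        zpow_eq_zpow_iff_modEq, hord, Int.modEq_iff_dvd] at h
      push_cast at h
      omega
  have hch : CharP L 7 :=
    charP_of_card_eq_prime_pow (f := 2) (by rw [Fintype.card_eq_nat_card, hL])
  have hζ := Complex.isPrimitiveRoot_exp 7 (by norm_num)
  set ζ := Complex.exp (2 * Real.pi * Complex.I / (7 : ℕ)) with hζdef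
  have hroot : ∀ y : L, ∃ a : ℕ, ζ ^ a = φ y := by
    intro y
    have : φ y ^ 7 = 1 := by
      rw [← AddChar.map_nsmul_eq_pow, nsmul_eq_mul, CharP.cast_eq_zero, zero_mul,
        AddChar.map_zero_eq_one]
    obtain ⟨a, _, ha⟩ := hζ.eq_pow_of_pow_eq_one this
    exact ⟨a, ha⟩
  obtain ⟨A, hA⟩ := hroot 1
  obtain ⟨B, hB⟩ := hroot I
  -- Writing the values of `φ` at `1` and `I` as powers of `ζ` turns `φ t = ζ ^ h` into the equation
  -- of a line.
  have hφz : ∀ z : ZMod 7 × ZMod 7, φ (f z.1 + f z.2 * I) = ζ ^ (A * z.1.val + B * z.2.val) := by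
    intro z
    have h1 : ∀ a : ZMod 7, f a = a.val := fun a => by
      conv_lhs => rw [← ZMod.natCast_zmod_val a]
      exact map_natCast f _
    rw [h1, h1, AddChar.map_add_eq_mul, pow_add, pow_mul, pow_mul, hA, hB,
      ← AddChar.map_nsmul_eq_pow, ← AddChar.map_nsmul_eq_pow, nsmul_eq_mul, nsmul_eq_mul, mul_one]
  by_cases hη : ∃ h : ℕ, ζ ^ h = η
  · right
    obtain ⟨h, rfl⟩ := hη
    have hlin : ∀ z : ZMod 7 × ZMod 7, φ (f z.1 + f z.2 * I) = ζ ^ h ↔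
        (A : ZMod 7) * z.1 + B * z.2 = h := by
      intro z
      rw [hφz, (isOfFinOrder_iff_pow_eq_one.2 ⟨7, by norm_num, hζ.pow_eq_one⟩).pow_eq_pow_iff_modEq,
        ← hζ.eq_orderOf, ← ZMod.natCast_eq_natCast_iff]
      push_cast
      rw [ZMod.natCast_zmod_val, ZMod.natCast_zmod_val]
    refine ⟨A, B, h, ?_, fun c => ?_⟩
    · by_contra! hAB
      apply hφ
      ext y
      obtain ⟨z, rfl⟩ := hbij.2 y
      have h1 := (ZMod.natCast_eq_zero_iff _ _).1 hAB.1
      have h2 := (ZMod.natCast_eq_zero_iff _ _).1 hAB.2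
      change φ (f z.1 + f z.2 * I) = 1
      rw [hφz, hζ.pow_eq_one_iff_dvd]
      exact dvd_add (h1.mul_right _) (h2.mul_right _)
    · rw [clsHits, lineCount, ← Fintype.card_subtype, ← Nat.card_eq_fintype_card]
      refine (Nat.card_congr ((Equiv.ofBijective _ hbij).subtypeEquiv fun z => ?_)).symm
      rw [Equiv.ofBijective_apply, hlin]
      refine and_congr ?_ Iff.rfl
      have := hcls (f z.1 + f z.2 * I) c
      rw [h16, f.injective.eq_iff] at this
      exact this.symm
  · left
    intro c
    have : IsEmpty {t : L // (∃ v : ℤ, ((β ^ v : Lˣ) : L) = t ∧ ((3 : ℕ) : ℤ) ∣ v - c) ∧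
        φ t = η} := ⟨fun t => hη ((hroot t.1).imp fun a ha => ha.trans t.2.2)⟩
    exact Nat.card_of_isEmpty

end FieldWith49Elements

/-! ### HeLP for the groups of type `G_3(5, 7)` -/

section TypeFiveSeven

variable {K L : Type*} [Field K] [Field L] {α : Kˣ} {β : Lˣ}

namespace IsType

lemma heLPVector_of_lineCount (T : IsType 5 7 3 α β) {w : ZMod 7} (hw : w ^ 3 = 1)
    (h : ∀ (φ : AddChar L ℂ), φ ≠ 1 → ∀ η, (∀ c, clsHits 3 β φ c η = 0) ∨
      ∃ A B h : ZMod 7, (A ≠ 0 ∨ B ≠ 0) ∧ ∀ c, clsHits 3 β φ c η = lineCount A B h (w ^ c))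
    {x : Fin 3 → ℤ} (hx : ∑ i, x i = 1)
    (h' : ∀ A B h v : ZMod 7, A ≠ 0 ∨ B ≠ 0 → v ^ 3 = 1 →
      0 ≤ ∑ i : Fin 3, (lineCount A B h (v * w ^ (i : ℕ)) : ℤ) * x i) :
    HeLPVector 3 α β 35 x := by
  have hw0 : w ≠ 0 := by
    rintro rfl
    rw [zero_pow three_ne_zero] at hw
    exact zero_ne_one hw
  refine T.heLPVector_of_hitSum_nonneg hx fun χ ξ => ?_
  by_cases hχ : charSnd χ = 1
  · exact hitSum_nonneg_of_charSnd_eq_one hx hχ ξ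
  refine T.hitSum_nonneg_of_clsHits (fun c η => ?_) ξ
  rcases h _ hχ η with h0 | ⟨A, B, t, hAB, h1⟩
  · simp [h0]
  · simp only [h1, zpow_add₀ hw0, zpow_natCast]
    refine h' A B t _ hAB ?_
    rw [← zpow_natCast, ← zpow_mul, mul_comm, zpow_mul, zpow_natCast, hw, one_zpow]

/-- The coefficient `-1` has to stand at the `i` with `w ^ i = 2`: this is `i = 1` for `w = 2` and
`i = 2` for `w = 4`. -/
lemma exists_heLPVector (T : IsType 5 7 3 α β) :
    ∃ w : ZMod 7, (∀ f : ZMod 7 →+* L, f w = (β : L) ^ 16) ∧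
      (w = 2 ∧ HeLPVector 3 α β 35 ![2, -1, 0] ∨ w = 4 ∧ HeLPVector 3 α β 35 ![2, 0, -1]) := by
  obtain ⟨w, hw, hf, h⟩ := exists_clsHits_eq_lineCount T.card_L T.gen_β
  refine ⟨w, hf, hw.imp ?_ ?_⟩
  · rintro rfl
    refine ⟨rfl, T.heLPVector_of_lineCount rfl h (by simp [Fin.sum_univ_three])
      fun A B t v hAB hv => ?_⟩
    have h1 := lineCount_two_mul_le A B t hAB v hv
    rw [mul_comm] at h1
    simp [Fin.sum_univ_three]
    omega
  · rintro rfl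
    refine ⟨rfl, T.heLPVector_of_lineCount rfl h (by simp [Fin.sum_univ_three])
      fun A B t v hAB hv => ?_⟩
    have h1 := lineCount_two_mul_le A B t hAB v hv
    rw [mul_comm, show (2 : ZMod 7) = 4 ^ 2 from rfl] at h1
    simp [Fin.sum_univ_three]
    omega

lemma inv {p q d : ℕ} (T : IsType p q d α β) : IsType p q d α⁻¹ β⁻¹ :=
  { T with
    gen_α := by rw [Subgroup.zpowers_inv, T.gen_α]
    gen_β := by rw [Subgroup.zpowers_inv, T.gen_β] }

lemma actGroup_inv (d : ℕ) (α : Kˣ) (β : Lˣ) : actGroup d α⁻¹ β⁻¹ = actGroup d α β := by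
  have h : ∀ (α : Kˣ) (β : Lˣ), actGroup d α⁻¹ β⁻¹ ≤ actGroup d α β := by
    intro α β σ hσ
    obtain ⟨i, j, hij, rfl⟩ := mem_actGroup.1 hσ
    refine mem_actGroup.2 ⟨-i, -j, ?_, by simp⟩
    rw [neg_sub_neg, ← neg_sub]
    exact hij.neg_right
  exact (h α β).antisymm (by simpa using h α⁻¹ β⁻¹)

/-- Inverting both generators preserves `H` and inverts `β ^ 16`, which exchanges `2` and `4` in the
field with seven elements. -/
lemma exists_generators_heLPVector (T : IsType 5 7 3 α β) :
    ∃ (α' : Kˣ) (β' : Lˣ), Subgroup.zpowers α' = ⊤ ∧ Subgroup.zpowers β' = ⊤ ∧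
      actGroup 3 α' β' = actGroup 3 α β ∧ HeLPVector 3 α' β' 35 ![2, 0, -1] := by
  obtain ⟨w, hf, h | h⟩ := T.exists_heLPVector
  · obtain ⟨w', hf', h' | h'⟩ := T.inv.exists_heLPVector
    · have := T.charP_L
      have h1 := hf (ZMod.castHom (dvd_refl 7) L)
      have h2 := hf' (ZMod.castHom (dvd_refl 7) L)
      rw [h.1] at h1
      rw [h'.1] at h2
      have h3 : ZMod.castHom (dvd_refl 7) L (2 * 2) = ZMod.castHom (dvd_refl 7) L 1 := by
        rw [map_mul, map_one]
        nth_rewrite 1 [h1]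
        rw [h2, ← mul_pow, Units.mul_inv, one_pow]
      have h4 := (ZMod.castHom (dvd_refl 7) L).injective h3
      exact absurd h4 (by decide)
    · exact ⟨α⁻¹, β⁻¹, T.inv.gen_α, T.inv.gen_β, actGroup_inv 3 α β, h'.2⟩
  · exact ⟨α, β, T.gen_α, T.gen_β, rfl, h.2⟩

lemma exists_heLPAdmissible_neg (T : IsType 5 7 3 α β) :
    ∃ ε, HeLPAdmissible (baseN 3 α β) 35 ε ∧ ∃ g, ε g < 0 := by
  obtain ⟨w, -, ⟨-, ε, hε, h⟩ | ⟨-, ε, hε, h⟩⟩ := T.exists_heLPVector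
  · exact ⟨ε, hε, _, (h 1).trans_lt (by simp)⟩
  · exact ⟨ε, hε, _, (h 2).trans_lt (by simp)⟩

end IsType

end TypeFiveSeven

/-! ### The algorithm for the groups `G_d(α, β)` -/

section Algorithm

variable {K L : Type*} [Field K] [Field L] {α : Kˣ} {β : Lˣ} {d : ℕ}

lemma baseN_comm {g h : Gd d α β} (hg : g ∈ baseN d α β) (hh : h ∈ baseN d α β) :
    g * h = h * g := by
  obtain ⟨z, rfl⟩ := hg
  obtain ⟨z', rfl⟩ := hh
  rw [← map_mul, mul_comm, map_mul]

instance isNilpotent_baseN : Group.IsNilpotent (baseN d α β) :=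
  let _ : CommGroup (baseN d α β) :=
    { (inferInstance : Group (baseN d α β)) with
      mul_comm := fun g h => Subtype.ext (baseN_comm g.2 h.2) }
  CommGroup.isNilpotent

lemma isPiElt_of_mem_hall_baseN {π : Set ℕ} {g : Gd d α β} (hg : g ∈ hall π (baseN d α β)) :
    IsPiElt π g :=
  isPiElt_of_mem_hall_of_comm (fun _ hx _ hy => baseN_comm (hall_le _ _ hx) (hall_le _ _ hy)) hg

/-- The local class of `1` is `{1}`, as automorphisms fix trivial primary parts. -/
lemma LocallyConj.eq_one {G M : Type*} [Group G] [Group M] {φ : G →* MulAut M} {x y : M}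
    (h1 : LocallyConj φ x 1) (h2 : LocallyConj φ x y) : y = 1 := by
  refine Subgroup.mem_bot.1 (mem_of_forall_piPart_mem fun r hr => Subgroup.mem_bot.2 ?_)
  obtain ⟨g, hg⟩ := h1 r hr
  obtain ⟨k, hk⟩ := h2 r hr
  have h3 : piPart {r} (1 : M) = 1 := one_pow _
  rw [h3, map_eq_one_iff _ (φ g).injective] at hg
  rw [← hk, hg, map_one]

namespace IsType

variable {p q : ℕ}

lemma mem_hall_compl_iff (T : IsType p q d α β) {g : Gd d α β} :
    g ∈ hall {q}ᶜ (baseN d α β) ↔ ∃ x : K, nElt d α β (Multiplicative.ofAdd (x, 0)) = g := by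
  classical
  constructor
  · intro h
    obtain ⟨z, rfl⟩ := hall_le _ _ h
    have h1 := isPiElt_of_mem_hall_baseN h
    induction z using Multiplicative.rec with | _ z => ?_
    obtain ⟨x, y⟩ := z
    by_cases hy : y = 0
    · exact ⟨x, by rw [hy]⟩
    · refine (h1 q T.prime_q ?_ rfl).elim
      rw [T.orderOf_nElt, if_neg hy]
      exact dvd_mul_left _ _
  · rintro ⟨x, rfl⟩
    refine mem_hall_of_isPiElt ⟨_, rfl⟩ fun r hr hd => ?_
    rw [T.orderOf_nElt, if_pos rfl, mul_one] at hd
    rintro rfl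
    split_ifs at hd
    · exact hr.one_lt.ne' (Nat.dvd_one.1 hd)
    · exact T.ne ((Nat.prime_dvd_prime_iff_eq hr T.prime_p).1 hd).symm

lemma exists_of_mem_hall (T : IsType p q d α β) {g : Gd d α β} (h : g ∈ hall {q} (baseN d α β)) :
    ∃ y : L, nElt d α β (Multiplicative.ofAdd (0, y)) = g := by
  classical
  obtain ⟨z, rfl⟩ := hall_le _ _ h
  have h1 := isPiElt_of_mem_hall_baseN h
  induction z using Multiplicative.rec with | _ z => ?_
  obtain ⟨x, y⟩ := z
  by_cases hx : x = 0
  · exact ⟨y, by rw [hx]⟩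
  · refine (T.ne (h1 p T.prime_p ?_)).elim
    rw [T.orderOf_nElt, if_neg hx]
    exact dvd_mul_right _ _

lemma pow_eq_one_of_mem_hall_compl (T : IsType p q d α β) (a : hall {q}ᶜ (baseN d α β)) :
    a ^ p = 1 := by
  obtain ⟨x, hx⟩ := T.mem_hall_compl_iff.1 a.2
  have := T.charP_K
  refine Subtype.ext ?_
  rw [Subgroup.coe_pow, ← hx, ← map_pow, ← ofAdd_nsmul, Prod.smul_mk, smul_zero, nsmul_eq_mul,
    CharP.cast_eq_zero, zero_mul]
  rfl

lemma card_hall_compl (T : IsType p q d α β) : Nat.card (hall {q}ᶜ (baseN d α β)) = p ^ 2 := by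
  rw [← T.card_K]
  refine (Nat.card_congr (Equiv.ofBijective
    (fun x : K => ⟨nElt d α β (Multiplicative.ofAdd (x, 0)), T.mem_hall_compl_iff.2 ⟨x, rfl⟩⟩)
    ⟨fun x y h => ?_, ?_⟩)).symm
  · have h1 := SemidirectProduct.inl_injective (congrArg Subtype.val h)
    exact congrArg (fun z => (Multiplicative.toAdd z).1) h1
  · rintro ⟨a, ha⟩
    obtain ⟨x, hx⟩ := T.mem_hall_compl_iff.1 ha
    exact ⟨x, Subtype.ext hx⟩

/-- In a group of order `p ^ 2` and exponent `p` the subgroups of order `p` are the minimal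
subgroups with cyclic quotient. -/
lemma minimal_isCocyclic {A : Type*} [Group A] {p : ℕ} (hp : p.Prime)
    (hcard : Nat.card A = p ^ 2) (hexp : ∀ a : A, a ^ p = 1) {b : A} (hb : b ≠ 1) :
    Minimal IsCocyclic (Subgroup.zpowers b) := by
  have : Fact p.Prime := ⟨hp⟩
  have : Finite A := Nat.finite_of_card_ne_zero (by rw [hcard]; exact pow_ne_zero 2 hp.ne_zero)
  have hcomm : ∀ x y : A, x * y = y * x := (IsPGroup.isMulCommutative_of_card_eq_prime_sq hcard).1.1
  have hK : Nat.card (Subgroup.zpowers b) = p := by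
    rw [Nat.card_zpowers]
    exact orderOf_eq_prime (hexp b) hb
  have hquot : ∀ J : Subgroup A, Nat.card (A ⧸ J) * Nat.card J = p ^ 2 := fun J => by
    rw [← hcard, J.card_eq_card_quotient_mul_card_subgroup]
  have hnormal : (Subgroup.zpowers b).Normal :=
    ⟨fun n hn g => by rwa [hcomm g n, mul_inv_cancel_right]⟩
  refine ⟨⟨hnormal, ?_⟩, ?_⟩
  · refine isCyclic_of_prime_card (p := p) ?_
    have h1 := hquot (Subgroup.zpowers b)
    rw [hK, pow_two] at h1
    exact Nat.eq_of_mul_eq_mul_right hp.pos h1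
  · rintro J ⟨hJ, hcyc⟩ hle
    obtain ⟨g, hg⟩ := hcyc.exists_ofOrder_eq_natCard
    -- A cyclic quotient of a group of exponent `p` has order dividing `p`, so `J` cannot be smaller
    -- than the subgroup of order `p` containing it.
    have h1 : Nat.card (A ⧸ J) ∣ p := by
      rw [← hg, orderOf_dvd_iff_pow_eq_one]
      obtain ⟨a, rfl⟩ := QuotientGroup.mk_surjective g
      rw [← QuotientGroup.mk_pow, hexp, QuotientGroup.mk_one]
    have h2 : p ≤ Nat.card J := by
      have h3 := hquot J
      have h4 := Nat.le_of_dvd hp.pos h1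
      by_contra! h5
      nlinarith [hp.pos]
    exact (Subgroup.eq_of_le_of_card_ge hle (hK.trans_le h2)).ge

/-- If `d` is coprime to `p - 1`, the units of the prime field are powers of `α ^ d`. -/
lemma dvd_of_zpow_eq_intCast (T : IsType p q d α β) (hd : d.Coprime (p - 1)) {i k : ℤ}
    (h : ((α ^ i : Kˣ) : K) = k) : (d : ℤ) ∣ i := by
  have := T.charP_K
  have := Fact.mk T.prime_p
  have h1 : (α ^ i) ^ p = α ^ i := by
    refine Units.ext ?_
    rw [Units.val_pow_eq_pow_val, h]
    exact map_intCast (frobenius K p) k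
  have h2 : α ^ (i * (p - 1 : ℕ)) = 1 := by
    refine mul_right_cancel (b := α ^ i) ?_
    rw [zpow_mul, zpow_natCast, ← pow_succ, Nat.sub_add_cancel T.prime_p.one_le, one_mul, h1]
  exact IsCoprime.dvd_of_dvd_mul_right (Nat.isCoprime_iff_coprime.2 hd) (T.dvd_of_zpow_α_eq_one h2)

lemma apply_eq_of_mem_zpowers (T : IsType p q d α β) (hd : d.Coprime (p - 1)) {y : Gd d α β}
    (hy : y ∈ hall {q} (baseN d α β)) {f : hall {q}ᶜ (baseN d α β) → ℤ}
    (hf : ∀ h ∈ Subgroup.centralizer {y}, ∀ a, f (MulAut.conjNormal h a) = f a)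
    {a c : hall {q}ᶜ (baseN d α β)} (hc : c ∈ Subgroup.zpowers a) (hc1 : c ≠ 1) : f c = f a := by
  obtain ⟨k, rfl⟩ := hc
  obtain ⟨y, rfl⟩ := T.exists_of_mem_hall hy
  obtain ⟨x, hx⟩ := T.mem_hall_compl_iff.1 a.2
  have hk : (k : K) ≠ 0 := by
    intro hk
    refine hc1 (Subtype.ext ?_)
    change ((a ^ k : hall {q}ᶜ (baseN d α β)) : Gd d α β) = 1
    rw [Subgroup.coe_zpow, ← hx, ← map_zpow, ← ofAdd_zsmul, Prod.smul_mk, smul_zero, zsmul_eq_mul,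
      hk, zero_mul]
    rfl
  obtain ⟨i, hi⟩ := T.exists_zpow_α hk
  -- The scalar `k` on the first component alone belongs to `H` because `d` divides `i`; acting
  -- trivially on the second component, it centralizes `y`.
  have hσ : scaleHom (α ^ i, β ^ (0 : ℤ)) ∈ actGroup d α β :=
    mem_actGroup.2 ⟨i, 0, by simpa using T.dvd_of_zpow_eq_intCast hd hi, rfl⟩
  rw [← hf (SemidirectProduct.inr ⟨_, hσ⟩) ?_ a]
  · congr 1
    refine Subtype.ext ?_
    change ((a ^ k : hall {q}ᶜ (baseN d α β)) : Gd d α β) = _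
    rw [MulAut.conjNormal_apply, Subgroup.coe_zpow, ← hx, conj_nElt, ← map_zpow, ← ofAdd_zsmul,
      Prod.smul_mk, smul_zero, zsmul_eq_mul, SemidirectProduct.right_inr, scaleHom_apply]
    simp only [toAdd_ofAdd, mul_zero]
    rw [hi]
  · rw [Subgroup.mem_centralizer_singleton_iff, ← mul_inv_eq_iff_eq_mul, conj_nElt,
      SemidirectProduct.right_inr, scaleHom_apply]
    simp

/-- The algorithm with input `G_d(α, β)`, `N`, `q` returns `true` if `d` is coprime to `p - 1`. -/
theorem algOutput_eq_empty (T : IsType p q d α β) (hd : d.Coprime (p - 1)) :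
    algOutput (baseN d α β) q = ∅ := by
  rw [Set.eq_empty_iff_forall_notMem]
  rintro ε ⟨y, hy, f, hf, -, -⟩
  have := T.finite_Gd
  obtain ⟨a, ha⟩ := hf.negative
  obtain ⟨a₀, ha₀⟩ := hf.support
  have hp := T.prime_p.one_lt
  have hnt : Nontrivial (hall {q}ᶜ (baseN d α β)) :=
    Finite.one_lt_card_iff_nontrivial.1 (by rw [T.card_hall_compl]; nlinarith)
  -- A line on which `f` is nowhere positive. If `a = 1`, then `f` lives on `{1}` and any line will
  -- do. Otherwise take the line of `a`: `f` equals `f a` off `1`, and `f 1` cannot be positive by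
  -- (II).
  have key : ∃ b : hall {q}ᶜ (baseN d α β), b ≠ 1 ∧ a ∈ Subgroup.zpowers b ∧
      ∀ c ∈ Subgroup.zpowers b, f c ≤ 0 := by
    by_cases h1 : a = 1
    · obtain ⟨b, hb⟩ := exists_ne (1 : hall {q}ᶜ (baseN d α β))
      refine ⟨b, hb, h1 ▸ Subgroup.one_mem _, fun c _ => ?_⟩
      subst h1
      by_contra! hc
      have h2 := LocallyConj.eq_one (ha₀ _ ha.ne) (ha₀ c hc.ne')
      rw [h2] at hc
      exact lt_asymm ha hc
    · refine ⟨a, h1, Subgroup.mem_zpowers a, fun c hc => ?_⟩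
      by_cases hc1 : c = 1
      · by_contra! h
        rw [hc1] at h
        exact h1 (LocallyConj.eq_one (ha₀ _ h.ne') (ha₀ a ha.ne))
      · rw [T.apply_eq_of_mem_zpowers hd hy hf.classFun hc hc1]
        exact ha.le
  obtain ⟨b, hb, hab, hc⟩ := key
  have h1 := hf.cosetIneq _ (minimal_isCocyclic T.prime_p T.card_hall_compl
    T.pow_eq_one_of_mem_hall_compl hb) 1
  rw [finsum_mem_eq_finite_toFinset_sum _ (Set.toFinite _)] at h1
  refine h1.not_gt (Finset.sum_neg' (fun c h => ?_) ⟨a, ?_, ?_⟩)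
  · exact mul_nonpos_of_nonneg_of_nonpos (by positivity) (hc c (by simpa using h))
  · simpa using hab
  · exact mul_neg_of_pos_of_neg (by exact_mod_cast Nat.card_pos) ha

/-- The list is empty, so only characteristic functions of classes remain on the left, and these
have no negative values. -/
lemma algAdmissible_ssubset (T : IsType 5 7 3 α β) :
    {ε | AlgAdmissible (baseN 3 α β) 7 ε} ⊂ {ε | ∃ n, HeLPAdmissible (baseN 3 α β) n ε} := by
  have := T.finite_Gd
  refine ⟨fun ε h => heLPAdmissible_of_algAdmissible T.prime_q
    (fun x hx y hy => baseN_comm (hall_le _ _ hx) (hall_le _ _ hy)) h, fun hsub => ?_⟩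
  obtain ⟨ε, hε, g, hg⟩ := T.exists_heLPAdmissible_neg
  rcases hsub ⟨35, hε⟩ with ⟨n, -, rfl⟩ | h
  · revert hg
    simp only
    split_ifs <;> simp
  · rw [T.algOutput_eq_empty (by decide)] at h
    exact h

end IsType

end Algorithm
end ZGUnits

end

open ZGUnits in
theorem mainTheorem7 :
    -- the HeLP restrictions for groups of type `G_d(p, q)` reduce to the character `χ_0`
    (∀ (p q d : ℕ), p.Prime → q.Prime → p ≠ q → d ∣ p ^ 2 - 1 → d ∣ q ^ 2 - 1 →
      Nat.Coprime d (Nat.gcd (p + 1) (q + 1)) →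
      ∀ (K : Type*) (L : Type*) [Field K] [Field L], Nat.card K = p ^ 2 → Nat.card L = q ^ 2 →
      ∀ (α : Kˣ) (β : Lˣ), Subgroup.zpowers α = ⊤ → Subgroup.zpowers β = ⊤ →
      ∀ (ζp ζq : ℂ), IsPrimitiveRoot ζp p → IsPrimitiveRoot ζq q →
        (∃ ψ, IsPsiZero α β ζp ζq ψ) ∧
        ∀ ψ, IsPsiZero α β ζp ζq ψ → ∀ x : Fin d → ℤ,
          (HeLPVector d α β (p * q) x ↔
            ∀ (r : ℕ) (ρ : Representation ℂ (Gd d α β) (Fin r → ℂ)),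
              CharIneq d α β (p * q) x ρ) ∧
          (HeLPVector d α β (p * q) x ↔ CharIneq d α β (p * q) x (chiRep d α β ψ))) ∧
    -- the HeLP method fails for the groups of type `G_3(5, 7)`, and the algorithm does not
    (∀ (K : Type*) (L : Type*) [Field K] [Field L], Nat.card K = 5 ^ 2 → Nat.card L = 7 ^ 2 →
      ∀ (α : Kˣ) (β : Lˣ), Subgroup.zpowers α = ⊤ → Subgroup.zpowers β = ⊤ →
        ¬ HeLPSolves (baseN 3 α β) 35 ∧
        (HeLPVector 3 α β 35 ![2, 0, -1] ∨ HeLPVector 3 α β 35 ![2, -1, 0]) ∧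
        (∃ (α' : Kˣ) (β' : Lˣ), Subgroup.zpowers α' = ⊤ ∧ Subgroup.zpowers β' = ⊤ ∧
          actGroup 3 α' β' = actGroup 3 α β ∧ HeLPVector 3 α' β' 35 ![2, 0, -1]) ∧
        algOutput (baseN 3 α β) 7 = ∅ ∧
        {ε | AlgAdmissible (baseN 3 α β) 7 ε} ⊂ {ε | ∃ n, HeLPAdmissible (baseN 3 α β) n ε}) ∧
    -- the restrictions of the algorithm are always at least as strong as those of the HeLP method
    (∀ (G : Type*) [Group G] [Finite G] (N : Subgroup G) [N.Normal] [Group.IsNilpotent N] (p : ℕ),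
      p.Prime → (∀ x ∈ hall {p}ᶜ N, ∀ y ∈ hall {p}ᶜ N, x * y = y * x) →
      ∀ ε : G → ℤ, AlgAdmissible N p ε → ∃ n, HeLPAdmissible N n ε) := by

  refine ⟨?_, ?_, ?_⟩
  · intro p q d hp hq hpq hdp hdq hd K L _ _ hK hL α β hα hβ ζp ζq hζp hζq
    have T : IsType p q d α β := ⟨hp, hq, hpq, hdp, hdq, hK, hL, hα, hβ⟩
    exact ⟨T.exists_isPsiZero hζp hζq, fun ψ hψ x => T.heLPVector_iff hd hψ x⟩
  · intro K L _ _ hK hL α β hα hβ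
    have T : IsType 5 7 3 α β := ⟨by norm_num, by norm_num, by norm_num, by norm_num, by norm_num,
      hK, hL, hα, hβ⟩
    refine ⟨fun h => ?_, ?_, T.exists_generators_heLPVector, T.algOutput_eq_empty (by decide),
      T.algAdmissible_ssubset⟩
    · obtain ⟨ε, hε, g, hg⟩ := T.exists_heLPAdmissible_neg
      exact (h ε hε g).not_gt hg
    · obtain ⟨w, -, h | h⟩ := T.exists_heLPVector
      exacts [Or.inr h.2, Or.inl h.2]
  · intro G _ _ N _ _ p hp hc ε h
    exact heLPAdmissible_of_algAdmissible hp hc h
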